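/- Let $M$ be a compact Polish (i.e. compact metrizable) space with its Borel $\sigma$-algebra and let $P(x,\cdot)$ be a transition probability on $M$ with $n$-step transition probabilities $P(n,x,\cdot)$. Assume that for some integer $n_0>0$, some constant $C>0$ and some probability measure $\nu$ on $M$, $$C^{-1}\nu(G)\le P(n_0,x,G)\le C\nu(G)\qquad\text{for all }x\in M\text{ and all measurable }G\subset M,$$ and let $\mu$ be the invariant probability measure of $P$. Let $X(0),X(1),\dots$ be a Markov chain with transition probability $P(x,\cdot)$ and an arbitrary initial distribution, on a probability space with probability $P$, and let $E_x$ denote expectation for the chain started at $x$. Let $\ell\ge1$ and let $q_1,\dots,q_\ell$ be positive increasing functions on $(0,\infty)$, taking integer values at the positive integers, such that $q_1(n)=n$ for integers $n\ge1$ and, for $j=2,\dots,\ell$ and every $\gamma>0$, $$\lim_{n\to\infty}(q_j(n)-q_j(n-1))=\infty,\qquad \liminf_{n\to\infty}(q_j(\gamma n)-q_{j-1}(n))>0 .$$ For $N\ge1$ set $\zeta_N=\frac1N\sum_{n=1}^N\delta_{(X(q_1(n)),\dots,X(q_\ell(n)))}$. Let $\mathcal P(M^\ell)$ be the space of Borel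 probability measures on $M^\ell$ with the topology of weak convergence, and for $\eta\in\mathcal P(M^\ell)$ put $$I(\eta)=-\inf_{u}\int_{M^\ell}\ln\frac{E_{x_1}\int u(X(1),x_2,\dots,x_\ell)\,d\mu(x_2)\cdots d\mu(x_\ell)}{u(x_1,\dots,x_\ell)}\,d\eta(x_1,\dots,x_\ell),$$ the infimum being over all positive continuous functions $u$ on $M^\ell$. **Theorem.** For every continuous $W:M^\ell\to\mathbb R$ and every $x\in M$ the limit $$Q(W)=\lim_{N\to\infty}\frac1N\ln E_x\exp\Big(\sum_{n=1}^N W(X(q_1(n)),\dots,X(q_\ell(n)))\Big)$$ exists, is finite and does not depend on $x$. The functional $Q$ on the space of continuous functions on $M^\ell$ (with the supremum norm) is convex and lower semicontinuous, and $$Q(W)=\sup_{\eta\in\mathcal P(M^\ell)}\Big(\int W\,d\eta-I(\eta)\Big).$$ Moreover, for every closed $K\subset\mathcal P(M^\ell)$, $$\limsup_{N\to\infty}\frac1N\ln P\{\zeta_N\in K\}\le-\inf_{\eta\in K}I(\eta),$$ and for every open $U\subset\mathcal P(M^\ell)$, $$\liminf_{N\to\infty}\frac1N\ln P\{\zeta_N\in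 U\}\ge-\inf_{\eta\in U}I(\eta),$$ with the conventions $\ln 0=-\infty$ and $\inf\emptyset=+\infty$. -/

import Mathlib

open MeasureTheory ProbabilityTheory Filter Topology
open scoped NNReal ENNReal

namespace Nonconventional

noncomputable section

/-- `X(0), X(1), …` is a (time homogeneous) Markov chain on the probability space `(Ω, P)` with
one-step transition probability `κ`, and with an arbitrary initial distribution:
`P(X(n+1) ∈ G | X(0), …, X(n)) = κ(X(n), G)` almost surely. -/
structure IsMarkovChain {Ω M : Type*} [MeasurableSpace Ω] [MeasurableSpace M]
    (κ : Kernel M M) (P : Measure Ω) (X : ℕ → Ω → M) : Prop where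
  measurable : ∀ n, Measurable (X n)
  markov : ∀ (n : ℕ) (G : Set M), MeasurableSet G →
    P⟦X (n + 1) ⁻¹' G | ⨆ i ≤ n, MeasurableSpace.comap (X i) inferInstance⟧
      =ᵐ[P] fun ω => (κ (X n ω)).real G

/-- The probability `P_x` on the path space `ℕ → M`: the law of the Markov chain with one-step
transition probability `κ` started at `x`. -/
def pathMeasure {M : Type*} [MeasurableSpace M] (κ : Kernel M M) [IsMarkovKernel κ] (x : M) :
    Measure (ℕ → M) :=
  Kernel.trajMeasure (X := fun _ => M) (Measure.dirac x)
    (fun n => κ.comap (fun h : (Π _ : Finset.Iic n, M) => h ⟨n, Finset.mem_Iic.2 le_rfl⟩)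
      (measurable_pi_apply _))

/-- The strong Doeblin condition: for some `n₀ > 0`, `C > 0` and some probability measure `ν`,
`C⁻¹ ν(G) ≤ P(n₀, x, G) ≤ C ν(G)` for all points `x` and all measurable sets `G`. -/
def StrongDoeblin {M : Type*} [MeasurableSpace M] (κ : Kernel M M) : Prop :=
  ∃ n₀ : ℕ, 0 < n₀ ∧ ∃ C : ℝ≥0, 0 < C ∧ ∃ ν : Measure M, IsProbabilityMeasure ν ∧
    ∀ (x : M) (G : Set M), MeasurableSet G →
      ((C⁻¹ : ℝ≥0) : ℝ≥0∞) * ν G ≤ (κ ^ n₀) x G ∧ (κ ^ n₀) x G ≤ (C : ℝ≥0∞) * ν G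

/-- The conditions on the time changes `q₁, …, q_ℓ` with `ℓ = m + 1` and `k = 1`
(the index `j : Fin (m + 1)` stands for `q_{j+1}`): they are positive increasing functions of a
positive real argument, integer valued at integers, `q₁(n) = n`, and for every later index
`q_j(n) - q_j(n-1) → ∞` and `liminf (q_j(γ n) - q_{j-1}(n)) > 0` for each `γ > 0`. -/
structure TimeChanges {m : ℕ} (q : Fin (m + 1) → ℝ → ℝ) : Prop where
  pos : ∀ j, ∀ t : ℝ, 0 < t → 0 < q j t
  mono : ∀ j, MonotoneOn (q j) (Set.Ioi 0)
  integer : ∀ j, ∀ n : ℕ, 0 < n → ∃ i : ℕ, q j n = i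
  first : ∀ n : ℕ, 0 < n → q 0 n = n
  gaps : ∀ j : Fin m, Tendsto (fun n : ℕ => q j.succ n - q j.succ ((n : ℝ) - 1)) atTop atTop
  spread : ∀ j : Fin m, ∀ γ : ℝ, 0 < γ →
    0 < liminf (fun n : ℕ => ((q j.succ (γ * n) - q j.castSucc n : ℝ) : EReal)) atTop

/-- The point `(X(q₁(n)), …, X(q_ℓ(n)))` of `M^ℓ` for a trajectory `w = (X(0), X(1), …)`. -/
def samplePoint {M : Type*} {m : ℕ} (q : Fin (m + 1) → ℝ → ℝ) (w : ℕ → M) (n : ℕ) :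
    Fin (m + 1) → M :=
  fun j => w ⌊q j n⌋₊

/-- The occupational measure `ζ_N = N⁻¹ ∑_{n=1}^N δ_{(X(q₁(n)), …, X(q_ℓ(n)))}` on `M^ℓ` of a
trajectory `w` (a probability measure for `N ≥ 1`). -/
def occupationalMeasure {M : Type*} [MeasurableSpace M] {m : ℕ} (q : Fin (m + 1) → ℝ → ℝ)
    (w : ℕ → M) (N : ℕ) : Measure (Fin (m + 1) → M) :=
  (N : ℝ≥0∞)⁻¹ • ∑ n ∈ Finset.Icc 1 N, Measure.dirac (samplePoint q w n)

/-- `E_{x₁} ∫ u(X(1), x₂, …, x_ℓ) dμ(x₂) … dμ(x_ℓ)` as a function of `x = (x₁, …, x_ℓ)`. -/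
def transitionMean {M : Type*} [MeasurableSpace M] {m : ℕ} (κ : Kernel M M) (μ : Measure M)
    (u : (Fin (m + 1) → M) → ℝ) (x : Fin (m + 1) → M) : ℝ :=
  ∫ y, (∫ z, u (Fin.cons (α := fun _ => M) y z) ∂(Measure.pi fun _ : Fin m => μ)) ∂(κ (x 0))

/-- The rate functional `I(η) = - inf_u ∫ ln (transitionMean u / u) dη`, the infimum being taken
over the positive continuous functions `u` on `M^ℓ`; its values lie in `[-∞, ∞]`. -/
def rate {M : Type*} [TopologicalSpace M] [MeasurableSpace M] {m : ℕ} (κ : Kernel M M)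
    (μ : Measure M) (η : Measure (Fin (m + 1) → M)) : EReal :=
  -⨅ u : {u : C(Fin (m + 1) → M, ℝ) // ∀ x, 0 < u x},
    ((∫ x, Real.log (transitionMean κ μ u.1 x / u.1 x) ∂η : ℝ) : EReal)

end

end Nonconventional

/-!
Large deviations for the occupational measures of `(X(q₁(n)), …, X(q_ℓ(n)))`, with `X` a Markov
chain satisfying the strong Doeblin condition.

*Decoupling.* After the first `ε N` terms are dropped, the times `q_j(n)` with `j ≥ 2`, `n ≤ N`, are
distinct, lie beyond `N`, and are as far apart from each other and from `[0, N]` as one likes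
(`TimeChanges.eventually_gaps`). By the strong Doeblin condition the transition probability over
many steps lies between `(1 - ε) μ` and `(1 + ε) μ` (`StrongDoeblin.exists_mixing`), so the states
at these times may be replaced by independent `μ`-distributed ones at the cost of a factor
`e^{O(ε N)}` (`lintegral_prod_sample_between`). The exponential moments thus grow like those of the
Markov chain `(X(n), Z₂(n), …, Z_ℓ(n))` with independent `μ`-distributed `Z_j(n)`, whose kernel is
`productKernel`; the functional `I` is exactly its Donsker–Varadhan functional
(`dvRate_productKernel`).

*Principal eigenvalue.* A power of the Feynman–Kac operator `f ↦ T (e^W f)` of this chain satisfies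
a Harnack inequality, and therefore contracts the oscillation of ratios of functions
(`PositiveOperator.contract`). This yields a positive eigenfunction (`exists_isEigen`), and the
number `Q W`, the logarithm of its eigenvalue, is the limit of the logarithmic moments
(`tendsto_log_moment`). The kernel need not be Feller, so the eigenfunction is only bounded and
measurable; Lusin-type approximation shows that nothing is lost by testing with continuous functions
(`neg_integral_le_dvRate`).

*Duality.* Testing `I` with `e^W h`, `h` the eigenfunction, gives `∫ W dη - Q W ≤ I η`; the
potential `ln (u / T u)`, which has eigenvalue one, gives the converse, so that `I` is the convex
conjugate of `Q` (`dvRate_le_iSup`). Moreover a potential has at most one equilibrium state, a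
measure with `I η = ∫ W dη - Q W`: such a measure is invariant under the normalized tilted operator,
whose powers converge to constants (`equilibrium_unique`).

*Large deviations.* The space of probability measures is compact, so each bound only involves
finitely many functions `V`, and all estimates come from Chebyshev's inequality for the exponential
moments of these. This gives the upper bound (`IsConjugate.limsup_le`), the variational formula for
`Q` (`IsConjugate.eq_iSup_sub`), and the lower bound near equilibrium states
(`IsConjugate.eventually_le_of_equilibrium`), where uniqueness is what confines the tilted moments
to any neighbourhood. Finally each open set containing `η` contains an equilibrium state `η'` with
`I η' ≤ I η`, namely a minimiser of `I` plus a large multiple of a squared distance to `η`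
(`IsConjugate.exists_equilibrium`), which gives the lower bound in general
(`IsConjugate.le_liminf`).
-/

namespace Nonconventional

/-! ### Positive operators on bounded measurable functions -/

/-- A bounded measurable real function. -/
structure BddMeas {E : Type*} [MeasurableSpace E] (f : E → ℝ) : Prop where
  measurable : Measurable f
  bounded : ∃ C, ∀ x, |f x| ≤ C

namespace BddMeas

variable {E : Type*} [MeasurableSpace E] {f g : E → ℝ}

lemma of_mem_Icc {a b : ℝ} (hf : Measurable f) (h : ∀ x, f x ∈ Set.Icc a b) : BddMeas f :=
  ⟨hf, max |a| |b|, fun x => abs_le_max_abs_abs (h x).1 (h x).2⟩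

lemma const (c : ℝ) : BddMeas (fun _ : E => c) := ⟨measurable_const, |c|, fun _ => le_rfl⟩

lemma add (hf : BddMeas f) (hg : BddMeas g) : BddMeas (fun x => f x + g x) := by
  obtain ⟨C, hC⟩ := hf.bounded
  obtain ⟨D, hD⟩ := hg.bounded
  exact ⟨hf.measurable.add hg.measurable, C + D,
    fun x => (abs_add_le _ _).trans (add_le_add (hC x) (hD x))⟩

lemma mul (hf : BddMeas f) (hg : BddMeas g) : BddMeas (fun x => f x * g x) := by
  obtain ⟨C, hC⟩ := hf.bounded
  obtain ⟨D, hD⟩ := hg.bounded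
  refine ⟨hf.measurable.mul hg.measurable, C * D, fun x => ?_⟩
  rw [abs_mul]
  exact mul_le_mul (hC x) (hD x) (abs_nonneg _) ((abs_nonneg _).trans (hC x))

lemma const_mul (c : ℝ) (hf : BddMeas f) : BddMeas (fun x => c * f x) := (const c).mul hf

lemma sub (hf : BddMeas f) (hg : BddMeas g) : BddMeas (fun x => f x - g x) := by
  simpa [sub_eq_add_neg] using hf.add (hg.const_mul (-1))

lemma exp (hf : BddMeas f) : BddMeas (fun x => Real.exp (f x)) := by
  obtain ⟨C, hC⟩ := hf.bounded
  exact of_mem_Icc (a := 0) (b := Real.exp C) hf.measurable.exp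
    fun x => ⟨(Real.exp_pos _).le, Real.exp_le_exp.2 ((le_abs_self _).trans (hC x))⟩

lemma log {c : ℝ} (hc : 0 < c) (hf : BddMeas f) (h : ∀ x, c ≤ f x) :
    BddMeas (fun x => Real.log (f x)) := by
  obtain ⟨C, hC⟩ := hf.bounded
  exact of_mem_Icc (a := Real.log c) (b := Real.log C) hf.measurable.log
    fun x => ⟨Real.log_le_log hc (h x), Real.log_le_log (hc.trans_le (h x))
      ((le_abs_self _).trans (hC x))⟩

lemma inv {c : ℝ} (hc : 0 < c) (hf : BddMeas f) (h : ∀ x, c ≤ f x) :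
    BddMeas (fun x => (f x)⁻¹) :=
  of_mem_Icc (a := 0) (b := c⁻¹) hf.measurable.inv
    fun x => ⟨inv_nonneg.2 (hc.le.trans (h x)), inv_anti₀ hc (h x)⟩

lemma div {c : ℝ} (hc : 0 < c) (hf : BddMeas f) (hg : BddMeas g) (h : ∀ x, c ≤ g x) :
    BddMeas (fun x => f x / g x) := by
  simpa [div_eq_mul_inv] using hf.mul (hg.inv hc h)

lemma integrable (hf : BddMeas f) (η : Measure E) [IsFiniteMeasure η] : Integrable f η := by
  obtain ⟨C, hC⟩ := hf.bounded
  exact Integrable.of_bound hf.measurable.aestronglyMeasurable C (ae_of_all _ hC)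

lemma comp {F : Type*} [MeasurableSpace F] (hf : BddMeas f) {φ : F → E} (hφ : Measurable φ) :
    BddMeas (fun x => f (φ x)) :=
  ⟨hf.measurable.comp hφ, hf.bounded.imp fun _ h x => h (φ x)⟩

end BddMeas

/-- A linear positivity preserving map of the space of bounded measurable functions. It is
encoded as a map of all functions, about which only its values at bounded measurable functions
matter. -/
structure PositiveOperator {E : Type*} [MeasurableSpace E] (K : (E → ℝ) → E → ℝ) : Prop where
  bddMeas : ∀ {f}, BddMeas f → BddMeas (K f)
  linear : ∀ {f g}, BddMeas f → BddMeas g → ∀ a b x,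
    K (fun y => a * f y + b * g y) x = a * K f x + b * K g x
  nonneg : ∀ {f}, BddMeas f → (∀ x, 0 ≤ f x) → ∀ x, 0 ≤ K f x

/-- The Harnack-type inequality `K f x ≤ D K f x'` for all points `x, x'` and all nonnegative
bounded measurable `f`. -/
def Comparable {E : Type*} [MeasurableSpace E] (K : (E → ℝ) → E → ℝ) (D : ℝ) : Prop :=
  ∀ {f}, BddMeas f → (∀ x, 0 ≤ f x) → ∀ x x', K f x ≤ D * K f x'

namespace PositiveOperator

variable {E : Type*} [MeasurableSpace E] {K : (E → ℝ) → E → ℝ}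

lemma const_mul (hK : PositiveOperator K) {f : E → ℝ} (hf : BddMeas f) (a : ℝ) (x : E) :
    K (fun y => a * f y) x = a * K f x := by
  simpa using hK.linear hf hf a 0 x

lemma sub (hK : PositiveOperator K) {f g : E → ℝ} (hf : BddMeas f) (hg : BddMeas g) (a : ℝ)
    (x : E) : K (fun y => f y - a * g y) x = K f x - a * K g x := by
  simpa [sub_eq_add_neg] using hK.linear hf hg 1 (-a) x

lemma mono (hK : PositiveOperator K) {f g : E → ℝ} (hf : BddMeas f) (hg : BddMeas g)
    (h : ∀ x, f x ≤ g x) (x : E) : K f x ≤ K g x := by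
  have := hK.nonneg (hg.sub (hf.const_mul 1)) (fun x => by simpa using h x) x
  rw [hK.sub hg hf] at this
  linarith

lemma iterate (hK : PositiveOperator K) (n : ℕ) : PositiveOperator K^[n] := by
  induction n with
  | zero => exact ⟨fun h => h, fun _ _ _ _ _ => rfl, fun _ h => h⟩
  | succ n ih =>
    refine ⟨fun h => ?_, fun {f g} hf hg a b x => ?_, fun hf h => ?_⟩
    · rw [Function.iterate_succ_apply']
      exact hK.bddMeas (ih.bddMeas h)
    · rw [Function.iterate_succ_apply', Function.iterate_succ_apply', Function.iterate_succ_apply',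
        ← hK.linear (ih.bddMeas hf) (ih.bddMeas hg)]
      congr 1
      exact funext fun y => ih.linear hf hg a b y
    · rw [Function.iterate_succ_apply']
      exact hK.nonneg (ih.bddMeas hf) (ih.nonneg hf h)

lemma iterate_eigen (hK : PositiveOperator K) {h : E → ℝ} (hh : BddMeas h) {r : ℝ}
    (he : ∀ x, K h x = r * h x) (n : ℕ) (x : E) : K^[n] h x = r ^ n * h x := by
  induction n generalizing x with
  | zero => simp
  | succ n ih =>
    rw [Function.iterate_succ_apply', show K^[n] h = fun y => r ^ n * h y from funext ih,
      hK.const_mul hh, he, pow_succ]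
    ring

lemma lower (hK : PositiveOperator K) {c δ : ℝ} (hδ : ∀ x, δ ≤ K (fun _ => 1) x) {f : E → ℝ}
    (hf : BddMeas f) (hc : 0 ≤ c) (h : ∀ x, c ≤ f x) (x : E) : c * δ ≤ K f x := by
  have h1 := hK.mono ((BddMeas.const (1 : ℝ)).const_mul c) hf (fun x => by simpa using h x) x
  rw [hK.const_mul (BddMeas.const 1)] at h1
  exact (mul_le_mul_of_nonneg_left (hδ x) hc).trans h1

lemma iterate_lower (hK : PositiveOperator K) {δ : ℝ} (h0 : 0 ≤ δ)
    (hδ : ∀ x, δ ≤ K (fun _ => 1) x) (n : ℕ) (x : E) : δ ^ n ≤ K^[n] (fun _ => 1) x := by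
  induction n generalizing x with
  | zero => simp
  | succ n ih =>
    rw [Function.iterate_succ_apply', pow_succ]
    exact hK.lower hδ ((hK.iterate n).bddMeas (BddMeas.const 1)) (pow_nonneg h0 n) ih x

/-- One step of the contraction of the projective oscillation: a comparable positive operator
shrinks the interval in which the ratio of two functions lies by the factor `1 - D⁻²`. -/
lemma contract_step (hK : PositiveOperator K) {D : ℝ} (hD : 1 ≤ D) (hc : Comparable K D)
    {f g : E → ℝ} (hf : BddMeas f) (hg : BddMeas g) (hg0 : ∀ x, 0 ≤ g x) {a b : ℝ}
    (hKg : ∀ x, 0 < K g x) (ha : ∀ x, a * g x ≤ f x) (hb : ∀ x, f x ≤ b * g x) (x0 : E) :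
    ∃ a' b', b' - a' = (1 - (D ^ 2)⁻¹) * (b - a) ∧
      ∀ x, a' * K g x ≤ K f x ∧ K f x ≤ b' * K g x := by
  have hD0 : 0 < D := by linarith
  set r := K f x0 / K g x0 with hr
  have hrK : K f x0 = r * K g x0 := by rw [hr]; field_simp [(hKg x0).ne']
  have har : a ≤ r := by
    rw [hr, le_div_iff₀ (hKg x0), ← hK.const_mul hg]
    exact hK.mono (hg.const_mul a) hf ha x0
  have hrb : r ≤ b := by
    rw [hr, div_le_iff₀ (hKg x0), ← hK.const_mul hg]
    exact hK.mono hf (hg.const_mul b) hb x0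
  have key : ∀ {φ : E → ℝ} {s : ℝ}, BddMeas φ → (∀ x, 0 ≤ φ x) → 0 ≤ s →
      K φ x0 = s * K g x0 → ∀ x, (D ^ 2)⁻¹ * s * K g x ≤ K φ x := by
    intro φ s hφ h0 hs he x
    have h1 := hc hg hg0 x x0
    have h2 := hc hφ h0 x0 x
    calc (D ^ 2)⁻¹ * s * K g x ≤ (D ^ 2)⁻¹ * s * (D * K g x0) := by gcongr
      _ = D⁻¹ * K φ x0 := by rw [he]; field_simp
      _ ≤ D⁻¹ * (D * K φ x) := by gcongr
      _ = K φ x := by field_simp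
  refine ⟨a + (D ^ 2)⁻¹ * (r - a), b - (D ^ 2)⁻¹ * (b - r), by ring, fun x => ⟨?_, ?_⟩⟩
  · have := key (hf.sub (hg.const_mul a)) (fun y => sub_nonneg.2 (ha y)) (sub_nonneg.2 har)
      (by rw [hK.sub hf hg, hrK]; ring) x
    rw [hK.sub hf hg] at this
    linarith
  · have h1 : ∀ y, K (fun y => b * g y - f y) y = b * K g y - K f y := fun y => by
      simpa [sub_eq_add_neg] using hK.linear hg hf b (-1) y
    have := key ((hg.const_mul b).sub hf) (fun y => sub_nonneg.2 (hb y)) (sub_nonneg.2 hrb)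
      (by rw [h1, hrK]; ring) x
    rw [h1] at this
    linarith

/-- Under a comparable positive operator the ratio of the iterates of two functions converges
uniformly, at a geometric rate, to a constant. -/
lemma contract (hK : PositiveOperator K) {D δ : ℝ} (hD : 1 ≤ D) (hc : Comparable K D)
    (hδ0 : 0 < δ) (hδ : ∀ x, δ ≤ K (fun _ => 1) x)
    {f g : E → ℝ} (hf : BddMeas f) (hg : BddMeas g) {c : ℝ} (hc0 : 0 < c) (hg0 : ∀ x, c ≤ g x)
    {a b : ℝ} (ha : ∀ x, a * g x ≤ f x) (hb : ∀ x, f x ≤ b * g x) (x0 : E) :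
    ∃ r, a ≤ r ∧ r ≤ b ∧ ∀ k x,
      |K^[k] f x - r * K^[k] g x| ≤ (1 - (D ^ 2)⁻¹) ^ k * (b - a) * K^[k] g x := by
  have hpos : ∀ k x, 0 < K^[k] g x := by
    intro k x
    have h := (hK.iterate k).lower (fun y => hK.iterate_lower hδ0.le hδ k y) hg hc0.le hg0 x
    exact (mul_pos hc0 (pow_pos hδ0 k)).trans_le h
  -- the lower and the upper bounds of the ratio of the `k`-th iterates; both sets grow with `k`
  let A : ℕ → Set ℝ := fun k => {α | ∀ x, α * K^[k] g x ≤ K^[k] f x}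
  let B : ℕ → Set ℝ := fun k => {β | ∀ x, K^[k] f x ≤ β * K^[k] g x}
  have hA : Monotone A := by
    refine monotone_nat_of_le_succ fun k α hα x => ?_
    have hgk := (hK.iterate k).bddMeas hg
    rw [Function.iterate_succ_apply', Function.iterate_succ_apply', ← hK.const_mul hgk]
    exact hK.mono (hgk.const_mul α) ((hK.iterate k).bddMeas hf) hα x
  have hB : Monotone B := by
    refine monotone_nat_of_le_succ fun k α hα x => ?_
    have hgk := (hK.iterate k).bddMeas hg
    rw [Function.iterate_succ_apply', Function.iterate_succ_apply', ← hK.const_mul hgk]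
    exact hK.mono ((hK.iterate k).bddMeas hf) (hgk.const_mul α) hα x
  have hAB : ∀ k j, ∀ α ∈ A k, ∀ β ∈ B j, α ≤ β := by
    intro k j α hα β hβ
    have h1 := hA (le_max_left k j) hα x0
    have h2 := hB (le_max_right k j) hβ x0
    exact le_of_mul_le_mul_right (h1.trans h2) (hpos _ x0)
  have hex : ∀ k, ∃ α ∈ A k, ∃ β ∈ B k, β - α = (1 - (D ^ 2)⁻¹) ^ k * (b - a) := by
    intro k
    induction k with
    | zero => exact ⟨a, ha, b, hb, by simp⟩
    | succ k ih =>
      obtain ⟨α, hα, β, hβ, hd⟩ := ih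
      obtain ⟨α', β', hd', h'⟩ := hK.contract_step hD hc ((hK.iterate k).bddMeas hf)
        ((hK.iterate k).bddMeas hg) (fun x => (hpos k x).le)
        (fun x => by rw [← Function.iterate_succ_apply' (f := K)]; exact hpos (k + 1) x) hα hβ x0
      refine ⟨α', fun x => ?_, β', fun x => ?_, by rw [hd', hd, pow_succ]; ring⟩
      · rw [Function.iterate_succ_apply', Function.iterate_succ_apply']; exact (h' x).1
      · rw [Function.iterate_succ_apply', Function.iterate_succ_apply']; exact (h' x).2
  have hbdd : BddAbove (⋃ k, A k) := ⟨b, by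
    rintro α hα
    obtain ⟨k, hk⟩ := Set.mem_iUnion.1 hα
    exact hAB k 0 α hk b hb⟩
  have hle : ∀ k, ∀ α ∈ A k, α ≤ sSup (⋃ k, A k) := fun k α hα =>
    le_csSup hbdd (Set.mem_iUnion.2 ⟨k, hα⟩)
  have hge : ∀ k, ∀ β ∈ B k, sSup (⋃ k, A k) ≤ β := fun k β hβ =>
    csSup_le ⟨a, Set.mem_iUnion.2 ⟨0, ha⟩⟩ fun α hα => by
      obtain ⟨j, hj⟩ := Set.mem_iUnion.1 hα
      exact hAB j k α hj β hβ
  refine ⟨sSup (⋃ k, A k), hle 0 a ha, hge 0 b hb, fun k x => ?_⟩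
  obtain ⟨α, hα, β, hβ, hd⟩ := hex k
  have h1 := hle k α hα
  have h2 := hge k β hβ
  have h3 := hα x
  have h4 := hβ x
  have h5 := hpos k x
  rw [← hd, abs_le]
  constructor <;> nlinarith

lemma contraction_rate_mem {D : ℝ} (hD : 1 ≤ D) : 0 ≤ 1 - (D ^ 2)⁻¹ ∧ 1 - (D ^ 2)⁻¹ < 1 :=
  ⟨sub_nonneg.2 (inv_le_one_of_one_le₀ (one_le_pow₀ hD)),
    sub_lt_self _ (inv_pos.2 (pow_pos (by linarith) 2))⟩

/-- Two positive eigenfunctions of a comparable positive operator with the same positive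
eigenvalue are proportional. -/
lemma proportional (hK : PositiveOperator K) {D δ : ℝ} (hD : 1 ≤ D) (hc : Comparable K D)
    (hδ0 : 0 < δ) (hδ : ∀ x, δ ≤ K (fun _ => 1) x) {f g : E → ℝ} (hf : BddMeas f)
    (hg : BddMeas g) {c : ℝ} (hc0 : 0 < c) (hg0 : ∀ x, c ≤ g x) {a b : ℝ}
    (ha : ∀ x, a * g x ≤ f x) (hb : ∀ x, f x ≤ b * g x) (x0 : E) {lam : ℝ} (hl : 0 < lam)
    (hef : ∀ x, K f x = lam * f x) (heg : ∀ x, K g x = lam * g x) :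
    ∃ r, a ≤ r ∧ ∀ x, f x = r * g x := by
  obtain ⟨r, har, -, hr⟩ := hK.contract hD hc hδ0 hδ hf hg hc0 hg0 ha hb x0
  refine ⟨r, har, fun x => ?_⟩
  have h1 : ∀ k : ℕ, |f x - r * g x| ≤ (1 - (D ^ 2)⁻¹) ^ k * ((b - a) * g x) := by
    intro k
    have := hr k x
    rw [hK.iterate_eigen hf hef, hK.iterate_eigen hg heg] at this
    have hp : 0 < lam ^ k := pow_pos hl k
    have h2 : lam ^ k * f x - r * (lam ^ k * g x) = lam ^ k * (f x - r * g x) := by ring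
    rw [h2, abs_mul, abs_of_pos hp] at this
    refine le_of_mul_le_mul_left (this.trans_eq ?_) hp
    ring
  have h2 : Tendsto (fun k : ℕ => (1 - (D ^ 2)⁻¹) ^ k * ((b - a) * g x)) atTop (𝓝 0) := by
    simpa using (tendsto_pow_atTop_nhds_zero_of_lt_one (contraction_rate_mem hD).1
      (contraction_rate_mem hD).2).mul_const ((b - a) * g x)
  have h3 := ge_of_tendsto' h2 h1
  exact sub_eq_zero.1 (abs_nonpos_iff.1 h3)

/-- A comparable positive operator has a positive eigenfunction: the iterates of the constant
function, normalized at a point, converge uniformly. -/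
lemma exists_eigen_of_comparable (hK : PositiveOperator K) {D δ : ℝ} (hD : 1 ≤ D)
    (hc : Comparable K D) (hδ0 : 0 < δ) (hδ : ∀ x, δ ≤ K (fun _ => 1) x) (x0 : E) :
    ∃ (lam : ℝ) (h : E → ℝ), 0 < lam ∧ BddMeas h ∧ (∀ x, D⁻¹ ≤ h x) ∧ (∀ x, h x ≤ D) ∧
      ∀ x, K h x = lam * h x := by
  have hD0 : 0 < D := by linarith
  set θ := 1 - (D ^ 2)⁻¹ with hθ
  obtain ⟨hθ0, hθ1⟩ := contraction_rate_mem hD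
  rw [← hθ] at hθ0 hθ1
  have one : BddMeas (fun _ : E => (1 : ℝ)) := BddMeas.const 1
  let u : ℕ → E → ℝ := fun k => K^[k] (fun _ => 1)
  have hu : ∀ k, BddMeas (u k) := fun k => (hK.iterate k).bddMeas one
  have hupos : ∀ k x, 0 < u k x := fun k x =>
    (pow_pos hδ0 k).trans_le (hK.iterate_lower hδ0.le hδ k x)
  let F : ℕ → E → ℝ := fun k x => (u k x0)⁻¹ * u k x
  have hF : ∀ k, BddMeas (F k) := fun k => (hu k).const_mul _
  have hcmp : ∀ k x x', u k x ≤ D * u k x' := by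
    intro k x x'
    cases k with
    | zero => simpa [u] using hD
    | succ k =>
      simp only [u, Function.iterate_succ_apply']
      exact hc (hu k) (fun y => (hupos k y).le) x x'
  have hFu : ∀ k x, F k x ≤ D := by
    intro k x
    have := hcmp k x x0
    simp only [F]
    rw [inv_mul_le_iff₀ (hupos k x0)]
    linarith
  have hFl : ∀ k x, D⁻¹ ≤ F k x := by
    intro k x
    have := hcmp k x0 x
    simp only [F]
    rw [le_inv_mul_iff₀ (hupos k x0), ← div_eq_mul_inv, div_le_iff₀ hD0]
    linarith
  -- the iterates of `u p` and of `1` have almost constant ratio, so normalization makes them close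
  have hcau : ∀ k p x, |F (k + p) x - F k x| ≤ 2 * D ^ 3 * θ ^ k := by
    intro k p x
    obtain ⟨r, hr1, hr2, hr⟩ := hK.contract hD hc hδ0 hδ (hF p) one one_pos (fun _ => le_rfl)
      (a := D⁻¹) (b := D) (fun y => by simpa using hFl p y) (fun y => by simpa using hFu p y) x0
    have hKF : ∀ y, K^[k] (F p) y = (u p x0)⁻¹ * u (k + p) y := by
      intro y
      simp only [F, u]
      rw [(hK.iterate k).const_mul (hu p), ← Function.iterate_add_apply]
    have hb : ∀ y, |K^[k] (F p) y - r * u k y| ≤ θ ^ k * D * u k y := by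
      intro y
      refine (hr k y).trans ?_
      have : D - D⁻¹ ≤ D := by have := inv_pos.2 hD0; linarith
      have h2 := (hupos k y).le
      gcongr
    have hx := hb x
    have hx0 := hb x0
    rw [hKF] at hx hx0
    set s := u (k + p) x0 with hs
    set v := (u p x0)⁻¹ with hv
    have hv0 : 0 < v := inv_pos.2 (hupos p x0)
    have hs0 : 0 < s := hupos _ _
    have hk0 : 0 < u k x0 := hupos _ _
    have hDvs : D⁻¹ * u k x0 ≤ v * s := by
      rw [← hKF x0]
      have := (hK.iterate k).mono (one.const_mul D⁻¹) (hF p) (fun y => by simpa using hFl p y) x0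
      rwa [(hK.iterate k).const_mul one] at this
    -- `F (k + p) x - F k x` is expanded around the common ratio `r`
    have e : F (k + p) x - F k x =
        ((v * u (k + p) x - r * u k x) - F k x * (v * s - r * u k x0)) / (v * s) := by
      simp only [F]
      rw [← hs]
      field_simp
      ring
    rw [e, abs_div, abs_of_pos (mul_pos hv0 hs0), div_le_iff₀ (mul_pos hv0 hs0)]
    have hF0 : 0 ≤ F k x := (inv_pos.2 hD0).le.trans (hFl k x)
    have h1 : |F k x * (v * s - r * u k x0)| ≤ D * (θ ^ k * D * u k x0) := by
      rw [abs_mul, abs_of_nonneg hF0]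
      gcongr
      exact hFu k x
    have h2 : θ ^ k * D * u k x ≤ θ ^ k * D * (D * u k x0) := by
      gcongr
      exact hcmp k x x0
    calc _ ≤ |v * u (k + p) x - r * u k x| + |F k x * (v * s - r * u k x0)| := abs_sub _ _
      _ ≤ θ ^ k * D * (D * u k x0) + D * (θ ^ k * D * u k x0) := add_le_add (hx.trans h2) h1
      _ = 2 * D ^ 3 * θ ^ k * (D⁻¹ * u k x0) := by field_simp; ring
      _ ≤ _ := by gcongr
  have hlim : Tendsto (fun k : ℕ => 2 * D ^ 3 * θ ^ k) atTop (𝓝 0) := by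
    simpa using (tendsto_pow_atTop_nhds_zero_of_lt_one hθ0 hθ1).const_mul (2 * D ^ 3)
  have hC : ∀ x, ∃ l, Tendsto (fun k => F k x) atTop (𝓝 l) := by
    intro x
    refine cauchySeq_tendsto_of_complete (cauchySeq_of_le_tendsto_0
      (fun k => 2 * (2 * D ^ 3 * θ ^ k)) ?_ (by simpa using hlim.const_mul 2))
    intro n m N hn hm
    obtain ⟨i, rfl⟩ := Nat.exists_eq_add_of_le hn
    obtain ⟨j, rfl⟩ := Nat.exists_eq_add_of_le hm
    rw [Real.dist_eq]
    calc _ ≤ |F (N + i) x - F N x| + |F (N + j) x - F N x| := by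
          rw [show F (N + i) x - F (N + j) x
            = (F (N + i) x - F N x) - (F (N + j) x - F N x) by ring]
          exact abs_sub _ _
      _ ≤ _ := by linarith [hcau N i x, hcau N j x]
  choose h hh using hC
  have hhl : ∀ x, D⁻¹ ≤ h x := fun x => ge_of_tendsto' (hh x) fun k => hFl k x
  have hhu : ∀ x, h x ≤ D := fun x => le_of_tendsto' (hh x) fun k => hFu k x
  have hhm : BddMeas h := BddMeas.of_mem_Icc
    (measurable_of_tendsto_metrizable (fun k => (hF k).measurable) (tendsto_pi_nhds.2 hh))
    fun x => ⟨hhl x, hhu x⟩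
  have hclose : ∀ k x, |F k x - h x| ≤ 2 * D ^ 3 * θ ^ k := by
    intro k x
    have h1 : Tendsto (fun p => |F (k + p) x - F k x|) atTop (𝓝 |h x - F k x|) :=
      ((((hh x).comp (tendsto_add_atTop_nat k)).congr fun p => by simp [add_comm]).sub_const _).abs
    rw [abs_sub_comm]
    exact le_of_tendsto' h1 fun p => hcau k p x
  have hKF : ∀ x, Tendsto (fun k => K (F k) x) atTop (𝓝 (K h x)) := by
    intro x
    rw [tendsto_iff_dist_tendsto_zero]
    refine squeeze_zero (fun _ => dist_nonneg) (fun k => ?_)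
      (by simpa using hlim.mul_const (K (fun _ => 1) x))
    have h1 : K (F k) x - K h x = K (fun y => F k y - 1 * h y) x := (by
      rw [hK.sub (hF k) hhm, one_mul])
    have hb : BddMeas (fun y => F k y - 1 * h y) := (hF k).sub (hhm.const_mul 1)
    have h2 := hK.mono hb (one.const_mul (2 * D ^ 3 * θ ^ k))
      (fun y => by simpa using (abs_le.1 (hclose k y)).2) x
    have h3 := hK.mono (one.const_mul (-(2 * D ^ 3 * θ ^ k))) hb
      (fun y => by simpa using (abs_le.1 (hclose k y)).1) x
    rw [hK.const_mul one] at h2 h3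
    rw [Real.dist_eq, h1, abs_le]
    constructor <;> linarith
  have hstep : ∀ k x, K (F k) x = K (F k) x0 * F (k + 1) x := by
    intro k x
    have h1 : ∀ y, K (F k) y = (u k x0)⁻¹ * u (k + 1) y := by
      intro y
      simp only [F]
      rw [hK.const_mul (hu k)]
      simp only [u, Function.iterate_succ_apply']
    rw [h1, h1]
    simp only [F]
    have := (hupos (k + 1) x0).ne'
    field_simp
  refine ⟨K h x0, h, ?_, hhm, hhl, hhu, fun x => ?_⟩
  · exact (mul_pos (inv_pos.2 hD0) hδ0).trans_le (hK.lower hδ hhm (inv_pos.2 hD0).le hhl x0)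
  · refine tendsto_nhds_unique (hKF x) ?_
    exact (((hKF x0).mul ((hh x).comp (tendsto_add_atTop_nat 1))).congr fun k =>
      (hstep k x).symm)

/-- If a power of a positive operator is comparable, the operator has a positive eigenfunction. -/
lemma exists_eigen (hK : PositiveOperator K) {n₀ : ℕ} {D δ : ℝ} (hD : 1 ≤ D)
    (hc : Comparable K^[n₀] D) (hδ0 : 0 < δ) (hδ : ∀ x, δ ≤ K (fun _ => 1) x) (x0 : E) :
    ∃ (lam : ℝ) (h : E → ℝ), 0 < lam ∧ BddMeas h ∧ (∀ x, D⁻¹ ≤ h x) ∧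
      ∀ x, K h x = lam * h x := by
  have hD0 : 0 < D := by linarith
  have hDi := inv_pos.2 hD0
  have hδ' := hK.iterate_lower hδ0.le hδ n₀
  obtain ⟨lam, h, hl, hh, hhl, hhu, he⟩ :=
    (hK.iterate n₀).exists_eigen_of_comparable hD hc (pow_pos hδ0 n₀) hδ' x0
  -- `K h` is an eigenfunction of `K^[n₀]` with the same eigenvalue, hence a multiple of `h`
  obtain ⟨B, hB⟩ := (hK.bddMeas hh).bounded
  have hB0 : 0 ≤ B := (abs_nonneg _).trans (hB x0)
  obtain ⟨r, har, hr⟩ := (hK.iterate n₀).proportional hD hc (pow_pos hδ0 n₀) hδ'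
    (hK.bddMeas hh) hh hDi hhl (a := D⁻¹ * δ * D⁻¹) (b := B * D)
    (fun x => by
      have h1 := hK.lower hδ hh hDi.le hhl x
      have h2 : D⁻¹ * h x ≤ 1 := by rw [inv_mul_le_iff₀ hD0]; linarith [hhu x]
      nlinarith [mul_pos hDi hδ0])
    (fun x => by
      have h1 := (le_abs_self _).trans (hB x)
      have h2 : 1 ≤ D * h x := by
        have := hhl x
        rwa [inv_le_iff_one_le_mul₀' hD0] at this
      nlinarith) x0 hl
    (fun x => by
      rw [← Function.iterate_succ_apply, Function.iterate_succ_apply',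
        show K^[n₀] h = fun y => lam * h y from funext he, hK.const_mul hh]) he
  exact ⟨r, h, (by positivity : 0 < D⁻¹ * δ * D⁻¹).trans_le har, hh, hhl, hr⟩

end PositiveOperator

/-! ### Tilted transition operators and their principal eigenvalue -/

/-- The Feynman–Kac operator `f ↦ T (e^W f)` of a kernel `T` and a potential `W`. -/
noncomputable def tilt {E : Type*} [MeasurableSpace E] (T : Kernel E E) (W f : E → ℝ) (x : E) : ℝ :=
  ∫ y, Real.exp (W y) * f y ∂(T x)

/-- `h` is a positive eigenfunction of the Feynman–Kac operator of `W`, with eigenvalue `e^q`. -/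
structure IsEigen {E : Type*} [MeasurableSpace E] (T : Kernel E E) (W : E → ℝ) (q : ℝ)
    (h : E → ℝ) : Prop where
  bddMeas : BddMeas h
  lower : ∃ c, 0 < c ∧ ∀ x, c ≤ h x
  eigen : ∀ x, tilt T W h x = Real.exp q * h x

section Tilt

variable {E : Type*} [MeasurableSpace E] {T : Kernel E E} [IsMarkovKernel T]

lemma BddMeas.integral_kernel {f : E → ℝ} (hf : BddMeas f) (T : Kernel E E) [IsMarkovKernel T] :
    BddMeas (fun x => ∫ y, f y ∂(T x)) := by
  obtain ⟨C, hC⟩ := hf.bounded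
  refine ⟨(hf.measurable.stronglyMeasurable.integral_kernel).measurable, C, fun x => ?_⟩
  have := norm_integral_le_of_norm_le_const (μ := T x) (f := f) (ae_of_all _ hC)
  simpa using this

lemma integral_kernel_mem_Icc {f : E → ℝ} (hf : Measurable f) {a b : ℝ}
    (h : ∀ x, f x ∈ Set.Icc a b) (x : E) : ∫ y, f y ∂(T x) ∈ Set.Icc a b := by
  have hi := (BddMeas.of_mem_Icc hf h).integrable (T x)
  constructor
  · simpa using integral_mono (integrable_const a) hi fun y => (h y).1
  · simpa using integral_mono hi (integrable_const b) fun y => (h y).2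

lemma tilt_positiveOperator {W : E → ℝ} (hW : BddMeas W) : PositiveOperator (tilt T W) where
  bddMeas hf := (hW.exp.mul hf).integral_kernel T
  linear {f g} hf hg a b x := by
    simp only [tilt]
    rw [← integral_const_mul, ← integral_const_mul, ← integral_add]
    · congr 1; ext y; ring
    · exact ((hW.exp.mul hf).integrable _).const_mul a
    · exact ((hW.exp.mul hg).integrable _).const_mul b
  nonneg hf h x := integral_nonneg fun y => mul_nonneg (Real.exp_pos _).le (h y)

lemma tilt_one_lower {W : E → ℝ} (hW : Measurable W) {w : ℝ} (hw : ∀ x, |W x| ≤ w) (x : E) :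
    Real.exp (-w) ≤ tilt T W (fun _ => 1) x := by
  have h : ∀ y, Real.exp (W y) * 1 ∈ Set.Icc (Real.exp (-w)) (Real.exp w) := fun y => by
    simpa using abs_le.1 (hw y)
  exact (integral_kernel_mem_Icc (by fun_prop) h x).1

/-- The Feynman–Kac semigroup and the untilted one differ at most by the factor `e^{n ‖W‖}`. -/
lemma tilt_iterate_between {W : E → ℝ} (hW : Measurable W) {w : ℝ} (hw : ∀ x, |W x| ≤ w)
    {f : E → ℝ} (hf : BddMeas f) (h0 : ∀ x, 0 ≤ f x) (n : ℕ) (x : E) :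
    Real.exp (-(n * w)) * (tilt T (fun _ => 0))^[n] f x ≤ (tilt T W)^[n] f x ∧
      (tilt T W)^[n] f x ≤ Real.exp (n * w) * (tilt T (fun _ => 0))^[n] f x := by
  have hWb : BddMeas W := ⟨hW, w, hw⟩
  have hA := tilt_positiveOperator (T := T) (BddMeas.const (0 : ℝ) : BddMeas fun _ : E => (0 : ℝ))
  have hK := tilt_positiveOperator (T := T) hWb
  induction n generalizing x with
  | zero => simp
  | succ n ih =>
    have hAn := (hA.iterate n).bddMeas hf
    have hAn0 := (hA.iterate n).nonneg hf h0
    have hKn := (hK.iterate n).bddMeas hf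
    rw [Function.iterate_succ_apply', Function.iterate_succ_apply']
    simp only [tilt, ← integral_const_mul]
    have hi : Integrable (fun y => Real.exp (W y) * (tilt T W)^[n] f y) (T x) :=
      (hWb.exp.mul hKn).integrable _
    have hj : ∀ c, Integrable (fun y => c * (Real.exp 0 * (tilt T fun _ => 0)^[n] f y)) (T x) :=
      fun c => ((hAn.const_mul _).const_mul c).integrable _
    constructor
    · refine integral_mono (hj _) hi fun y => ?_
      calc _ = Real.exp (-w) * (Real.exp (-(n * w)) * (tilt T fun _ => 0)^[n] f y) := by
            rw [← mul_assoc (Real.exp (-w)), ← Real.exp_add]; push_cast; simp; left; ring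
        _ ≤ _ := by
            gcongr
            · exact mul_nonneg (Real.exp_pos _).le (hAn0 y)
            · exact (abs_le.1 (hw y)).1
            · exact (ih y).1
    · refine integral_mono hi (hj _) fun y => ?_
      calc _ ≤ Real.exp w * (Real.exp (n * w) * (tilt T fun _ => 0)^[n] f y) := by
            gcongr
            · exact (hK.iterate n).nonneg hf h0 y
            · exact (abs_le.1 (hw y)).2
            · exact (ih y).2
        _ = _ := by
            rw [← mul_assoc (Real.exp w), ← Real.exp_add]; push_cast; simp; left; ring

lemma tilt_comparable {n₀ : ℕ} {D : ℝ} (hD : 1 ≤ D)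
    (hT : Comparable (tilt T (fun _ => 0))^[n₀] D) {W : E → ℝ} (hW : Measurable W) {w : ℝ}
    (hw : ∀ x, |W x| ≤ w) : Comparable (tilt T W)^[n₀] (D * Real.exp (2 * (n₀ * w))) := by
  intro f hf h0 x x'
  have h1 := (tilt_iterate_between (T := T) hW hw hf h0 n₀ x).2
  have h2 := (tilt_iterate_between (T := T) hW hw hf h0 n₀ x').1
  have h3 := hT hf h0 x x'
  calc _ ≤ Real.exp (n₀ * w) * (D * (tilt T fun _ => 0)^[n₀] f x') := h1.trans (by gcongr)
    _ = D * Real.exp (2 * (n₀ * w)) *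
        (Real.exp (-(n₀ * w)) * (tilt T fun _ => 0)^[n₀] f x') := by
      rw [show 2 * (n₀ * w) = n₀ * w + n₀ * w by ring, Real.exp_add, Real.exp_neg]
      field_simp
    _ ≤ _ := by gcongr

lemma one_le_const {D : ℝ} (hD : 1 ≤ D) (n : ℕ) {w : ℝ} (hw : 0 ≤ w) :
    1 ≤ D * Real.exp (2 * (n * w)) :=
  one_le_mul_of_one_le_of_one_le hD (Real.one_le_exp (by positivity))

lemma exists_isEigen [Nonempty E] {n₀ : ℕ} {D : ℝ} (hD : 1 ≤ D)
    (hT : Comparable (tilt T (fun _ => 0))^[n₀] D) {W : E → ℝ} (hW : BddMeas W) :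
    ∃ q h, IsEigen T W q h := by
  obtain ⟨w, hw⟩ := hW.bounded
  obtain ⟨x0⟩ := ‹Nonempty E›
  have hD' := one_le_const hD n₀ ((abs_nonneg _).trans (hw x0))
  obtain ⟨lam, h, hl, hh, hhl, he⟩ := (tilt_positiveOperator (T := T) hW).exists_eigen hD'
    (tilt_comparable hD hT hW.measurable hw) (Real.exp_pos _)
    (tilt_one_lower hW.measurable hw) x0
  exact ⟨Real.log lam, h, hh, ⟨_, inv_pos.2 (by linarith), hhl⟩, by rwa [Real.exp_log hl]⟩

lemma IsEigen.iterate {W : E → ℝ} (hW : BddMeas W) {q : ℝ} {h : E → ℝ} (he : IsEigen T W q h)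
    (n : ℕ) (x : E) : (tilt T W)^[n] h x = Real.exp (q * n) * h x := by
  rw [(tilt_positiveOperator hW).iterate_eigen he.bddMeas he.eigen, mul_comm q, Real.exp_nat_mul]

/-- The Feynman–Kac semigroup grows exactly like `e^{q n}`, with constants depending on the
potential only through its bound. -/
lemma IsEigen.growth {n₀ : ℕ} {D : ℝ} (hD : 1 ≤ D)
    (hT : Comparable (tilt T (fun _ => 0))^[n₀] D) {W : E → ℝ} (hW : Measurable W) {w : ℝ}
    (hw : ∀ x, |W x| ≤ w) {q : ℝ} {h : E → ℝ} (he : IsEigen T W q h) (n : ℕ) (x : E) :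
    Real.exp (q * n) ≤ D * Real.exp (2 * (n₀ * w)) * (tilt T W)^[n] (fun _ => 1) x ∧
      (tilt T W)^[n] (fun _ => 1) x ≤ D * Real.exp (2 * (n₀ * w)) * Real.exp (q * n) := by
  have hWb : BddMeas W := ⟨hW, w, hw⟩
  have hK := tilt_positiveOperator (T := T) hWb
  obtain ⟨c, hc, hcl⟩ := he.lower
  have hpos : ∀ x, 0 < h x := fun x => hc.trans_le (hcl x)
  have one : BddMeas (fun _ : E => (1 : ℝ)) := BddMeas.const 1
  have hcmp : ∀ x x', h x ≤ D * Real.exp (2 * (n₀ * w)) * h x' := by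
    intro x x'
    have := tilt_comparable hD hT hW hw he.bddMeas (fun y => (hpos y).le) x x'
    rw [he.iterate hWb, he.iterate hWb] at this
    refine le_of_mul_le_mul_left (this.trans_eq ?_) (Real.exp_pos (q * n₀))
    ring
  set D' := D * Real.exp (2 * (n₀ * w)) with hD'
  constructor
  · have h1 := (hK.iterate n).mono he.bddMeas (one.const_mul (D' * h x))
      (fun y => by simpa using hcmp y x) x
    rw [he.iterate hWb, (hK.iterate n).const_mul one] at h1
    refine le_of_mul_le_mul_right (h1.trans_eq ?_) (hpos x)
    ring
  · have h1 := (hK.iterate n).mono (one.const_mul (h x)) (he.bddMeas.const_mul D')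
      (fun y => by simpa using hcmp x y) x
    rw [(hK.iterate n).const_mul he.bddMeas, he.iterate hWb, (hK.iterate n).const_mul one] at h1
    refine le_of_mul_le_mul_left (h1.trans_eq ?_) (hpos x)
    ring

lemma tilt_zero_iterate_one (n : ℕ) (y : E) : (tilt T fun _ => 0)^[n] (fun _ => 1) y = 1 := by
  induction n generalizing y with
  | zero => simp
  | succ n ih =>
    rw [Function.iterate_succ_apply', show (tilt T fun _ => 0)^[n] (fun _ => 1) = fun _ => 1
      from funext ih]
    simp [tilt]

lemma tendsto_tilt_iterate {π : Measure E} (hπ : T.Invariant π) {W : E → ℝ}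
    {V : ℕ → E → ℝ} (hV : ∀ k, Measurable (V k)) {w : ℝ} (hVw : ∀ k x, |V k x| ≤ w)
    (hlim : ∀ᵐ x ∂π, Tendsto (fun k => V k x) atTop (𝓝 (W x))) (n : ℕ) :
    ∀ᵐ x ∂π, Tendsto (fun k => (tilt T (V k))^[n] (fun _ => 1) x) atTop
      (𝓝 ((tilt T W)^[n] (fun _ => 1) x)) := by
  induction n with
  | zero => simp
  | succ n ih =>
    have h := ih.and hlim
    rw [← hπ.def] at h
    filter_upwards [Measure.ae_ae_of_ae_bind T.measurable.aemeasurable h] with x hx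
    simp only [Function.iterate_succ_apply', tilt]
    have hb : ∀ k, BddMeas (V k) := fun k => ⟨hV k, w, hVw k⟩
    have hm : ∀ k, BddMeas ((tilt T (V k))^[n] fun _ => 1) := fun k =>
      ((tilt_positiveOperator (hb k)).iterate n).bddMeas (BddMeas.const 1)
    refine tendsto_integral_of_dominated_convergence
      (fun _ => Real.exp w * (Real.exp (n * w) * 1))
      (fun k => ((hb k).exp.mul (hm k)).measurable.aestronglyMeasurable) (integrable_const _)
      (fun k => ae_of_all _ fun y => ?_) ?_
    · have h1 := (tilt_iterate_between (T := T) (hV k) (hVw k) (BddMeas.const 1)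
        (fun _ => zero_le_one) n y).2
      rw [tilt_zero_iterate_one] at h1
      have h0 := ((tilt_positiveOperator (T := T) (hb k)).iterate n).nonneg (BddMeas.const 1)
        (fun _ => zero_le_one) y
      rw [Real.norm_eq_abs, abs_mul, abs_of_pos (Real.exp_pos _), abs_of_nonneg h0]
      gcongr
      exact (abs_le.1 (hVw k y)).2
    · filter_upwards [hx] with y hy
      exact ((Real.continuous_exp.tendsto _).comp hy.2).mul hy.1

/-- Upper semicontinuity of the eigenvalue under bounded almost everywhere convergence of the
potentials with respect to an invariant measure. -/
lemma eventually_eigenvalue_le {n₀ : ℕ} {D : ℝ} (hD : 1 ≤ D)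
    (hT : Comparable (tilt T (fun _ => 0))^[n₀] D) {π : Measure E} [IsProbabilityMeasure π]
    (hπ : T.Invariant π) {W : E → ℝ} (hW : Measurable W) {V : ℕ → E → ℝ}
    (hV : ∀ k, Measurable (V k)) {w : ℝ} (hWw : ∀ x, |W x| ≤ w) (hVw : ∀ k x, |V k x| ≤ w)
    (hlim : ∀ᵐ x ∂π, Tendsto (fun k => V k x) atTop (𝓝 (W x))) {q : ℝ} {h : E → ℝ}
    (he : IsEigen T W q h) {p : ℕ → ℝ} {g : ℕ → E → ℝ} (hp : ∀ k, IsEigen T (V k) (p k) (g k))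
    {ε : ℝ} (hε : 0 < ε) : ∀ᶠ k in atTop, p k ≤ q + ε := by
  set D' := D * Real.exp (2 * (n₀ * w)) with hD'
  have hD0 : 0 < D' := mul_pos (by linarith) (Real.exp_pos _)
  obtain ⟨n, hn⟩ := exists_nat_gt (max 0 ((2 * Real.log D' + 1) / ε))
  have hn0 : (0 : ℝ) < n := (le_max_left _ _).trans_lt hn
  have hn1 : 2 * Real.log D' + 1 ≤ n * ε := by
    have := (le_max_right _ _).trans_lt hn
    rw [div_lt_iff₀ hε] at this
    exact this.le
  have hb : ∀ k, BddMeas (V k) := fun k => ⟨hV k, w, hVw k⟩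
  have hm : ∀ k, BddMeas ((tilt T (V k))^[n] fun _ => 1) := fun k =>
    ((tilt_positiveOperator (hb k)).iterate n).bddMeas (BddMeas.const 1)
  have hmW : BddMeas ((tilt T W)^[n] fun _ => 1) :=
    ((tilt_positiveOperator ⟨hW, w, hWw⟩).iterate n).bddMeas (BddMeas.const 1)
  have hint : Tendsto (fun k => ∫ x, (tilt T (V k))^[n] (fun _ => 1) x ∂π) atTop
      (𝓝 (∫ x, (tilt T W)^[n] (fun _ => 1) x ∂π)) := by
    refine tendsto_integral_of_dominated_convergence (fun _ => Real.exp (n * w) * 1)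
      (fun k => (hm k).measurable.aestronglyMeasurable) (integrable_const _)
      (fun k => ae_of_all _ fun y => ?_) (tendsto_tilt_iterate hπ hV hVw hlim n)
    have h1 := (tilt_iterate_between (T := T) (hV k) (hVw k) (BddMeas.const 1)
      (fun _ => zero_le_one) n y).2
    rw [tilt_zero_iterate_one] at h1
    have h0 := ((tilt_positiveOperator (T := T) (hb k)).iterate n).nonneg (BddMeas.const 1)
      (fun _ => zero_le_one) y
    rwa [Real.norm_eq_abs, abs_of_nonneg h0]
  have hup : ∫ x, (tilt T W)^[n] (fun _ => 1) x ∂π ≤ D' * Real.exp (q * n) := by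
    have := integral_mono (hmW.integrable π) (integrable_const (D' * Real.exp (q * n)))
      fun x => (he.growth hD hT hW hWw n x).2
    simpa using this
  have hlt : ∫ x, (tilt T W)^[n] (fun _ => 1) x ∂π < Real.exp 1 * (D' * Real.exp (q * n)) := by
    refine hup.trans_lt (lt_mul_of_one_lt_left (by positivity) ?_)
    simp
  filter_upwards [hint.eventually_lt_const hlt] with k hk
  have h1 : Real.exp (p k * n) ≤ D' * ∫ x, (tilt T (V k))^[n] (fun _ => 1) x ∂π := by
    have := integral_mono (integrable_const (Real.exp (p k * n)))
      (((hm k).integrable π).const_mul D') fun x => ((hp k).growth hD hT (hV k) (hVw k) n x).1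
    rw [integral_const_mul] at this
    simpa using this
  have h2 : Real.exp (p k * n) ≤ Real.exp (2 * Real.log D' + 1 + q * n) := by
    have e : Real.exp (2 * Real.log D' + 1 + q * n)
        = D' * (Real.exp 1 * (D' * Real.exp (q * n))) := by
      rw [Real.exp_add, Real.exp_add, two_mul, Real.exp_add, Real.exp_log hD0]; ring
    rw [e]
    exact h1.trans (by gcongr)
  have h3 := Real.exp_le_exp.1 h2
  have h4 : p k * n ≤ (q + ε) * n := by linarith
  exact le_of_mul_le_mul_right h4 hn0

end Tilt

/-! ### The Donsker–Varadhan functional and the principal eigenvalue -/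

/-- The Donsker–Varadhan functional `- inf_u ∫ ln (T u / u) dη` of a kernel `T`, the infimum being
taken over the positive continuous functions. -/
noncomputable def dvRate {E : Type*} [TopologicalSpace E] [MeasurableSpace E] (T : Kernel E E)
    (η : Measure E) : EReal :=
  -⨅ u : {u : C(E, ℝ) // ∀ x, 0 < u x},
    ((∫ x, Real.log ((∫ y, u.1 y ∂(T x)) / u.1 x) ∂η : ℝ) : EReal)

lemma abs_log_div_le {E : Type*} [MeasurableSpace E] {T : Kernel E E} [IsMarkovKernel T]
    {v : E → ℝ} (hv : Measurable v) {c b : ℝ} (hc : 0 < c)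
    (h : ∀ x, v x ∈ Set.Icc c b) (x : E) :
    |Real.log ((∫ y, v y ∂(T x)) / v x)| ≤ Real.log (b / c) := by
  have h1 := integral_kernel_mem_Icc (T := T) hv h x
  have hb : 0 < b := hc.trans_le ((h x).1.trans (h x).2)
  have hv0 : 0 < v x := hc.trans_le (h x).1
  have hT0 : 0 < ∫ y, v y ∂(T x) := hc.trans_le h1.1
  rw [abs_le]
  constructor
  · rw [← Real.log_inv]
    refine Real.log_le_log (by positivity) ?_
    rw [inv_div]
    exact div_le_div₀ hT0.le h1.1 hv0 (h x).2
  · exact Real.log_le_log (by positivity) (div_le_div₀ hb.le h1.2 hc (h x).1)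

lemma measurable_log_div {E : Type*} [MeasurableSpace E] {T : Kernel E E}
    {v : E → ℝ} (hv : Measurable v) :
    Measurable fun x => Real.log ((∫ y, v y ∂(T x)) / v x) :=
  (hv.stronglyMeasurable.integral_kernel.measurable.div hv).log

lemma exp_mul_mem_Icc {E : Type*} {W h : E → ℝ} {w c b : ℝ} (hw : ∀ x, |W x| ≤ w) (hc : 0 < c)
    (h1 : ∀ x, c ≤ h x) (h2 : ∀ x, |h x| ≤ b) (x : E) :
    Real.exp (W x) * h x ∈ Set.Icc (Real.exp (-w) * c) (Real.exp w * b) := by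
  have h3 := (le_abs_self _).trans (h2 x)
  have h4 := hc.trans_le (h1 x)
  constructor
  · have := Real.exp_le_exp.2 (abs_le.1 (hw x)).1
    gcongr
    exact h1 x
  · have := Real.exp_le_exp.2 (abs_le.1 (hw x)).2
    gcongr

lemma _root_.ContinuousMap.bddMeas {E : Type*} [TopologicalSpace E] [CompactSpace E]
    [MeasurableSpace E] [BorelSpace E] (u : C(E, ℝ)) : BddMeas u :=
  ⟨u.continuous.measurable, ‖u‖, fun x => u.norm_coe_le_norm x⟩

section

variable {E : Type*} [TopologicalSpace E] [CompactSpace E] [PolishSpace E] [MeasurableSpace E]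
  [BorelSpace E]

/-- A measurable function with values in an interval is the almost everywhere limit of continuous
functions with values in the same interval. -/
lemma exists_continuous_tendsto_ae (θ : Measure E) [IsFiniteMeasure θ] {f : E → ℝ}
    (hf : Measurable f) {a b : ℝ} (hfab : ∀ x, f x ∈ Set.Icc a b) (hab : a ≤ b) :
    ∃ g : ℕ → C(E, ℝ), (∀ k x, g k x ∈ Set.Icc a b) ∧
      ∀ᵐ x ∂θ, Tendsto (fun k => g k x) atTop (𝓝 (f x)) := by
  have hfb : BddMeas f := BddMeas.of_mem_Icc hf hfab
  have hex : ∀ k : ℕ, ∃ g : C(E, ℝ), (∀ x, g x ∈ Set.Icc a b) ∧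
      eLpNorm (fun x => g x - f x) 1 θ ≤ ((k : ℝ≥0∞) + 1)⁻¹ := by
    intro k
    obtain ⟨g, hg, hgi⟩ := (memLp_one_iff_integrable.2 (hfb.integrable θ)
      ).exists_boundedContinuous_eLpNorm_sub_le ENNReal.one_ne_top
      (ε := ((k : ℝ≥0∞) + 1)⁻¹) (by simp)
    refine ⟨⟨fun x => max a (min b (g x)), by fun_prop⟩, fun x =>
      ⟨le_max_left _ _, max_le hab (min_le_left _ _)⟩, ?_⟩
    refine le_trans (eLpNorm_mono fun x => ?_) hg
    have h1 : f x = max a (min b (f x)) := by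
      rw [min_eq_right (hfab x).2, max_eq_right (hfab x).1]
    simp only [ContinuousMap.coe_mk, Pi.sub_apply, Real.norm_eq_abs]
    rw [abs_sub_comm (f x)]
    conv_lhs => rw [h1]
    exact (abs_max_sub_max_le_max _ _ _ _).trans (by
      simpa using (abs_min_sub_min_le_max b (g x) b (f x)).trans (by simp))
  choose g hg1 hg2 using hex
  have hlim : Tendsto (fun k => eLpNorm ((fun x => g k x) - f) 1 θ) atTop (𝓝 0) := by
    refine tendsto_of_tendsto_of_tendsto_of_le_of_le tendsto_const_nhds ?_
      (fun _ => bot_le) hg2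
    have := (tendsto_add_atTop_iff_nat 1).2 ENNReal.tendsto_inv_nat_nhds_zero
    simpa using this
  obtain ⟨ns, hns, h⟩ := (tendstoInMeasure_of_tendsto_eLpNorm one_ne_zero
    (fun k => (g k).continuous.aestronglyMeasurable) hf.aestronglyMeasurable
    hlim).exists_seq_tendsto_ae
  exact ⟨fun k => g (ns k), fun k => hg1 _, h⟩

variable {T : Kernel E E} [IsMarkovKernel T]

/-- In the definition of the Donsker–Varadhan functional one may use measurable test functions
with values in a compact subset of `(0, ∞)`; continuity of the kernel plays no role. -/
lemma neg_integral_le_dvRate (η : Measure E) [IsProbabilityMeasure η] {v : E → ℝ}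
    (hv : Measurable v) {c b : ℝ} (hc : 0 < c) (h : ∀ x, v x ∈ Set.Icc c b) :
    ((-∫ x, Real.log ((∫ y, v y ∂(T x)) / v x) ∂η : ℝ) : EReal) ≤ dvRate T η := by
  obtain ⟨x0⟩ : Nonempty E := nonempty_of_isProbabilityMeasure η
  obtain ⟨g, hg1, hg2⟩ := exists_continuous_tendsto_ae (η + η.bind T) hv h
    ((h x0).1.trans (h x0).2)
  rw [ae_add_measure_iff] at hg2
  have hlim : Tendsto (fun k => ∫ x, Real.log ((∫ y, g k y ∂(T x)) / g k x) ∂η) atTop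
      (𝓝 (∫ x, Real.log ((∫ y, v y ∂(T x)) / v x) ∂η)) := by
    refine tendsto_integral_of_dominated_convergence (fun _ => Real.log (b / c))
      (fun k => (measurable_log_div (g k).continuous.measurable).aestronglyMeasurable)
      (integrable_const _) (fun k => ae_of_all _ fun x =>
        abs_log_div_le (g k).continuous.measurable hc (hg1 k) x) ?_
    filter_upwards [hg2.1, Measure.ae_ae_of_ae_bind T.measurable.aemeasurable hg2.2]
      with x hx hTx
    have h1 : Tendsto (fun k => ∫ y, g k y ∂(T x)) atTop (𝓝 (∫ y, v y ∂(T x))) := by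
      refine tendsto_integral_of_dominated_convergence (fun _ => b)
        (fun k => (g k).continuous.aestronglyMeasurable) (integrable_const _)
        (fun k => ae_of_all _ fun y => ?_) hTx
      rw [Real.norm_eq_abs, abs_of_pos (hc.trans_le (hg1 k y).1)]
      exact (hg1 k y).2
    have hv0 : 0 < v x := hc.trans_le (h x).1
    have hT0 : 0 < ∫ y, v y ∂(T x) :=
      hc.trans_le (integral_kernel_mem_Icc (T := T) hv h x).1
    exact (h1.div hx hv0.ne').log (div_pos hT0 hv0).ne'
  rw [EReal.coe_neg, dvRate, EReal.neg_le_neg_iff]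
  exact ge_of_tendsto' ((continuous_coe_real_ereal.tendsto _).comp hlim) fun k =>
    iInf_le_of_le ⟨g k, fun x => hc.trans_le (hg1 k x).1⟩ le_rfl

/-- Half of the duality between the eigenvalue and the Donsker–Varadhan functional: the test
function `e^W h` built from the eigenfunction `h` gives `∫ W dη - q`. -/
lemma IsEigen.integral_sub_le_dvRate {W : E → ℝ} (hW : BddMeas W) {q : ℝ} {h : E → ℝ}
    (he : IsEigen T W q h) (η : Measure E) [IsProbabilityMeasure η] :
    ((∫ x, W x ∂η - q : ℝ) : EReal) ≤ dvRate T η := by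
  obtain ⟨w, hw⟩ := hW.bounded
  obtain ⟨c, hc, hcl⟩ := he.lower
  obtain ⟨b, hb⟩ := he.bddMeas.bounded
  have h1 := neg_integral_le_dvRate (T := T) η (hW.exp.mul he.bddMeas).measurable
    (mul_pos (Real.exp_pos _) hc) (exp_mul_mem_Icc hw hc hcl hb)
  have h2 : ∀ x, Real.log ((∫ y, Real.exp (W y) * h y ∂(T x)) / (Real.exp (W x) * h x))
      = q - W x := by
    intro x
    have hx := hc.trans_le (hcl x)
    have := he.eigen x
    rw [tilt] at this
    rw [this, mul_div_mul_right _ _ hx.ne', ← Real.exp_sub, Real.log_exp]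
  simp_rw [h2] at h1
  rw [integral_sub (integrable_const _) (hW.integrable η)] at h1
  simpa using h1

/-- The other half: the Donsker–Varadhan functional is the convex conjugate of the eigenvalue. The
potential `ln (u / T u)` has eigenfunction `T u` and eigenvalue `1`; it need not be continuous, and
is approximated by continuous potentials. -/
lemma dvRate_le_iSup {n₀ : ℕ} {D : ℝ} (hD : 1 ≤ D)
    (hT : Comparable (tilt T (fun _ => 0))^[n₀] D) {π : Measure E} [IsProbabilityMeasure π]
    (hπ : T.Invariant π) {Q : C(E, ℝ) → ℝ} (hQ : ∀ W : C(E, ℝ), ∃ h, IsEigen T W (Q W) h)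
    (η : Measure E) [IsProbabilityMeasure η] :
    dvRate T η ≤ ⨆ W : C(E, ℝ), ((∫ x, W x ∂η - Q W : ℝ) : EReal) := by
  rw [dvRate, EReal.neg_le]
  refine le_iInf fun ⟨u, hu⟩ => ?_
  rw [EReal.neg_le]
  obtain ⟨x0⟩ : Nonempty E := nonempty_of_isProbabilityMeasure η
  obtain ⟨xm, -, hxm⟩ := isCompact_univ.exists_isMinOn ⟨x0, trivial⟩ u.continuous.continuousOn
  obtain ⟨c, hc0, hcu⟩ : ∃ c, 0 < c ∧ ∀ x, u x ∈ Set.Icc c ‖u‖ := ⟨u xm, hu xm, fun x =>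
    ⟨hxm (Set.mem_univ x), (le_abs_self _).trans (u.norm_coe_le_norm x)⟩⟩
  have hum : Measurable u := u.continuous.measurable
  set L : E → ℝ := fun x => Real.log ((∫ y, u y ∂(T x)) / u x) with hL
  have hLm : Measurable L := measurable_log_div hum
  set w := Real.log (‖u‖ / c) with hw
  have hLw : ∀ x, |L x| ≤ w := fun x => abs_log_div_le hum hc0 hcu x
  have hLw' : ∀ x, (fun x => -L x) x ∈ Set.Icc (-w) w := fun x => by
    rw [Set.mem_Icc, ← abs_le, abs_neg]; exact hLw x
  have hTu := fun x => integral_kernel_mem_Icc (T := T) hum hcu x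
  have hTpos : ∀ x, 0 < ∫ y, u y ∂(T x) := fun x => hc0.trans_le (hTu x).1
  have heig : IsEigen T (fun x => -L x) 0 (fun x => ∫ y, u y ∂(T x)) := by
    refine ⟨u.bddMeas.integral_kernel T, ⟨c, hc0, fun x => (hTu x).1⟩, fun x => ?_⟩
    rw [tilt, Real.exp_zero, one_mul]
    congr 1
    ext y
    rw [hL, ← Real.log_inv, inv_div, Real.exp_log (div_pos (hu y) (hTpos y)),
      div_mul_cancel₀ _ (hTpos y).ne']
  obtain ⟨g, hg1, hg2⟩ := exists_continuous_tendsto_ae (η + π) hLm.neg hLw'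
    (by have := (abs_nonneg _).trans (hLw x0); linarith)
  rw [ae_add_measure_iff] at hg2
  have hgw : ∀ k x, |g k x| ≤ w := fun k x => abs_le.2 (hg1 k x)
  have hint : Tendsto (fun k => ∫ x, g k x ∂η) atTop (𝓝 (∫ x, -L x ∂η)) :=
    tendsto_integral_of_dominated_convergence (fun _ => w)
      (fun k => (g k).continuous.aestronglyMeasurable) (integrable_const _)
      (fun k => ae_of_all _ (hgw k)) hg2.1
  choose h hh using hQ
  have hS : ∀ ε > 0, ((∫ x, -L x ∂η - ε : ℝ) : EReal) ≤
      ⨆ W : C(E, ℝ), ((∫ x, W x ∂η - Q W : ℝ) : EReal) := by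
    intro ε hε
    have hev := eventually_eigenvalue_le hD hT hπ hLm.neg (fun k => (g k).continuous.measurable)
      (fun x => abs_le.2 (hLw' x)) hgw hg2.2 heig (fun k => hh (g k)) hε
    refine le_of_tendsto ((continuous_coe_real_ereal.tendsto _).comp (hint.sub_const ε)) ?_
    filter_upwards [hev] with k hk
    refine le_iSup_of_le (g k) ?_
    simp only [Function.comp]
    exact EReal.coe_le_coe_iff.2 (by linarith)
  rw [← EReal.coe_neg, ← integral_neg]
  have hlim : Tendsto (fun ε : ℝ => ((∫ x, -L x ∂η - ε : ℝ) : EReal)) (𝓝[>] 0)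
      (𝓝 ((∫ x, -L x ∂η : ℝ) : EReal)) := by
    refine (continuous_coe_real_ereal.tendsto _).comp ?_
    have : Tendsto (fun ε : ℝ => ∫ x, -L x ∂η - ε) (𝓝 0) (𝓝 (∫ x, -L x ∂η - 0)) :=
      tendsto_const_nhds.sub tendsto_id
    rw [sub_zero] at this
    exact this.mono_left nhdsWithin_le_nhds
  exact le_of_tendsto hlim (eventually_mem_nhdsWithin.mono fun ε hε => hS ε hε)

/-- An equilibrium state of `W` is invariant under the Markov operator
`g ↦ e^{-q} h⁻¹ T (e^W h g)`: test functions `e^W h (1 + s g)` with small `s` of both signs. -/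
lemma IsEigen.integral_invariant {W : E → ℝ} (hW : BddMeas W) {q : ℝ} {h : E → ℝ}
    (he : IsEigen T W q h) (η : Measure E) [IsProbabilityMeasure η]
    (hη : dvRate T η ≤ ((∫ x, W x ∂η - q : ℝ) : EReal)) {g : E → ℝ} (hg : BddMeas g) :
    ∫ x, tilt T W (fun y => h y * g y) x / (Real.exp q * h x) ∂η = ∫ x, g x ∂η := by
  obtain ⟨w, hw⟩ := hW.bounded
  obtain ⟨c, hc, hcl⟩ := he.lower
  obtain ⟨b, hb⟩ := he.bddMeas.bounded
  have hh0 : ∀ x, 0 < h x := fun x => hc.trans_le (hcl x)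
  have hK := tilt_positiveOperator (T := T) hW
  -- it suffices to treat functions bounded by one
  wlog hg1 : ∀ x, |g x| ≤ 1 generalizing g with H
  · obtain ⟨G, hG⟩ := hg.bounded
    have hG1 : 0 < |G| + 1 := by positivity
    have := H (hg.const_mul (|G| + 1)⁻¹) (fun x => by
      rw [abs_mul, abs_inv, abs_of_pos hG1, inv_mul_le_iff₀ hG1]
      linarith [hG x, le_abs_self G])
    have e : ∀ x, tilt T W (fun y => h y * ((|G| + 1)⁻¹ * g y)) x / (Real.exp q * h x)
        = (|G| + 1)⁻¹ * (tilt T W (fun y => h y * g y) x / (Real.exp q * h x)) := by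
      intro x
      rw [show (fun y => h y * ((|G| + 1)⁻¹ * g y)) = fun y => (|G| + 1)⁻¹ * (h y * g y) by
        ext y; ring, hK.const_mul (he.bddMeas.mul hg), mul_div_assoc]
    simp_rw [e] at this
    rw [integral_const_mul, integral_const_mul] at this
    exact mul_left_cancel₀ (inv_pos.2 hG1).ne' this
  set S : E → ℝ := fun x => tilt T W (fun y => h y * g y) x / (Real.exp q * h x) with hS
  have hhg := he.bddMeas.mul hg
  have hSb : BddMeas S := (hK.bddMeas hhg).div (mul_pos (Real.exp_pos q) hc)
    (he.bddMeas.const_mul _) fun x => by have := hcl x; gcongr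
  have hS1 : ∀ x, |S x| ≤ 1 := by
    intro x
    have hp : 0 < Real.exp q * h x := mul_pos (Real.exp_pos _) (hh0 x)
    rw [hS, abs_div, abs_of_pos hp, div_le_one hp, ← he.eigen x, abs_le]
    constructor
    · have := hK.mono (he.bddMeas.const_mul (-1)) hhg (fun y => by
        nlinarith [hh0 y, (abs_le.1 (hg1 y)).1]) x
      rw [hK.const_mul he.bddMeas] at this
      linarith
    · exact hK.mono hhg he.bddMeas (fun y => by nlinarith [hh0 y, (abs_le.1 (hg1 y)).2]) x
  have key : ∀ s : ℝ, |s| ≤ 1 / 2 → 0 ≤ s * (∫ x, S x ∂η - ∫ x, g x ∂η) + 2 * s ^ 2 := by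
    intro s hs
    have hsg : ∀ {f : E → ℝ}, (∀ x, |f x| ≤ 1) → ∀ x, |s * f x| ≤ 1 / 2 := by
      intro f hf x
      rw [abs_mul]
      calc |s| * |f x| ≤ 1 / 2 * 1 := by gcongr; exact hf x
        _ = 1 / 2 := by norm_num
    have hv : BddMeas (fun x => h x * (1 + s * g x)) :=
      he.bddMeas.mul ((BddMeas.const 1).add (hg.const_mul s))
    obtain ⟨b', hb'⟩ := hv.bounded
    have hc' : ∀ x, c * (1 / 2) ≤ h x * (1 + s * g x) := by
      intro x
      have := (abs_le.1 (hsg hg1 x)).1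
      have := hcl x
      have := hh0 x
      gcongr
      linarith
    have h1 := (neg_integral_le_dvRate (T := T) η (hW.exp.mul hv).measurable
      (mul_pos (Real.exp_pos _) (by positivity)) (exp_mul_mem_Icc hw (by positivity) hc' hb')).trans
      hη
    have h2 : ∀ x, Real.log ((∫ y, Real.exp (W y) * (h y * (1 + s * g y)) ∂(T x)) /
        (Real.exp (W x) * (h x * (1 + s * g x))))
        = q - W x + (Real.log (1 + s * S x) - Real.log (1 + s * g x)) := by
      intro x
      have hgx := (abs_le.1 (hsg hg1 x)).1
      have hSx := (abs_le.1 (hsg hS1 x)).1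
      have e1 : ∫ y, Real.exp (W y) * (h y * (1 + s * g y)) ∂(T x)
          = Real.exp q * h x * (1 + s * S x) := by
        have e0 := hK.linear he.bddMeas hhg 1 s x
        rw [show (fun y => 1 * h y + s * (h y * g y)) = fun y => h y * (1 + s * g y) by
          ext y; ring, he.eigen x] at e0
        have e2 : S x * (Real.exp q * h x) = tilt T W (fun y => h y * g y) x :=
          div_mul_cancel₀ _ (mul_pos (Real.exp_pos q) (hh0 x)).ne'
        rw [← tilt, e0, ← e2]
        ring
      have p1 : 0 < 1 + s * S x := by linarith
      have p2 : 0 < 1 + s * g x := by linarith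
      have := hh0 x
      rw [e1, Real.log_div (by positivity) (by positivity), Real.log_mul (by positivity) p1.ne',
        Real.log_mul (by positivity) (by positivity), Real.log_exp,
        Real.log_mul (by positivity) (by positivity), Real.log_mul (by positivity) p2.ne',
        Real.log_exp]
      ring
    have h3 : ∀ x, q - W x + (Real.log (1 + s * S x) - Real.log (1 + s * g x))
        ≤ q - W x + (s * S x - s * g x + 2 * s ^ 2) := by
      intro x
      have hgx := hsg hg1 x
      have hSx := (abs_le.1 (hsg hS1 x)).1
      have l1 : Real.log (1 + s * S x) ≤ s * S x := by
        have := Real.log_le_sub_one_of_pos (show 0 < 1 + s * S x by linarith)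
        linarith
      have l2 : s * g x - 2 * s ^ 2 ≤ Real.log (1 + s * g x) := by
        set y := s * g x with hy
        have hy1 := abs_le.1 hgx
        have hp : 0 < 1 + y := by linarith
        have := Real.one_sub_inv_le_log_of_pos hp
        have h6 : y ^ 2 ≤ s ^ 2 := by
          rw [hy, mul_pow]
          have : g x ^ 2 ≤ 1 := by rw [← sq_abs]; exact pow_le_one₀ (abs_nonneg _) (hg1 x)
          nlinarith [sq_nonneg s]
        have h7 : y - 2 * y ^ 2 ≤ 1 - (1 + y)⁻¹ := by
          have e : 1 - (1 + y)⁻¹ = y / (1 + y) := by field_simp; ring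
          rw [e, le_div_iff₀ hp]
          nlinarith [mul_nonneg (sq_nonneg y) (show 0 ≤ 1 + 2 * y by linarith)]
        linarith
      linarith
    have hlog : ∀ {f : E → ℝ}, BddMeas f → (∀ x, |f x| ≤ 1) →
        BddMeas (fun x => Real.log (1 + s * f x)) := fun {f} hf hf1 =>
      ((BddMeas.const 1).add (hf.const_mul s)).log (c := 1 / 2) (by norm_num) fun x => by
        linarith [(abs_le.1 (hsg hf1 x)).1]
    have hqW : BddMeas fun x => q - W x := (BddMeas.const q).sub hW
    simp_rw [h2] at h1
    have h4 := integral_mono ((hqW.add ((hlog hSb hS1).sub (hlog hg hg1))).integrable η)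
      ((hqW.add (((hSb.const_mul s).sub (hg.const_mul s)).add
        (BddMeas.const (2 * s ^ 2)))).integrable η) h3
    have h5 : ∫ x, (q - W x + (s * S x - s * g x + 2 * s ^ 2)) ∂η
        = q - ∫ x, W x ∂η + (s * (∫ x, S x ∂η - ∫ x, g x ∂η) + 2 * s ^ 2) := by
      rw [integral_add (hqW.integrable η) ((((hSb.const_mul s).sub (hg.const_mul s)).add
        (BddMeas.const (2 * s ^ 2))).integrable η),
        integral_add (((hSb.const_mul s).sub (hg.const_mul s)).integrable η)
          (integrable_const _), integral_sub (integrable_const _) (hW.integrable η),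
        integral_sub ((hSb.const_mul s).integrable η) ((hg.const_mul s).integrable η),
        integral_const_mul, integral_const_mul]
      simp
      ring
    have h6 := EReal.coe_le_coe_iff.1 h1
    linarith
  have hbd : ∀ t : ℝ, 0 < t → t ≤ 1 / 2 → |∫ x, S x ∂η - ∫ x, g x ∂η| ≤ 2 * t := by
    intro t ht ht2
    have k1 := key t (by rwa [abs_of_pos ht])
    have k2 := key (-t) (by rwa [abs_neg, abs_of_pos ht])
    rw [abs_le]
    constructor
    · refine le_of_mul_le_mul_left ?_ ht
      linarith
    · refine le_of_mul_le_mul_left ?_ ht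
      linarith
  refine sub_eq_zero.1 (abs_nonpos_iff.1 (le_of_forall_pos_le_add fun ε hε => ?_))
  refine (hbd (min (1 / 2) (ε / 2)) (by positivity) (min_le_left _ _)).trans ?_
  linarith [min_le_right (1 / 2) (ε / 2)]

/-- The equilibrium state of a potential is unique: the invariance of an equilibrium state under
the normalized tilted operator, whose powers converge uniformly to constants, determines it. -/
lemma equilibrium_unique {n₀ : ℕ} {D : ℝ} (hD : 1 ≤ D)
    (hT : Comparable (tilt T (fun _ => 0))^[n₀] D) {W : E → ℝ} (hW : BddMeas W) {q : ℝ}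
    {h : E → ℝ} (he : IsEigen T W q h) (η η' : Measure E) [IsProbabilityMeasure η]
    [IsProbabilityMeasure η'] (hη : dvRate T η ≤ ((∫ x, W x ∂η - q : ℝ) : EReal))
    (hη' : dvRate T η' ≤ ((∫ x, W x ∂η' - q : ℝ) : EReal)) : η = η' := by
  obtain ⟨x0⟩ : Nonempty E := nonempty_of_isProbabilityMeasure η
  obtain ⟨w, hw⟩ := hW.bounded
  obtain ⟨c, hc, hcl⟩ := he.lower
  have hh0 : ∀ x, 0 < h x := fun x => hc.trans_le (hcl x)
  have hK := tilt_positiveOperator (T := T) hW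
  have hD' := one_le_const hD n₀ ((abs_nonneg _).trans (hw x0))
  have hlow : ∀ n x, Real.exp (q * n) * c ≤ Real.exp (q * n) * h x := fun n x => by
    have := hcl x; gcongr
  have hinv : ∀ (ρ : Measure E) [IsProbabilityMeasure ρ],
      dvRate T ρ ≤ ((∫ x, W x ∂ρ - q : ℝ) : EReal) → ∀ (n : ℕ) {g : E → ℝ}, BddMeas g →
      ∫ x, (tilt T W)^[n] (fun y => h y * g y) x / (Real.exp (q * n) * h x) ∂ρ
        = ∫ x, g x ∂ρ := by
    intro ρ _ hρ n
    induction n with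
    | zero =>
      intro g hg
      congr 1
      ext x
      have := (hh0 x).ne'
      simp only [Function.iterate_zero, id, Nat.cast_zero, mul_zero, Real.exp_zero, one_mul]
      field_simp
    | succ n ih =>
      intro g hg
      have hhg := he.bddMeas.mul hg
      have hg' : BddMeas fun x => tilt T W (fun y => h y * g y) x / (Real.exp q * h x) :=
        (hK.bddMeas hhg).div (mul_pos (Real.exp_pos q) hc) (he.bddMeas.const_mul _)
          fun x => by have := hcl x; gcongr
      rw [← he.integral_invariant hW ρ hρ hg, ← ih hg']
      congr 1
      ext x
      have e : (fun y => h y * (tilt T W (fun y => h y * g y) y / (Real.exp q * h y)))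
          = fun y => (Real.exp q)⁻¹ * tilt T W (fun y => h y * g y) y := by
        ext y
        have := (hh0 y).ne'
        field_simp
      rw [e, (hK.iterate n).const_mul (hK.bddMeas hhg), ← Function.iterate_succ_apply]
      push_cast
      rw [mul_add, Real.exp_add, mul_one]
      have := (hh0 x).ne'
      field_simp
  have hconst : ∀ {g : E → ℝ}, BddMeas g → ∃ r, ∀ (ρ : Measure E) [IsProbabilityMeasure ρ],
      dvRate T ρ ≤ ((∫ x, W x ∂ρ - q : ℝ) : EReal) → ∫ x, g x ∂ρ = r := by
    intro g hg
    obtain ⟨G, hG⟩ := hg.bounded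
    have hhg := he.bddMeas.mul hg
    have hcmp : Comparable (tilt T W)^[n₀] (D * Real.exp (2 * (n₀ * w))) :=
      tilt_comparable hD hT hW.measurable hw
    have hδ := hK.iterate_lower (Real.exp_pos _).le (tilt_one_lower hW.measurable hw) n₀
    obtain ⟨r, -, -, hr⟩ := (hK.iterate n₀).contract hD' hcmp (pow_pos (Real.exp_pos _) n₀) hδ
      hhg he.bddMeas hc hcl (a := -G) (b := G)
      (fun x => by have := (abs_le.1 (hG x)).1; have := hh0 x; nlinarith)
      (fun x => by have := (abs_le.1 (hG x)).2; have := hh0 x; nlinarith) x0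
    obtain ⟨hθ0, hθ1⟩ := PositiveOperator.contraction_rate_mem hD'
    set θ := 1 - ((D * Real.exp (2 * (n₀ * w))) ^ 2)⁻¹ with hθ
    refine ⟨r, fun ρ _ hρ => ?_⟩
    have hk : ∀ k : ℕ, |∫ x, g x ∂ρ - r| ≤ θ ^ k * (G - -G) := by
      intro k
      have e1 := hinv ρ hρ (n₀ * k) hg
      have hb : BddMeas fun x =>
          (tilt T W)^[n₀ * k] (fun y => h y * g y) x / (Real.exp (q * (n₀ * k : ℕ)) * h x) :=
        ((hK.iterate _).bddMeas hhg).div (mul_pos (Real.exp_pos _) hc) (he.bddMeas.const_mul _)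
          (hlow _)
      rw [← e1, show r = ∫ _, r ∂ρ by simp, ← integral_sub (hb.integrable ρ) (integrable_const _)]
      have hle : ∀ x, ‖(tilt T W)^[n₀ * k] (fun y => h y * g y) x /
          (Real.exp (q * (n₀ * k : ℕ)) * h x) - r‖ ≤ θ ^ k * (G - -G) := by
        intro x
        have h1 := hr k x
        rw [← Function.iterate_mul, he.iterate hW] at h1
        have hp : 0 < Real.exp (q * (n₀ * k : ℕ)) * h x := mul_pos (Real.exp_pos _) (hh0 x)
        rw [Real.norm_eq_abs, div_sub' hp.ne', abs_div, abs_of_pos hp, div_le_iff₀ hp,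
          mul_comm _ r]
        exact h1
      simpa using norm_integral_le_of_norm_le_const (μ := ρ) (ae_of_all _ hle)
    have hlim : Tendsto (fun k : ℕ => θ ^ k * (G - -G)) atTop (𝓝 0) := by
      simpa using (tendsto_pow_atTop_nhds_zero_of_lt_one hθ0 hθ1).mul_const (G - -G)
    exact sub_eq_zero.1 (abs_nonpos_iff.1 (ge_of_tendsto' hlim hk))
  ext s hs
  obtain ⟨r, hr⟩ := hconst (g := s.indicator fun _ => 1) (BddMeas.of_mem_Icc (a := 0) (b := 1)
    (measurable_const.indicator hs) fun x => by
      by_cases hx : x ∈ s <;> simp [hx])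
  have h1 := hr η hη
  have h2 := hr η' hη'
  rw [integral_indicator_const _ hs] at h1 h2
  simp only [smul_eq_mul, mul_one] at h1 h2
  rw [← measureReal_eq_measureReal_iff, h1, h2]

end

/-! ### Markov chains on path space and decoupling of distant times -/

/-- A measure `L` on the path space is the law of a Markov chain with transition probability `κ`:
the coordinate at time `n + 1` may be integrated out with respect to `κ (w n)`. -/
def IsMarkovLaw {M : Type*} [MeasurableSpace M] (κ : Kernel M M) (L : Measure (ℕ → M)) : Prop :=
  ∀ (n : ℕ) (f : (ℕ → M) → ℝ≥0∞), Measurable f → DependsOn f (Set.Iic (n + 1)) →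
    ∫⁻ w, f w ∂L = ∫⁻ w, ∫⁻ y, f (Function.update w (n + 1) y) ∂(κ (w n)) ∂L

section

variable {M : Type*} [MeasurableSpace M]

/-- The transition from the history up to time `n` to the state at time `n + 1`. -/
noncomputable def historyKernel (κ : Kernel M M) (n : ℕ) : Kernel (Π _ : Finset.Iic n, M) M :=
  κ.comap (fun h : (Π _ : Finset.Iic n, M) => h ⟨n, Finset.mem_Iic.2 le_rfl⟩)
    (measurable_pi_apply _)

instance (κ : Kernel M M) [IsMarkovKernel κ] (n : ℕ) : IsMarkovKernel (historyKernel κ n) := by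
  unfold historyKernel; infer_instance

lemma isMarkovLaw_of_compProd {κ : Kernel M M} [IsMarkovKernel κ] {L : Measure (ℕ → M)}
    [IsProbabilityMeasure L]
    (h : ∀ n : ℕ, (L.map (Preorder.frestrictLe (π := fun _ => M) n)) ⊗ₘ historyKernel κ n
      = L.map (fun w => (Preorder.frestrictLe (π := fun _ => M) n w, w (n + 1)))) :
    IsMarkovLaw κ L := by
  intro n f hf hdep
  let ext : (Π _ : Finset.Iic n, M) × M → ℕ → M := fun p i =>
    if hi : i ∈ Finset.Iic n then p.1 ⟨i, hi⟩ else p.2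
  have hext : Measurable ext := by
    refine measurable_pi_lambda _ fun i => ?_
    by_cases hi : i ∈ Finset.Iic n
    · simp only [ext, hi, dite_true]
      exact (measurable_pi_apply _).comp measurable_fst
    · simp only [ext, hi, dite_false]
      exact measurable_snd
  have hfr : Measurable (Preorder.frestrictLe (π := fun _ : ℕ => M) n) :=
    Preorder.measurable_frestrictLe n
  have h1 : ∀ w y, f (ext (Preorder.frestrictLe (π := fun _ => M) n w, y))
      = f (Function.update w (n + 1) y) := by
    intro w y
    refine hdep fun i hi => ?_
    rcases Nat.lt_or_ge n i with hlt | hle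
    · have : i = n + 1 := le_antisymm hi hlt
      subst this
      simp [ext]
    · have h2 : i ∈ Finset.Iic n := Finset.mem_Iic.2 hle
      have h3 : i ≠ n + 1 := by omega
      simp only [ext, h2, dite_true, Function.update_of_ne h3, Preorder.frestrictLe_apply]
  have h2 : ∀ w, f w = f (ext (Preorder.frestrictLe (π := fun _ => M) n w, w (n + 1))) := by
    intro w
    rw [h1, Function.update_eq_self]
  have hfe : Measurable fun p => f (ext p) := hf.comp hext
  calc ∫⁻ w, f w ∂L
      = ∫⁻ p, f (ext p) ∂(L.map (fun w =>
          (Preorder.frestrictLe (π := fun _ => M) n w, w (n + 1)))) := by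
        rw [lintegral_map hfe (by fun_prop)]
        exact lintegral_congr h2
    _ = ∫⁻ w, ∫⁻ y, f (ext (Preorder.frestrictLe (π := fun _ => M) n w, y))
          ∂(κ (w n)) ∂L := by
        rw [← h, Measure.lintegral_compProd hfe, lintegral_map _ hfr]
        · rfl
        · exact hfe.lintegral_kernel_prod_right'
    _ = _ := by simp_rw [h1]

instance (κ : Kernel M M) [IsMarkovKernel κ] (x : M) : IsProbabilityMeasure (pathMeasure κ x) := by
  unfold pathMeasure; infer_instance

lemma isMarkovLaw_pathMeasure (κ : Kernel M M) [IsMarkovKernel κ] (x : M) :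
    IsMarkovLaw κ (pathMeasure κ x) :=
  isMarkovLaw_of_compProd fun _ =>
    Kernel.map_frestrictLe_trajMeasure_compProd_eq_map_trajMeasure
      (X := fun _ => M) (κ := fun n => historyKernel κ n)

/-- The σ-algebra generated by a process up to time `n`. -/
@[reducible]
def pastSigma {Ω : Type*} (X : ℕ → Ω → M) (n : ℕ) : MeasurableSpace Ω :=
  ⨆ i ≤ n, MeasurableSpace.comap (X i) inferInstance

lemma IsMarkovChain.isMarkovLaw {Ω : Type*} [MeasurableSpace Ω] {κ : Kernel M M}
    [IsMarkovKernel κ] {P : Measure Ω} [IsProbabilityMeasure P] {X : ℕ → Ω → M}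
    (hX : IsMarkovChain κ P X) : IsMarkovLaw κ (P.map fun ω n => X n ω) := by
  have hm : Measurable fun ω n => X n ω := measurable_pi_lambda _ hX.measurable
  have : IsProbabilityMeasure (P.map fun ω n => X n ω) :=
    Measure.isProbabilityMeasure_map hm.aemeasurable
  refine isMarkovLaw_of_compProd fun n => ?_
  have hfr : Measurable (Preorder.frestrictLe (π := fun _ : ℕ => M) n) :=
    Preorder.measurable_frestrictLe n
  rw [Measure.map_map hfr hm, Measure.map_map (by fun_prop) hm]
  have hmn : Measurable (Preorder.frestrictLe (π := fun _ => M) n ∘ fun ω n => X n ω) :=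
    hfr.comp hm
  have : IsProbabilityMeasure
      (P.map (Preorder.frestrictLe (π := fun _ => M) n ∘ fun ω n => X n ω)) :=
    Measure.isProbabilityMeasure_map hmn.aemeasurable
  refine Measure.ext_prod fun {A G} hA hG => ?_
  rw [Measure.compProd_apply_prod hA hG, setLIntegral_map hA
    ((historyKernel κ n).measurable_coe hG) hmn,
    Measure.map_apply (by exact hmn.prodMk (hX.measurable _)) (hA.prod hG)]
  have hmle : pastSigma X n ≤ ‹MeasurableSpace Ω› := iSup₂_le fun i _ => (hX.measurable i).comap_le
  have hmeas : Measurable[pastSigma X n] fun ω =>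
      Preorder.frestrictLe (π := fun _ => M) n fun n => X n ω := by
    refine @measurable_pi_lambda _ _ _ (pastSigma X n) _ _ fun i => ?_
    have : MeasurableSpace.comap (X i) inferInstance ≤ pastSigma X n :=
      le_iSup₂_of_le (f := fun i (_ : i ≤ n) => MeasurableSpace.comap (X i) inferInstance)
        i.1 (Finset.mem_Iic.1 i.2) le_rfl
    exact (comap_measurable (X i)).mono this le_rfl
  set S := (fun ω => Preorder.frestrictLe (π := fun _ => M) n fun n => X n ω) ⁻¹' A with hS
  have hSm : MeasurableSet[pastSigma X n] S := hmeas hA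
  have hXG : MeasurableSet (X (n + 1) ⁻¹' G) := hX.measurable _ hG
  have h1 := setIntegral_condExp hmle
    ((integrable_const (1 : ℝ)).indicator hXG :
      Integrable ((X (n + 1) ⁻¹' G).indicator fun _ => (1 : ℝ)) P) hSm
  have hcond : ∀ᵐ ω ∂P, ω ∈ S →
      (P⟦X (n + 1) ⁻¹' G | pastSigma X n⟧) ω = (κ (X n ω)).real G :=
    (hX.markov n G hG).mono fun ω h _ => h
  rw [setIntegral_congr_ae (hmle _ hSm) hcond,
    integral_indicator_const _ hXG, smul_eq_mul, mul_one, measureReal_restrict_apply hXG] at h1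
  have hκm : Measurable fun ω => κ (X n ω) G := (κ.measurable_coe hG).comp (hX.measurable n)
  have h2 : ∫⁻ ω in S, κ (X n ω) G ∂P = P (X (n + 1) ⁻¹' G ∩ S) := by
    rw [← ENNReal.ofReal_toReal (measure_ne_top P (X (n + 1) ⁻¹' G ∩ S)), ← Measure.real, ← h1,
      ofReal_integral_eq_lintegral_ofReal]
    · refine lintegral_congr fun ω => ?_
      rw [Measure.real, ENNReal.ofReal_toReal (measure_ne_top _ _)]
    · refine Integrable.of_bound hκm.ennreal_toReal.aestronglyMeasurable 1 (ae_of_all _ fun ω => ?_)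
      rw [Real.norm_eq_abs, abs_of_nonneg measureReal_nonneg]
      exact measureReal_le_one
    · exact ae_of_all _ fun ω => measureReal_nonneg
  refine Eq.trans h2 ?_
  congr 1
  ext ω
  simp [hS, and_comm]

variable {κ : Kernel M M} [IsMarkovKernel κ] {L : Measure (ℕ → M)}

instance (κ : Kernel M M) [IsMarkovKernel κ] (n : ℕ) : IsMarkovKernel (κ ^ n) := by
  induction n with
  | zero => rw [pow_zero]; exact inferInstanceAs (IsMarkovKernel Kernel.id)
  | succ n ih => rw [pow_succ]; exact inferInstanceAs (IsMarkovKernel ((κ ^ n) ∘ₖ κ))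

omit [IsMarkovKernel κ] in
lemma measurable_lintegral_update [IsSFiniteKernel κ] {f : (ℕ → M) → ℝ≥0∞} (hf : Measurable f)
    (i j : ℕ) : Measurable fun w => ∫⁻ y, f (Function.update w j y) ∂(κ (w i)) := by
  have h : Measurable fun p : (ℕ → M) × M => f (Function.update p.1 j p.2) :=
    hf.comp measurable_update'
  exact h.lintegral_kernel_prod_right' (κ := κ.comap (fun w : ℕ → M => w i) (measurable_pi_apply i))

/-- The Markov property over several steps. -/
lemma IsMarkovLaw.lintegral_pow (hL : IsMarkovLaw κ L) (n : ℕ) {g : ℕ} (hg : 1 ≤ g)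
    {f : (ℕ → M) → ℝ≥0∞} (hf : Measurable f) (hdep : DependsOn f (Set.Iic n ∪ {n + g})) :
    ∫⁻ w, f w ∂L = ∫⁻ w, ∫⁻ y, f (Function.update w (n + g) y) ∂((κ ^ g) (w n)) ∂L := by
  induction g, hg using Nat.le_induction generalizing f with
  | base =>
    rw [pow_one]
    refine hL n f hf (hdep.mono ?_)
    rintro i (hi | hi)
    · simp only [Set.mem_Iic] at hi ⊢; omega
    · simp only [Set.mem_singleton_iff, Set.mem_Iic] at hi ⊢; omega
  | succ g hg ih =>
    have hdep' : DependsOn f (Set.Iic (n + g + 1)) := hdep.mono (by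
      rintro i (hi | hi)
      · simp only [Set.mem_Iic] at hi ⊢; omega
      · simp only [Set.mem_singleton_iff, Set.mem_Iic] at hi ⊢; omega)
    have hF : Measurable fun w => ∫⁻ y, f (Function.update w (n + g + 1) y) ∂(κ (w (n + g))) :=
      measurable_lintegral_update hf _ _
    rw [hL (n + g) f hf hdep', ih hF]
    · refine lintegral_congr fun w => ?_
      have hfw : Measurable fun y => f (Function.update w (n + (g + 1)) y) :=
        hf.comp (measurable_update w)
      rw [_root_.pow_succ', show κ * κ ^ g = κ ∘ₖ (κ ^ g) from rfl,
        Kernel.lintegral_comp _ _ _ hfw]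
      refine lintegral_congr fun y => ?_
      rw [Function.update_self]
      refine lintegral_congr fun z => hdep fun i hi => ?_
      by_cases h1 : i = n + g + 1
      · subst h1; simp [add_assoc]
      · rw [Function.update_of_ne h1, Function.update_of_ne (show i ≠ n + (g + 1) from h1)]
        rcases hi with hi | hi
        · rw [Function.update_of_ne]
          simp only [Set.mem_Iic] at hi; omega
        · exact absurd hi h1
    · intro w w' hw
      have h0 : w (n + g) = w' (n + g) := hw _ (Or.inr rfl)
      simp only [h0]
      refine lintegral_congr fun y => hdep fun i hi => ?_
      by_cases h1 : i = n + g + 1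
      · subst h1; simp
      · rw [Function.update_of_ne h1, Function.update_of_ne h1]
        rcases hi with hi | hi
        · exact hw _ (Or.inl hi)
        · exact absurd hi h1

omit [MeasurableSpace M] in
lemma dependsOn_update {β : Type*} {f : (ℕ → M) → β} {S : Set ℕ} (hdep : DependsOn f S)
    {w w' : ℕ → M} {s : ℕ} (h : ∀ i ∈ S, i ≠ s → w i = w' i) (y : M) :
    f (Function.update w s y) = f (Function.update w' s y) := by
  refine hdep fun i hi => ?_
  by_cases h1 : i = s
  · subst h1; simp
  · rw [Function.update_of_ne h1, Function.update_of_ne h1]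
    exact h i hi h1

lemma DependsOn.lintegral_update {μ : Measure M} {f : (ℕ → M) → ℝ≥0∞} {S : Set ℕ} {s : ℕ}
    (hdep : DependsOn f (insert s S)) :
    DependsOn (fun w => ∫⁻ y, f (Function.update w s y) ∂μ) S := by
  intro w w' h
  refine lintegral_congr fun y => dependsOn_update hdep (fun i hi his => h i ?_) y
  exact hi.resolve_left his

/-- If the transition probability over `g` steps is at most `c μ`, then the states at times which
are at distance at least `g` from each other and from the times up to `N` may be replaced by
independent `μ`-distributed ones, at the cost of a factor `c` for each of them. -/
lemma IsMarkovLaw.lintegral_le_lmarginal (hL : IsMarkovLaw κ L) {μ : Measure M}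
    [IsProbabilityMeasure μ] {c : ℝ≥0∞} {g : ℕ} (hg : 1 ≤ g) (hc : ∀ x, (κ ^ g) x ≤ c • μ) (N : ℕ)
    (B : Finset ℕ) {f : (ℕ → M) → ℝ≥0∞} (hf : Measurable f)
    (hdep : DependsOn f (Set.Iic N ∪ B)) (hN : ∀ s ∈ B, N + g ≤ s)
    (hB : ∀ s ∈ B, ∀ t ∈ B, t < s → t + g ≤ s) :
    ∫⁻ w, f w ∂L ≤ c ^ B.card * ∫⁻ w, (∫⋯∫⁻_B, f ∂(fun _ => μ)) w ∂L := by
  induction B using Finset.induction_on_max generalizing f with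
  | empty => simp
  | insert s B hlt ih =>
    have hs : s ∉ B := fun h => (hlt s h).false
    have hNs := hN s (Finset.mem_insert_self s B)
    have hF : Measurable fun w => ∫⁻ y, f (Function.update w s y) ∂μ := by
      rw [← lmarginal_singleton (μ := fun _ => μ)]
      exact hf.lmarginal _
    have hsg : s - g + g = s := by omega
    rw [lmarginal_insert' f hf hs, Finset.card_insert_of_notMem hs]
    have h1 : ∫⁻ w, f w ∂L ≤ c * ∫⁻ w, ∫⁻ y, f (Function.update w s y) ∂μ ∂L := by
      rw [hL.lintegral_pow (s - g) hg hf (hdep.mono ?_), hsg, ← lintegral_const_mul _ hF]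
      · refine lintegral_mono fun w => (lintegral_mono' (hc _) le_rfl).trans ?_
        rw [lintegral_smul_measure, smul_eq_mul]
      · rw [hsg]
        rintro i (hi | hi)
        · left; simp only [Set.mem_Iic] at hi ⊢; omega
        · rcases Finset.mem_insert.1 (Finset.mem_coe.1 hi) with rfl | hi
          · exact Or.inr rfl
          · left
            have := hB s (Finset.mem_insert_self s B) i (Finset.mem_insert_of_mem hi) (hlt i hi)
            simp only [Set.mem_Iic]; omega
    have h2 := ih hF (DependsOn.lintegral_update (S := Set.Iic N ∪ B) (hdep.mono (by
        rw [Finset.coe_insert, Set.union_insert])))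
      (fun t ht => hN t (Finset.mem_insert_of_mem ht))
      (fun a ha b hb => hB a (Finset.mem_insert_of_mem ha) b (Finset.mem_insert_of_mem hb))
    rw [pow_succ', mul_assoc]
    exact h1.trans (by gcongr)

/-- The lower bound corresponding to `IsMarkovLaw.lintegral_le_lmarginal`. -/
lemma IsMarkovLaw.lmarginal_le_lintegral (hL : IsMarkovLaw κ L) {μ : Measure M}
    [IsProbabilityMeasure μ] {c : ℝ≥0∞} {g : ℕ} (hg : 1 ≤ g) (hc : ∀ x, c • μ ≤ (κ ^ g) x) (N : ℕ)
    (B : Finset ℕ) {f : (ℕ → M) → ℝ≥0∞} (hf : Measurable f)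
    (hdep : DependsOn f (Set.Iic N ∪ B)) (hN : ∀ s ∈ B, N + g ≤ s)
    (hB : ∀ s ∈ B, ∀ t ∈ B, t < s → t + g ≤ s) :
    c ^ B.card * ∫⁻ w, (∫⋯∫⁻_B, f ∂(fun _ => μ)) w ∂L ≤ ∫⁻ w, f w ∂L := by
  induction B using Finset.induction_on_max generalizing f with
  | empty => simp
  | insert s B hlt ih =>
    have hs : s ∉ B := fun h => (hlt s h).false
    have hNs := hN s (Finset.mem_insert_self s B)
    have hF : Measurable fun w => ∫⁻ y, f (Function.update w s y) ∂μ := by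
      rw [← lmarginal_singleton (μ := fun _ => μ)]
      exact hf.lmarginal _
    have hsg : s - g + g = s := by omega
    rw [lmarginal_insert' f hf hs, Finset.card_insert_of_notMem hs]
    have h1 : c * ∫⁻ w, ∫⁻ y, f (Function.update w s y) ∂μ ∂L ≤ ∫⁻ w, f w ∂L := by
      rw [hL.lintegral_pow (s - g) hg hf (hdep.mono ?_), hsg, ← lintegral_const_mul _ hF]
      · refine lintegral_mono fun w => le_trans ?_ (lintegral_mono' (hc _) le_rfl)
        rw [lintegral_smul_measure, smul_eq_mul]
      · rw [hsg]
        rintro i (hi | hi)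
        · left; simp only [Set.mem_Iic] at hi ⊢; omega
        · rcases Finset.mem_insert.1 (Finset.mem_coe.1 hi) with rfl | hi
          · exact Or.inr rfl
          · left
            have := hB s (Finset.mem_insert_self s B) i (Finset.mem_insert_of_mem hi) (hlt i hi)
            simp only [Set.mem_Iic]; omega
    have h2 := ih hF (DependsOn.lintegral_update (S := Set.Iic N ∪ B) (hdep.mono (by
        rw [Finset.coe_insert, Set.union_insert])))
      (fun t ht => hN t (Finset.mem_insert_of_mem ht))
      (fun a ha b hb => hB a (Finset.mem_insert_of_mem ha) b (Finset.mem_insert_of_mem hb))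
    rw [pow_succ', mul_assoc]
    exact le_trans (by gcongr) h1

/-- The Feynman–Kac formula: the exponential moment of an additive functional of the chain is
given by the powers of the tilted operator. -/
lemma IsMarkovLaw.lintegral_prod_exp (hL : IsMarkovLaw κ L) {V : M → ℝ} (hV : BddMeas V) (N : ℕ)
    {f : M → ℝ} (hf : BddMeas f) (h0 : ∀ x, 0 ≤ f x) :
    ∫⁻ w, (∏ n ∈ Finset.Icc 1 N, ENNReal.ofReal (Real.exp (V (w n)))) * ENNReal.ofReal (f (w N)) ∂L
      = ∫⁻ w, ENNReal.ofReal ((tilt κ V)^[N] f (w 0)) ∂L := by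
  have hK := tilt_positiveOperator (T := κ) hV
  induction N generalizing f with
  | zero => simp
  | succ N ih =>
    have hVm := hV.measurable
    have hfm := hf.measurable
    rw [hL N _ (by fun_prop), Function.iterate_succ_apply, ← ih (hK.bddMeas hf) (hK.nonneg hf h0)]
    · refine lintegral_congr fun w => ?_
      have e : ∀ y, (∏ n ∈ Finset.Icc 1 (N + 1),
          ENNReal.ofReal (Real.exp (V (Function.update w (N + 1) y n))))
            * ENNReal.ofReal (f (Function.update w (N + 1) y (N + 1)))
          = (∏ n ∈ Finset.Icc 1 N, ENNReal.ofReal (Real.exp (V (w n))))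
            * ENNReal.ofReal (Real.exp (V y) * f y) := by
        intro y
        rw [Finset.prod_Icc_succ_top (by omega), Function.update_self,
          ENNReal.ofReal_mul (Real.exp_pos _).le, mul_assoc]
        congr 1
        refine Finset.prod_congr rfl fun n hn => ?_
        rw [Function.update_of_ne (by have := (Finset.mem_Icc.1 hn).2; omega)]
      simp_rw [e]
      rw [lintegral_const_mul _ (by fun_prop)]
      congr 1
      rw [tilt, ofReal_integral_eq_lintegral_ofReal ((hV.exp.mul hf).integrable _)
        (ae_of_all _ fun y => mul_nonneg (Real.exp_pos _).le (h0 y))]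
    · intro w w' h
      simp only
      rw [h (N + 1) (Set.mem_Iic.2 le_rfl)]
      congr 1
      refine Finset.prod_congr rfl fun n hn => ?_
      rw [h n (Finset.mem_Icc.1 hn).2]

end

/-! ### Uniform mixing under the strong Doeblin condition -/

section

variable {M : Type*} [MeasurableSpace M] {κ : Kernel M M} [IsMarkovKernel κ]

lemma tilt_zero_iterate {f : M → ℝ} (hf : BddMeas f) (n : ℕ) (x : M) :
    (tilt κ fun _ => 0)^[n] f x = ∫ y, f y ∂((κ ^ n) x) := by
  induction n generalizing f x with
  | zero =>
    rw [pow_zero, show (1 : Kernel M M) = Kernel.id from rfl, Kernel.id_apply,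
      integral_dirac' _ _ hf.measurable.stronglyMeasurable]
    rfl
  | succ n ih =>
    rw [Function.iterate_succ_apply, ih ((tilt_positiveOperator (BddMeas.const 0)).bddMeas hf),
      pow_succ', show κ * κ ^ n = κ ∘ₖ (κ ^ n) from rfl,
      Kernel.integral_comp (hf.integrable _)]
    simp [tilt]

omit [IsMarkovKernel κ] in
lemma invariant_pow {μ : Measure M} (hμ : κ.Invariant μ) (n : ℕ) : (κ ^ n).Invariant μ := by
  induction n with
  | zero =>
    rw [pow_zero]
    exact Measure.bind_dirac
  | succ n ih => rw [pow_succ]; exact ih.comp hμ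

lemma integral_tilt_zero_iterate {μ : Measure M} [IsProbabilityMeasure μ] (hμ : κ.Invariant μ)
    {f : M → ℝ} (hf : BddMeas f) (n : ℕ) :
    ∫ x, (tilt κ fun _ => 0)^[n] f x ∂μ = ∫ x, f x ∂μ := by
  simp_rw [tilt_zero_iterate hf]
  have h : ((κ ^ n) ∘ₖ Kernel.const Unit μ) () = μ := by
    rw [Kernel.comp_apply, Kernel.const_apply]
    exact (invariant_pow hμ n).def
  have h1 := Kernel.integral_comp (η := κ ^ n) (κ := Kernel.const Unit μ) (a := ())
    (f := f) (by rw [h]; exact hf.integrable μ)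
  rw [h, Kernel.const_apply] at h1
  exact h1.symm

/-- Under the strong Doeblin condition the `n₀`-step transition probabilities are comparable with
the invariant measure. -/
lemma StrongDoeblin.exists_bounds {μ : Measure M} [IsProbabilityMeasure μ] (hκ : StrongDoeblin κ)
    (hμ : κ.Invariant μ) : ∃ n₀ : ℕ, 0 < n₀ ∧ ∃ c : ℝ, 0 < c ∧ c ≤ 1 ∧ ∀ (f : M → ℝ), BddMeas f →
      (∀ x, 0 ≤ f x) → ∀ x, c * ∫ y, f y ∂μ ≤ (tilt κ fun _ => 0)^[n₀] f x ∧
        (tilt κ fun _ => 0)^[n₀] f x ≤ c⁻¹ * ∫ y, f y ∂μ := by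
  obtain ⟨n₀, hn₀, C, hC, ν, hν, h⟩ := hκ
  have hC0 : (0 : ℝ) < C := hC
  have hf1 : ∀ f : M → ℝ, BddMeas f → (∀ x, 0 ≤ f x) → ∀ x,
      (C : ℝ)⁻¹ * ∫ y, f y ∂ν ≤ (tilt κ fun _ => 0)^[n₀] f x ∧
        (tilt κ fun _ => 0)^[n₀] f x ≤ C * ∫ y, f y ∂ν := by
    intro f hf h0 x
    rw [tilt_zero_iterate hf]
    have h1 : C⁻¹ • ν ≤ (κ ^ n₀) x := Measure.le_iff.2 fun G hG => (h x G hG).1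
    have h2 : (κ ^ n₀) x ≤ C • ν := Measure.le_iff.2 fun G hG => (h x G hG).2
    have h3 := integral_mono_measure h1 (ae_of_all _ h0) (hf.integrable _)
    have h4 := integral_mono_measure h2 (ae_of_all _ h0) (hf.integrable _)
    rw [integral_smul_nnreal_measure] at h3 h4
    exact ⟨h3, h4⟩
  have hμν : ∀ f : M → ℝ, BddMeas f → (∀ x, 0 ≤ f x) →
      (C : ℝ)⁻¹ * ∫ y, f y ∂ν ≤ ∫ y, f y ∂μ ∧ ∫ y, f y ∂μ ≤ C * ∫ y, f y ∂ν := by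
    intro f hf h0
    have hA := ((tilt_positiveOperator (T := κ) (BddMeas.const 0)).iterate n₀).bddMeas hf
    rw [← integral_tilt_zero_iterate hμ hf n₀]
    constructor
    · simpa using integral_mono (integrable_const _) (hA.integrable μ) fun x => (hf1 f hf h0 x).1
    · simpa using integral_mono (hA.integrable μ) (integrable_const _) fun x => (hf1 f hf h0 x).2
  have hC1 : (1 : ℝ) ≤ C := by
    simpa using (hμν (fun _ => 1) (BddMeas.const 1) fun _ => zero_le_one).2
  refine ⟨n₀, hn₀, ((C : ℝ) ^ 2)⁻¹, by positivity, inv_le_one_of_one_le₀ (one_le_pow₀ hC1),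
    fun f hf h0 x => ?_⟩
  obtain ⟨h1, h2⟩ := hf1 f hf h0 x
  obtain ⟨h3, h4⟩ := hμν f hf h0
  constructor
  · refine le_trans ?_ h1
    calc ((C : ℝ) ^ 2)⁻¹ * ∫ y, f y ∂μ ≤ ((C : ℝ) ^ 2)⁻¹ * (C * ∫ y, f y ∂ν) := by gcongr
      _ = _ := by field_simp
  · refine h2.trans ?_
    calc (C : ℝ) * ∫ y, f y ∂ν = C ^ 2 * ((C : ℝ)⁻¹ * ∫ y, f y ∂ν) := by field_simp
      _ ≤ _ := by rw [inv_inv]; gcongr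

/-- Uniform convergence of the transition probabilities to the invariant measure, in the sense
that their densities converge to one uniformly. -/
lemma StrongDoeblin.exists_mixing {μ : Measure M} [IsProbabilityMeasure μ] (hκ : StrongDoeblin κ)
    (hμ : κ.Invariant μ) {δ : ℝ} (hδ : 0 < δ) : ∃ g : ℕ, 1 ≤ g ∧
      ∀ x, (κ ^ g) x ≤ ENNReal.ofReal (1 + δ) • μ ∧ ENNReal.ofReal (1 - δ) • μ ≤ (κ ^ g) x := by
  obtain ⟨n₀, hn₀, c, hc, hc1, h⟩ := hκ.exists_bounds hμ
  have hA := tilt_positiveOperator (T := κ) (BddMeas.const 0)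
  have one : BddMeas (fun _ : M => (1 : ℝ)) := BddMeas.const 1
  have hone : ∀ n x, (tilt κ fun _ => 0)^[n] (fun _ => 1) x = 1 := tilt_zero_iterate_one
  have hsucc : ∀ (k : ℕ) (f : M → ℝ), (tilt κ fun _ => 0)^[n₀ * (k + 1)] f
      = (tilt κ fun _ => 0)^[n₀] ((tilt κ fun _ => 0)^[n₀ * k] f) := by
    intro k f
    rw [← Function.iterate_add_apply]
    congr 2
    ring
  have hlow : ∀ (k : ℕ) (f : M → ℝ), BddMeas f → (∀ x, 0 ≤ f x) → ∀ x,
      (1 - (1 - c) ^ k) * ∫ y, f y ∂μ ≤ (tilt κ fun _ => 0)^[n₀ * k] f x := by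
    intro k f hf h0
    induction k with
    | zero => intro x; simpa using h0 x
    | succ k ih =>
      intro x
      have hk := (hA.iterate (n₀ * k)).bddMeas hf
      set b := (1 - (1 - c) ^ k) * ∫ y, f y ∂μ with hb
      have h1 := (h _ (hk.sub (one.const_mul b)) (fun y => by simpa using ih y) x).1
      rw [(hA.iterate n₀).sub hk one, hone, integral_sub (hk.integrable μ)
        ((one.const_mul b).integrable μ), integral_tilt_zero_iterate hμ hf] at h1
      simp only [mul_one, integral_const, probReal_univ, one_smul] at h1
      rw [hsucc, pow_succ]
      rw [hb] at h1
      linarith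
  have hup : ∀ (k : ℕ) (f : M → ℝ), BddMeas f → (∀ x, 0 ≤ f x) → ∀ x,
      (tilt κ fun _ => 0)^[n₀ * (k + 1)] f x
        ≤ (1 + (c⁻¹ - 1) * (1 - c) ^ k) * ∫ y, f y ∂μ := by
    intro k f hf h0
    induction k with
    | zero => intro x; simpa using (h f hf h0 x).2
    | succ k ih =>
      intro x
      have hk := (hA.iterate (n₀ * (k + 1))).bddMeas hf
      set b := (1 + (c⁻¹ - 1) * (1 - c) ^ k) * ∫ y, f y ∂μ with hb
      have h1 := (h _ ((one.const_mul b).sub hk) (fun y => by simpa using ih y) x).1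
      have h2 : (tilt κ fun _ => 0)^[n₀]
          (fun y => b * 1 - (tilt κ fun _ => 0)^[n₀ * (k + 1)] f y) x
          = b - (tilt κ fun _ => 0)^[n₀ * (k + 1 + 1)] f x := by
        have := (hA.iterate n₀).linear one hk b (-1) x
        rw [hone] at this
        rw [hsucc (k + 1)]
        simp only [sub_eq_add_neg]
        simpa only [neg_one_mul, mul_one] using this
      rw [h2, integral_sub ((one.const_mul b).integrable μ) (hk.integrable μ),
        integral_tilt_zero_iterate hμ hf] at h1
      simp only [mul_one, integral_const, probReal_univ, one_smul] at h1
      rw [pow_succ]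
      rw [hb] at h1
      linarith
  have hlim : Tendsto (fun k : ℕ => (1 - c) ^ k) atTop (𝓝 0) :=
    tendsto_pow_atTop_nhds_zero_of_lt_one (by linarith) (by linarith)
  have hlim2 : Tendsto (fun k : ℕ => (1 - c) ^ (k + 1)) atTop (𝓝 0) :=
    hlim.comp (tendsto_add_atTop_nat 1)
  have hlim3 : Tendsto (fun k : ℕ => (c⁻¹ - 1) * (1 - c) ^ k) atTop (𝓝 0) := by
    simpa using hlim.const_mul (c⁻¹ - 1)
  obtain ⟨k, hk1, hk2⟩ := ((hlim2.eventually_le_const hδ).and (hlim3.eventually_le_const hδ)).exists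
  refine ⟨n₀ * (k + 1), Nat.mul_pos hn₀ (Nat.succ_pos k), fun x => ?_⟩
  have hind : ∀ G : Set M, MeasurableSet G → ∀ ρ : Measure M, IsProbabilityMeasure ρ →
      BddMeas (G.indicator fun _ => (1 : ℝ)) ∧ (∀ x, 0 ≤ G.indicator (fun _ => (1 : ℝ)) x) ∧
        ∫ y, G.indicator (fun _ => (1 : ℝ)) y ∂ρ = ρ.real G := by
    intro G hG ρ _
    refine ⟨BddMeas.of_mem_Icc (a := 0) (b := 1) (measurable_const.indicator hG) fun x => by
      by_cases hx : x ∈ G <;> simp [hx], fun x => Set.indicator_nonneg (fun _ _ => zero_le_one) x,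
      ?_⟩
    rw [integral_indicator_const _ hG, smul_eq_mul, mul_one]
  constructor <;> refine Measure.le_iff.2 fun G hG => ?_
  all_goals
    obtain ⟨b1, b2, b3⟩ := hind G hG μ inferInstance
    obtain ⟨-, -, b4⟩ := hind G hG ((κ ^ (n₀ * (k + 1))) x) inferInstance
    rw [Measure.smul_apply, smul_eq_mul, ← ofReal_measureReal (measure_ne_top μ G),
      ← ofReal_measureReal (measure_ne_top ((κ ^ (n₀ * (k + 1))) x) G)]
  · rw [← ENNReal.ofReal_mul (by linarith)]
    refine ENNReal.ofReal_le_ofReal ?_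
    have := hup k _ b1 b2 x
    rw [tilt_zero_iterate b1, b3, b4] at this
    exact this.trans (by gcongr)
  · rw [← ENNReal.ofReal_mul' measureReal_nonneg]
    refine ENNReal.ofReal_le_ofReal ?_
    have := hlow (k + 1) _ b1 b2 x
    rw [tilt_zero_iterate b1, b3, b4] at this
    exact le_trans (by gcongr) this

end

/-! ### The kernel `κ × μ^m` -/

section

variable {M : Type*} [MeasurableSpace M] {m : ℕ}

lemma measurable_cons :
    Measurable fun p : M × (Fin m → M) => (Fin.cons p.1 p.2 : Fin (m + 1) → M) := by
  refine measurable_pi_lambda _ fun i => ?_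
  refine Fin.cases ?_ (fun j => ?_) i
  · simpa using measurable_fst
  · simp only [Fin.cons_succ]
    exact (measurable_pi_apply j).comp measurable_snd

/-- The law of `(y, z₂, …, z_ℓ)` with `y` distributed according to `ρ` and independent
`μ`-distributed `z_j`. -/
noncomputable def consMeasure (m : ℕ) (μ ρ : Measure M) : Measure (Fin (m + 1) → M) :=
  (ρ.prod (Measure.pi fun _ : Fin m => μ)).map fun p => Fin.cons p.1 p.2

/-- The transition probability of the chain `(X(n), Z₂(n), …, Z_ℓ(n))` in which the `Z_j(n)` are
independent with distribution `μ`. -/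
noncomputable def productKernel (m : ℕ) (κ : Kernel M M) [IsMarkovKernel κ] (μ : Measure M)
    [IsProbabilityMeasure μ] : Kernel (Fin (m + 1) → M) (Fin (m + 1) → M) :=
  ((κ.comap (fun x : Fin (m + 1) → M => x 0) (measurable_pi_apply 0)) ×ₖ
    Kernel.const _ (Measure.pi fun _ : Fin m => μ)).map fun p => Fin.cons p.1 p.2

variable {κ : Kernel M M} [IsMarkovKernel κ] {μ : Measure M} [IsProbabilityMeasure μ]

instance : IsMarkovKernel (productKernel m κ μ) := Kernel.IsMarkovKernel.map _ measurable_cons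

instance (ρ : Measure M) [IsProbabilityMeasure ρ] : IsProbabilityMeasure (consMeasure m μ ρ) :=
  Measure.isProbabilityMeasure_map measurable_cons.aemeasurable

lemma productKernel_apply (x : Fin (m + 1) → M) :
    productKernel m κ μ x = consMeasure m μ (κ (x 0)) := by
  rw [productKernel, Kernel.map_apply _ measurable_cons, Kernel.prod_apply]
  rfl

lemma integral_productKernel {f : (Fin (m + 1) → M) → ℝ} (hf : BddMeas f) (x : Fin (m + 1) → M) :
    ∫ y, f y ∂(productKernel m κ μ x) = transitionMean κ μ f x := by
  rw [productKernel_apply, consMeasure, integral_map measurable_cons.aemeasurable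
    hf.measurable.aestronglyMeasurable, integral_prod _ ((hf.comp measurable_cons).integrable _)]
  rfl

lemma consMeasure_apply (ρ : Measure M) [IsProbabilityMeasure ρ] {S : Set (Fin (m + 1) → M)}
    (hS : MeasurableSet S) : consMeasure m μ ρ S
      = ∫⁻ y, (Measure.pi fun _ : Fin m => μ) {z | (Fin.cons y z : Fin (m + 1) → M) ∈ S} ∂ρ := by
  rw [consMeasure, Measure.map_apply measurable_cons hS, Measure.prod_apply (measurable_cons hS)]
  rfl

lemma productKernel_invariant (hμ : κ.Invariant μ) :
    (productKernel m κ μ).Invariant (consMeasure m μ μ) := by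
  refine Measure.ext fun S hS => ?_
  have hF : Measurable fun y =>
      (Measure.pi fun _ : Fin m => μ) {z | (Fin.cons y z : Fin (m + 1) → M) ∈ S} :=
    measurable_measure_prodMk_left (measurable_cons hS)
  have hG : Measurable fun y => ∫⁻ z, (Measure.pi fun _ : Fin m => μ)
      {z' | (Fin.cons z z' : Fin (m + 1) → M) ∈ S} ∂(κ y) := hF.lintegral_kernel
  have hG0 := hG.comp
    (measurable_pi_apply (0 : Fin (m + 1)) : Measurable fun a : Fin (m + 1) → M => a 0)
  rw [Measure.bind_apply hS (productKernel m κ μ).measurable.aemeasurable]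
  simp_rw [productKernel_apply, consMeasure_apply _ hS]
  rw [consMeasure, lintegral_map (f := fun a => ∫⁻ y, (Measure.pi fun _ : Fin m => μ)
    {z | (Fin.cons y z : Fin (m + 1) → M) ∈ S} ∂(κ (a 0))) hG0 measurable_cons]
  simp only [Fin.cons_zero]
  have hG1 : AEMeasurable (fun p : M × (Fin m → M) => ∫⁻ z, (Measure.pi fun _ : Fin m => μ)
      {z' | (Fin.cons z z' : Fin (m + 1) → M) ∈ S} ∂(κ p.1)) (μ.prod (Measure.pi fun _ => μ)) :=
    (hG.comp measurable_fst).aemeasurable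
  rw [lintegral_prod _ hG1]
  simp only [lintegral_const, measure_univ, mul_one]
  rw [← Measure.lintegral_bind κ.measurable.aemeasurable hF.aemeasurable, hμ.def]

/-- The potential on `M` obtained by averaging `e^W` over the independent coordinates. -/
noncomputable def reduced (μ : Measure M) (W : (Fin (m + 1) → M) → ℝ) (y : M) : ℝ :=
  Real.log (∫ z, Real.exp (W (Fin.cons y z)) ∂(Measure.pi fun _ : Fin m => μ))

lemma BddMeas.section_integral {f : (Fin (m + 1) → M) → ℝ} (hf : BddMeas f) :
    BddMeas fun y => ∫ z, f (Fin.cons y z) ∂(Measure.pi fun _ : Fin m => μ) := by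
  obtain ⟨C, hC⟩ := hf.bounded
  refine ⟨((hf.measurable.comp measurable_cons).stronglyMeasurable.integral_prod_right'
    (ν := Measure.pi fun _ : Fin m => μ)).measurable, C, fun x => ?_⟩
  have := norm_integral_le_of_norm_le_const (μ := Measure.pi fun _ : Fin m => μ)
    (f := fun z => f (Fin.cons x z)) (ae_of_all _ fun z => hC _)
  simpa using this

lemma exp_section_lower {W : (Fin (m + 1) → M) → ℝ} (hW : Measurable W) {w : ℝ}
    (hw : ∀ x, |W x| ≤ w) (y : M) :
    Real.exp (-w) ≤ ∫ z, Real.exp (W (Fin.cons y z)) ∂(Measure.pi fun _ : Fin m => μ) := by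
  have hi : Integrable (fun z => Real.exp (W (Fin.cons y z))) (Measure.pi fun _ : Fin m => μ) :=
    ((BddMeas.mk hW ⟨w, hw⟩).exp.comp (measurable_cons.comp measurable_prodMk_left)).integrable _
  simpa using integral_mono (integrable_const (Real.exp (-w))) hi
    fun z => Real.exp_le_exp.2 (abs_le.1 (hw _)).1

lemma bddMeas_reduced {W : (Fin (m + 1) → M) → ℝ} (hW : BddMeas W) : BddMeas (reduced μ W) := by
  obtain ⟨w, hw⟩ := hW.bounded
  exact hW.exp.section_integral.log (Real.exp_pos _) (exp_section_lower hW.measurable hw)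

lemma exp_reduced {W : (Fin (m + 1) → M) → ℝ} (hW : BddMeas W) (y : M) :
    Real.exp (reduced μ W y)
      = ∫ z, Real.exp (W (Fin.cons y z)) ∂(Measure.pi fun _ : Fin m => μ) := by
  obtain ⟨w, hw⟩ := hW.bounded
  exact Real.exp_log ((Real.exp_pos _).trans_le (exp_section_lower hW.measurable hw y))

/-- On functions of the first coordinate the tilted product chain acts like the chain itself, tilted
by the reduced potential. -/
lemma tilt_productKernel {W : (Fin (m + 1) → M) → ℝ} (hW : BddMeas W) {f : M → ℝ}
    (hf : BddMeas f) (n : ℕ) (x : Fin (m + 1) → M) :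
    (tilt (productKernel m κ μ) W)^[n] (fun x => f (x 0)) x
      = (tilt κ (reduced μ W))^[n] f (x 0) := by
  have hr := bddMeas_reduced (μ := μ) hW
  induction n generalizing f with
  | zero => rfl
  | succ n ih =>
    rw [Function.iterate_succ_apply, Function.iterate_succ_apply,
      ← ih ((tilt_positiveOperator hr).bddMeas hf)]
    refine congrArg (fun F => (tilt (productKernel m κ μ) W)^[n] F x) (funext fun x => ?_)
    rw [tilt, integral_productKernel (hW.exp.mul (hf.comp (measurable_pi_apply 0))), tilt,
      transitionMean]
    refine integral_congr_ae (ae_of_all _ fun y => ?_)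
    simp only
    rw [exp_reduced hW, ← integral_mul_const]
    rfl

/-- The Harnack inequality for the product chain: its transition probabilities depend on the first
coordinate only, and there the strong Doeblin condition applies. -/
lemma exists_comparable (hκ : StrongDoeblin κ) (hμ : κ.Invariant μ) : ∃ (n₀ : ℕ) (D : ℝ), 1 ≤ D ∧
    Comparable (tilt (productKernel m κ μ) fun _ => 0)^[n₀] D := by
  obtain ⟨n₀, hn₀, c, hc, hc1, h⟩ := hκ.exists_bounds hμ
  refine ⟨n₀, (c ^ 2)⁻¹, (one_le_inv₀ (by positivity)).2 (pow_le_one₀ hc.le hc1), ?_⟩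
  intro f hf h0 x x'
  have hbar := hf.section_integral (μ := μ)
  have hz : reduced μ (fun _ : Fin (m + 1) → M => (0 : ℝ)) = fun _ => 0 := by
    ext y; simp [reduced]
  have e : ∀ x, (tilt (productKernel m κ μ) fun _ => 0)^[n₀] f x = (tilt κ fun _ => 0)^[n₀]
      (fun y => ∫ z, f (Fin.cons y z) ∂(Measure.pi fun _ : Fin m => μ)) (x 0) := by
    intro x
    obtain ⟨k, rfl⟩ : ∃ k, n₀ = k + 1 := ⟨n₀ - 1, by omega⟩
    have e1 : tilt (productKernel m κ μ) (fun _ => 0) f = fun x => tilt κ (fun _ => 0)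
        (fun y => ∫ z, f (Fin.cons y z) ∂(Measure.pi fun _ : Fin m => μ)) (x 0) := by
      ext x
      simp only [tilt, Real.exp_zero, one_mul]
      rw [integral_productKernel hf]
      rfl
    rw [Function.iterate_succ_apply, Function.iterate_succ_apply, e1,
      tilt_productKernel (BddMeas.const 0)
        ((tilt_positiveOperator (BddMeas.const 0)).bddMeas hbar), hz]
  have hb0 : ∀ y, 0 ≤ ∫ z, f (Fin.cons y z) ∂(Measure.pi fun _ : Fin m => μ) := fun y =>
    integral_nonneg fun z => h0 _
  rw [e, e]
  refine (h _ hbar hb0 (x 0)).2.trans ?_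
  have := (h _ hbar hb0 (x' 0)).1
  rw [show ∀ r : ℝ, c⁻¹ * r = (c ^ 2)⁻¹ * (c * r) from fun r => by field_simp]
  gcongr

lemma dvRate_productKernel [TopologicalSpace M] [CompactSpace M] [PolishSpace M] [BorelSpace M]
    (η : Measure (Fin (m + 1) → M)) : dvRate (productKernel m κ μ) η = rate κ μ η := by
  unfold dvRate rate
  simp_rw [fun u : {u : C(Fin (m + 1) → M, ℝ) // ∀ x, 0 < u x} =>
    integral_productKernel (κ := κ) (μ := μ) u.1.bddMeas]

end

/-! ### The sampling times -/

section

variable {m : ℕ} {q : Fin (m + 1) → ℝ → ℝ}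

lemma TimeChanges.cast_floor (hq : TimeChanges q) (j : Fin (m + 1)) {n : ℕ} (hn : 0 < n) :
    (⌊q j n⌋₊ : ℝ) = q j n := by
  obtain ⟨i, hi⟩ := hq.integer j n hn
  rw [hi, Nat.floor_natCast]

lemma TimeChanges.floor_zero (hq : TimeChanges q) {n : ℕ} (hn : 0 < n) : ⌊q 0 n⌋₊ = n := by
  rw [hq.first n hn, Nat.floor_natCast]

lemma TimeChanges.floor_mono (hq : TimeChanges q) (j : Fin (m + 1)) {n n' : ℕ} (hn : 0 < n)
    (h : n ≤ n') : ⌊q j n⌋₊ ≤ ⌊q j n'⌋₊ :=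
  Nat.floor_mono (hq.mono j (Set.mem_Ioi.2 (by exact_mod_cast hn))
    (Set.mem_Ioi.2 (by exact_mod_cast hn.trans_le h)) (by exact_mod_cast h))

/-- After dropping the first `ε N` terms, the sampling times of different coordinates are ordered
and all gaps between them, except those of the first coordinate, exceed any given bound. -/
lemma TimeChanges.eventually_gaps (hq : TimeChanges q) {ε : ℝ} (hε : 0 < ε) (g : ℕ) :
    ∀ᶠ N : ℕ in atTop, ∀ j : Fin m,
      (∀ n ≥ ⌈ε * N⌉₊ + 1, ⌊q j.succ n⌋₊ + g ≤ ⌊q j.succ (n + 1 : ℕ)⌋₊) ∧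
        ⌊q j.castSucc N⌋₊ + g ≤ ⌊q j.succ (⌈ε * N⌉₊ + 1 : ℕ)⌋₊ := by
  rw [eventually_all]
  intro j
  obtain ⟨n₁, hn₁⟩ := eventually_atTop.1 ((hq.gaps j).eventually_ge_atTop (g : ℝ))
  have hlarge : Tendsto (fun N : ℕ => ε * (N : ℝ)) atTop atTop :=
    tendsto_natCast_atTop_atTop.const_mul_atTop hε
  have hgap : ∀ n : ℕ, 0 < n → n₁ ≤ n + 1 → ⌊q j.succ n⌋₊ + g ≤ ⌊q j.succ (n + 1 : ℕ)⌋₊ := by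
    intro n hn h1
    have h2 := hn₁ (n + 1) h1
    have h3 : ((n + 1 : ℕ) : ℝ) - 1 = n := by push_cast; ring
    rw [h3, ← hq.cast_floor j.succ hn, ← hq.cast_floor j.succ (Nat.succ_pos n)] at h2
    have h4 : ((⌊q j.succ n⌋₊ + g : ℕ) : ℝ) ≤ (⌊q j.succ (n + 1 : ℕ)⌋₊ : ℝ) := by
      push_cast at h2 ⊢
      linarith
    exact_mod_cast h4
  filter_upwards [hlarge.eventually_ge_atTop (n₁ : ℝ), eventually_gt_atTop 0,
    eventually_lt_of_lt_liminf (hq.spread j ε hε)] with N hN hN0 hsp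
  have hεN : 0 < ε * N := mul_pos hε (by exact_mod_cast hN0)
  have hceil : ε * N ≤ (⌈ε * N⌉₊ : ℝ) := Nat.le_ceil _
  have hc0 : 0 < ⌈ε * N⌉₊ := Nat.ceil_pos.2 hεN
  have hc1 : n₁ ≤ ⌈ε * N⌉₊ := by exact_mod_cast hN.trans hceil
  refine ⟨fun n hn => hgap n (by omega) (by omega), ?_⟩
  refine le_trans ?_ (hgap _ hc0 (by omega))
  have h1 : q j.castSucc N ≤ q j.succ (⌈ε * N⌉₊ : ℕ) := by
    have h2 : 0 < q j.succ (ε * N) - q j.castSucc N := by exact_mod_cast hsp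
    have h3 := hq.mono j.succ (Set.mem_Ioi.2 hεN) (Set.mem_Ioi.2 (hεN.trans_le hceil)) hceil
    linarith
  exact Nat.add_le_add_right (Nat.floor_mono h1) g

end

/-! ### Exponential moments of nonconventional sums -/

section

variable {M : Type*} [MeasurableSpace M] {m : ℕ}

lemma lmarginal_mul_of_dependsOn {μ : Measure M} {B : Finset ℕ} {c f : (ℕ → M) → ℝ≥0∞}
    (hf : Measurable f) {S : Set ℕ} (hc : DependsOn c S) (hS : ∀ i ∈ S, i ∉ B) :
    (∫⋯∫⁻_B, (fun w => c w * f w) ∂(fun _ => μ)) = fun w => c w * (∫⋯∫⁻_B, f ∂(fun _ => μ)) w := by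
  ext w
  have h : ∀ y, c (Function.updateFinset w B y) = c w := fun y => hc fun i hi => by
    rw [Function.updateFinset_def]
    simp [hS i hi]
  simp only [lmarginal, h]
  rw [lintegral_const_mul]
  exact hf.comp measurable_updateFinset

variable {κ : Kernel M M} [IsMarkovKernel κ] {μ : Measure M} [IsProbabilityMeasure μ]

lemma lmarginal_sample {W : (Fin (m + 1) → M) → ℝ} (hW : BddMeas W) (t : Fin (m + 1) → ℕ)
    (ht : Function.Injective t) (w : ℕ → M) :
    (∫⋯∫⁻_(Finset.univ.image fun j : Fin m => t j.succ),
      (fun w => ENNReal.ofReal (Real.exp (W fun j => w (t j)))) ∂(fun _ => μ)) w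
      = ENNReal.ofReal (Real.exp (reduced μ W (w (t 0)))) := by
  have hinj : Function.Injective fun j : Fin m => t j.succ := ht.comp (Fin.succ_injective m)
  have hsec : BddMeas fun z : Fin m → M => Real.exp (W (Fin.cons (w (t 0)) z)) :=
    hW.exp.comp (measurable_cons.comp measurable_prodMk_left)
  have h0 : t 0 ∉ Finset.univ.image fun j : Fin m => t j.succ := by
    simp only [Finset.mem_image, Finset.mem_univ, true_and, not_exists]
    exact fun j h => Fin.succ_ne_zero j (ht h)
  have h1 : (∫⋯∫⁻_(Finset.univ.image fun j : Fin m => t j.succ),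
      (fun w => ENNReal.ofReal (Real.exp (W fun j => w (t j)))) ∂(fun _ => μ)) w
      = (∫⋯∫⁻_(Finset.univ.image fun j : Fin m => t j.succ),
      (fun w' => ENNReal.ofReal (Real.exp (W (Fin.cons (w (t 0)) fun j => w' (t j.succ)))))
        ∂(fun _ => μ)) w := by
    unfold lmarginal
    refine lintegral_congr fun y => ?_
    refine congrArg (fun v => ENNReal.ofReal (Real.exp (W v))) (funext fun j => ?_)
    refine Fin.cases ?_ (fun j => ?_) j
    · rw [Function.updateFinset_def, Fin.cons_zero]
      simp only [h0, dite_false]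
    · rw [Fin.cons_succ]
  rw [h1]
  have h2 := lmarginal_image (μ := fun _ : ℕ => μ) hinj Finset.univ
    (f := fun z : Fin m → M => ENNReal.ofReal (Real.exp (W (Fin.cons (w (t 0)) z))))
    hsec.measurable.ennreal_ofReal w
  refine h2.trans ?_
  rw [lmarginal_univ, exp_reduced hW, ofReal_integral_eq_lintegral_ofReal (hsec.integrable _)
    (ae_of_all _ fun z => (Real.exp_pos _).le)]

/-- Integrating out all sampled coordinates but the first one. -/
lemma lmarginal_prod {W : (Fin (m + 1) → M) → ℝ} (hW : BddMeas W) (t : ℕ → Fin (m + 1) → ℕ)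
    (S : Finset ℕ)
    (ht : ∀ n ∈ S, ∀ n' ∈ S, ∀ j j', t n j = t n' j' → n = n' ∧ j = j') :
    (∫⋯∫⁻_((Finset.univ ×ˢ S).image fun p : Fin m × ℕ => t p.2 p.1.succ),
      (fun w => ∏ n ∈ S, ENNReal.ofReal (Real.exp (W fun j => w (t n j)))) ∂(fun _ => μ))
      = fun w => ∏ n ∈ S, ENNReal.ofReal (Real.exp (reduced μ W (w (t n 0)))) := by
  have hWm := hW.measurable
  induction S using Finset.induction_on with
  | empty => simp
  | insert a S ha ih =>
    have hφ : ∀ n, Measurable fun w : ℕ → M =>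
        ENNReal.ofReal (Real.exp (W fun j => w (t n j))) := fun n => by
      have : Measurable fun (w : ℕ → M) (j : Fin (m + 1)) => w (t n j) := by fun_prop
      exact (hWm.comp this).exp.ennreal_ofReal
    have ih' := ih fun n hn n' hn' => ht n (Finset.mem_insert_of_mem hn) n'
      (Finset.mem_insert_of_mem hn')
    have hunion : ((Finset.univ ×ˢ insert a S).image fun p : Fin m × ℕ => t p.2 p.1.succ)
        = (Finset.univ.image fun j : Fin m => t a j.succ) ∪
          ((Finset.univ ×ˢ S).image fun p : Fin m × ℕ => t p.2 p.1.succ) := by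
      ext i
      simp only [Finset.mem_image, Finset.mem_product, Finset.mem_univ, true_and,
        Finset.mem_insert, Finset.mem_union, Prod.exists]
      constructor
      · rintro ⟨j, n, rfl | hn, rfl⟩
        · exact Or.inl ⟨j, rfl⟩
        · exact Or.inr ⟨j, n, hn, rfl⟩
      · rintro (⟨j, rfl⟩ | ⟨j, n, hn, rfl⟩)
        · exact ⟨j, a, Or.inl rfl, rfl⟩
        · exact ⟨j, n, Or.inr hn, rfl⟩
    have hnot : ∀ j, t a j ∉ (Finset.univ ×ˢ S).image fun p : Fin m × ℕ => t p.2 p.1.succ := by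
      intro j h
      simp only [Finset.mem_image, Finset.mem_product, Finset.mem_univ, true_and,
        Prod.exists] at h
      obtain ⟨j', n, hn, h⟩ := h
      have := (ht n (Finset.mem_insert_of_mem hn) a (Finset.mem_insert_self a S) _ _ h).1
      exact ha (this ▸ hn)
    have hdisj : Disjoint (Finset.univ.image fun j : Fin m => t a j.succ)
        ((Finset.univ ×ˢ S).image fun p : Fin m × ℕ => t p.2 p.1.succ) := by
      rw [Finset.disjoint_left]
      intro i hi
      obtain ⟨j, -, rfl⟩ := Finset.mem_image.1 hi
      exact hnot _
    have hprod : Measurable fun w : ℕ → M =>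
        ∏ n ∈ S, ENNReal.ofReal (Real.exp (W fun j => w (t n j))) :=
      Finset.measurable_fun_prod _ fun n _ => hφ n
    have hmul : Measurable fun w : ℕ → M => ENNReal.ofReal (Real.exp (W fun j => w (t a j))) *
        ∏ n ∈ S, ENNReal.ofReal (Real.exp (W fun j => w (t n j))) := (hφ a).mul hprod
    simp_rw [Finset.prod_insert ha]
    rw [hunion, lmarginal_union _ _ hmul hdisj,
      lmarginal_mul_of_dependsOn (S := Set.range (t a)) hprod ?_ ?_, ih']
    · have hcomm : (fun w : ℕ → M => ENNReal.ofReal (Real.exp (W fun j => w (t a j))) *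
          ∏ n ∈ S, ENNReal.ofReal (Real.exp (reduced μ W (w (t n 0)))))
          = fun w => (∏ n ∈ S, ENNReal.ofReal (Real.exp (reduced μ W (w (t n 0))))) *
            ENNReal.ofReal (Real.exp (W fun j => w (t a j))) := by
        ext w; rw [mul_comm]
      rw [hcomm, lmarginal_mul_of_dependsOn (S := (fun n => t n 0) '' S) (hφ a) ?_ ?_]
      · ext w
        rw [lmarginal_sample hW (t a) (fun j j' h => (ht a (Finset.mem_insert_self a S) a
          (Finset.mem_insert_self a S) j j' h).2), mul_comm]
      · intro w w' h
        refine Finset.prod_congr rfl fun n hn => ?_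
        rw [h _ (Set.mem_image_of_mem _ hn)]
      · rintro _ ⟨n, hn, rfl⟩ h
        obtain ⟨j, -, hj⟩ := Finset.mem_image.1 h
        have := (ht a (Finset.mem_insert_self a S) n (Finset.mem_insert_of_mem hn) _ _ hj).2
        exact Fin.succ_ne_zero j this
    · intro w w' h
      have : (fun j => w (t a j)) = fun j => w' (t a j) := funext fun j => h _ ⟨j, rfl⟩
      simp only [this]
    · rintro _ ⟨j, rfl⟩
      exact hnot j

variable {L : Measure (ℕ → M)} [IsProbabilityMeasure L] {q : Fin (m + 1) → ℝ → ℝ}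

lemma measurable_samplePoint (q : Fin (m + 1) → ℝ → ℝ) (n : ℕ) :
    Measurable fun w : ℕ → M => samplePoint q w n := by
  unfold samplePoint; fun_prop

/-- Decoupling of the sampled product: its expectation is compared with that of the reduced
potential along the chain. -/
lemma lintegral_prod_sample_between (hκ : StrongDoeblin κ) (hμ : κ.Invariant μ)
    (hq : TimeChanges q) (hL : IsMarkovLaw κ L) {W : (Fin (m + 1) → M) → ℝ} (hW : BddMeas W)
    {ε : ℝ} (hε : 0 < ε) : ∀ᶠ N : ℕ in atTop,
      ∫⁻ w, ∏ n ∈ Finset.Icc (⌈ε * N⌉₊ + 1) N,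
          ENNReal.ofReal (Real.exp (W (samplePoint q w n))) ∂L
        ≤ ENNReal.ofReal (1 + ε) ^ (m * N) * ∫⁻ w, ∏ n ∈ Finset.Icc (⌈ε * N⌉₊ + 1) N,
          ENNReal.ofReal (Real.exp (reduced μ W (w n))) ∂L ∧
      ENNReal.ofReal (1 - ε) ^ (m * N) * ∫⁻ w, ∏ n ∈ Finset.Icc (⌈ε * N⌉₊ + 1) N,
          ENNReal.ofReal (Real.exp (reduced μ W (w n))) ∂L
        ≤ ∫⁻ w, ∏ n ∈ Finset.Icc (⌈ε * N⌉₊ + 1) N,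
          ENNReal.ofReal (Real.exp (W (samplePoint q w n))) ∂L := by
  obtain ⟨g, hg, hmix⟩ := hκ.exists_mixing hμ hε
  filter_upwards [hq.eventually_gaps hε g] with N hN
  set a := ⌈ε * N⌉₊ + 1 with ha
  rcases Nat.lt_or_ge N a with hNa | haN
  · simp only [Finset.Icc_eq_empty_of_lt hNa, Finset.prod_empty, lintegral_const, measure_univ,
      mul_one]
    constructor
    · exact one_le_pow₀ (by rw [ENNReal.one_le_ofReal]; linarith)
    · exact pow_le_one₀ bot_le (ENNReal.ofReal_le_one.2 (by linarith))
  have ha0 : 0 < a := Nat.succ_pos _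
  set t : ℕ → Fin (m + 1) → ℕ := fun n j => ⌊q j n⌋₊ with ht
  have hmono : ∀ j {n n' : ℕ}, a ≤ n → n ≤ n' → t n j ≤ t n' j := fun j n n' hn h =>
    hq.floor_mono j (by omega) h
  have ht0 : ∀ n, a ≤ n → t n 0 = n := fun n hn => hq.floor_zero (by omega)
  have hlast : Monotone fun i : Fin (m + 1) => t N i := Fin.monotone_iff_le_succ.2 fun j =>
    ((Nat.le_add_right _ g).trans (hN j).2).trans (hmono _ le_rfl haN)
  have hNt : ∀ (j : Fin m) n, a ≤ n → N + g ≤ t n j.succ := by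
    intro j n hn
    calc N + g = t N 0 + g := by rw [ht0 N haN]
      _ ≤ t N j.castSucc + g := Nat.add_le_add_right (hlast (Fin.zero_le _)) g
      _ ≤ t a j.succ := (hN j).2
      _ ≤ t n j.succ := hmono _ le_rfl hn
  have hord1 : ∀ (j : Fin m) n n', a ≤ n → n < n' → t n j.succ + g ≤ t n' j.succ :=
    fun j n n' hn h => ((hN j).1 n hn).trans (hmono _ (by omega) h)
  have hord2 : ∀ (j j' : Fin m) n n', j < j' → n ≤ N → a ≤ n → a ≤ n' →
      t n j.succ + g ≤ t n' j'.succ := by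
    intro j j' n n' hj hnN hn hn'
    calc t n j.succ + g ≤ t N j.succ + g := Nat.add_le_add_right (hmono _ hn hnN) g
      _ ≤ t N j'.castSucc + g := Nat.add_le_add_right (hlast (by
          rw [Fin.le_def]; simp only [Fin.val_succ, Fin.val_castSucc]; exact hj)) g
      _ ≤ t a j'.succ := (hN j').2
      _ ≤ t n' j'.succ := hmono _ le_rfl hn'
  have hord : ∀ (j j' : Fin m) n n', n ∈ Finset.Icc a N → n' ∈ Finset.Icc a N →
      t n j.succ + g ≤ t n' j'.succ ∨ t n' j'.succ + g ≤ t n j.succ ∨ (n = n' ∧ j = j') := by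
    intro j j' n n' hn hn'
    rw [Finset.mem_Icc] at hn hn'
    rcases lt_trichotomy j j' with h | rfl | h
    · exact Or.inl (hord2 j j' n n' h hn.2 hn.1 hn'.1)
    · rcases lt_trichotomy n n' with h | rfl | h
      · exact Or.inl (hord1 j n n' hn.1 h)
      · exact Or.inr (Or.inr ⟨rfl, rfl⟩)
      · exact Or.inr (Or.inl (hord1 j n' n hn'.1 h))
    · exact Or.inr (Or.inl (hord2 j' j n' n h hn'.2 hn'.1 hn.1))
  have hinj : ∀ n ∈ Finset.Icc a N, ∀ n' ∈ Finset.Icc a N, ∀ j j', t n j = t n' j' →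
      n = n' ∧ j = j' := by
    intro n hn n' hn' j j'
    have hn2 := Finset.mem_Icc.1 hn
    have hn2' := Finset.mem_Icc.1 hn'
    refine Fin.cases ?_ (fun j => ?_) j <;> refine Fin.cases ?_ (fun j' => ?_) j'
    · intro h
      rw [ht0 n hn2.1, ht0 n' hn2'.1] at h
      exact ⟨h, rfl⟩
    · intro h
      have := hNt j' n' hn2'.1
      rw [ht0 n hn2.1] at h
      omega
    · intro h
      have := hNt j n hn2.1
      rw [ht0 n' hn2'.1] at h
      omega
    · intro h
      rcases hord j j' n n' hn hn' with h1 | h1 | ⟨h1, h2⟩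
      · omega
      · omega
      · exact ⟨h1, by rw [h2]⟩
  -- the sampled times of all coordinates but the first, which all lie beyond `N`
  set B := (Finset.univ ×ˢ Finset.Icc a N).image fun p : Fin m × ℕ => t p.2 p.1.succ with hBdef
  have hBN : ∀ s ∈ B, N + g ≤ s := by
    intro s hs
    obtain ⟨p, hp, rfl⟩ := Finset.mem_image.1 hs
    exact hNt _ _ (Finset.mem_Icc.1 (Finset.mem_product.1 hp).2).1
  have hB : ∀ s ∈ B, ∀ t ∈ B, t < s → t + g ≤ s := by
    intro s hs s' hs' hlt
    obtain ⟨p, hp, rfl⟩ := Finset.mem_image.1 hs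
    obtain ⟨p', hp', rfl⟩ := Finset.mem_image.1 hs'
    rcases hord p'.1 p.1 p'.2 p.2 (Finset.mem_product.1 hp').2 (Finset.mem_product.1 hp).2
      with h | h | ⟨h1, h2⟩
    · exact h
    · omega
    · rw [h1, h2] at hlt; exact absurd hlt (lt_irrefl _)
  have hcard : B.card ≤ m * N := by
    refine Finset.card_image_le.trans ?_
    rw [Finset.card_product, Finset.card_univ, Fintype.card_fin, Nat.card_Icc]
    exact Nat.mul_le_mul_left m (by omega)
  have hfm : Measurable fun w : ℕ → M => ∏ n ∈ Finset.Icc a N,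
      ENNReal.ofReal (Real.exp (W fun j => w (t n j))) :=
    Finset.measurable_fun_prod _ fun n _ =>
      (hW.measurable.comp (measurable_samplePoint q n)).exp.ennreal_ofReal
  have hdep : DependsOn (fun w : ℕ → M => ∏ n ∈ Finset.Icc a N,
      ENNReal.ofReal (Real.exp (W fun j => w (t n j)))) (Set.Iic N ∪ B) := by
    intro w w' h
    refine Finset.prod_congr rfl fun n hn => ?_
    have hn2 := Finset.mem_Icc.1 hn
    refine congrArg (fun v => ENNReal.ofReal (Real.exp (W v))) (funext fun j => ?_)
    refine h _ ?_
    refine Fin.cases ?_ (fun j => ?_) j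
    · left
      rw [ht0 n hn2.1]
      exact hn2.2
    · right
      exact Finset.mem_coe.2 (Finset.mem_image.2
        ⟨(j, n), Finset.mem_product.2 ⟨Finset.mem_univ _, hn⟩, rfl⟩)
  have hred : ∀ w : ℕ → M, ∏ n ∈ Finset.Icc a N, ENNReal.ofReal (Real.exp (reduced μ W (w (t n 0))))
      = ∏ n ∈ Finset.Icc a N, ENNReal.ofReal (Real.exp (reduced μ W (w n))) := fun w =>
    Finset.prod_congr rfl fun n hn => by rw [ht0 n (Finset.mem_Icc.1 hn).1]
  have hup := hL.lintegral_le_lmarginal hg (fun x => (hmix x).1) N B hfm hdep hBN hB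
  have hlow := hL.lmarginal_le_lintegral hg (fun x => (hmix x).2) N B hfm hdep hBN hB
  rw [lmarginal_prod hW t _ hinj] at hup hlow
  simp_rw [hred] at hup hlow
  constructor
  · refine hup.trans ?_
    gcongr
    rw [ENNReal.one_le_ofReal]; linarith
  · refine le_trans ?_ hlow
    exact mul_le_mul' (pow_le_pow_of_le_one bot_le (ENNReal.ofReal_le_one.2 (by linarith)) hcard)
      le_rfl

/-- Dropping the first factors of a product of exponentials of bounded functions. -/
lemma lintegral_prod_exp_between {M : Type*} [MeasurableSpace M] {L : Measure (ℕ → M)}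
    {Y : ℕ → (ℕ → M) → ℝ} (hY : ∀ n, Measurable (Y n)) {w : ℝ}
    (hw : ∀ n x, |Y n x| ≤ w) {a N : ℕ} (ha : a ≤ N) :
    ∫⁻ x, ∏ n ∈ Finset.Icc 1 N, ENNReal.ofReal (Real.exp (Y n x)) ∂L
      ≤ ENNReal.ofReal (Real.exp (a * w)) *
        ∫⁻ x, ∏ n ∈ Finset.Icc (a + 1) N, ENNReal.ofReal (Real.exp (Y n x)) ∂L ∧
    ENNReal.ofReal (Real.exp (-(a * w))) *
        ∫⁻ x, ∏ n ∈ Finset.Icc (a + 1) N, ENNReal.ofReal (Real.exp (Y n x)) ∂L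
      ≤ ∫⁻ x, ∏ n ∈ Finset.Icc 1 N, ENNReal.ofReal (Real.exp (Y n x)) ∂L := by
  have hm : Measurable fun x => ∏ n ∈ Finset.Icc (a + 1) N, ENNReal.ofReal (Real.exp (Y n x)) :=
    Finset.measurable_fun_prod _ fun n _ => (hY n).exp.ennreal_ofReal
  have hsplit : ∀ x, ∏ n ∈ Finset.Icc 1 N, ENNReal.ofReal (Real.exp (Y n x))
      = (∏ n ∈ Finset.Icc 1 a, ENNReal.ofReal (Real.exp (Y n x))) *
        ∏ n ∈ Finset.Icc (a + 1) N, ENNReal.ofReal (Real.exp (Y n x)) := by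
    intro x
    have hu : Finset.Icc 1 N = Finset.Icc 1 a ∪ Finset.Icc (a + 1) N := by
      ext i; simp only [Finset.mem_Icc, Finset.mem_union]; omega
    rw [hu, Finset.prod_union]
    rw [Finset.disjoint_left]
    intro i; simp only [Finset.mem_Icc]; omega
  have hexp : ∀ s : ℝ, ENNReal.ofReal (Real.exp (a * s))
      = ∏ _n ∈ Finset.Icc 1 a, ENNReal.ofReal (Real.exp s) := by
    intro s
    rw [Finset.prod_const, Nat.card_Icc, Nat.add_sub_cancel,
      ← ENNReal.ofReal_pow (Real.exp_pos _).le, ← Real.exp_nat_mul]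
  simp_rw [hsplit]
  rw [← lintegral_const_mul _ hm, ← lintegral_const_mul _ hm, hexp w,
    show -(a * w) = a * -w by ring, hexp (-w)]
  constructor
  · refine lintegral_mono fun x => ?_
    gcongr with n hn
    exact (abs_le.1 (hw n x)).2
  · refine lintegral_mono fun x => ?_
    gcongr with n hn
    exact (abs_le.1 (hw n x)).1

lemma ofReal_integral_exp_sum {Y : ℕ → (ℕ → M) → ℝ} (hY : ∀ n, BddMeas (Y n)) (s : Finset ℕ) :
    ENNReal.ofReal (∫ x, Real.exp (∑ n ∈ s, Y n x) ∂L)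
      = ∫⁻ x, ∏ n ∈ s, ENNReal.ofReal (Real.exp (Y n x)) ∂L := by
  have hb : BddMeas fun x => ∑ n ∈ s, Y n x := by
    induction s using Finset.induction_on with
    | empty => simpa using BddMeas.const 0
    | insert a s ha ih => simpa only [Finset.sum_insert ha] using (hY a).add ih
  rw [ofReal_integral_eq_lintegral_ofReal (hb.exp.integrable _)
    (ae_of_all _ fun x => (Real.exp_pos _).le)]
  refine lintegral_congr fun x => ?_
  rw [Real.exp_sum, ENNReal.ofReal_prod_of_nonneg fun n _ => (Real.exp_pos _).le]

/-- Upper and lower bounds for the exponential moments of the nonconventional sums: up to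
corrections of order `ε N` they are those of the chain with independent extra coordinates, whose
growth is governed by the eigenvalue. -/
lemma abs_log_moment_sub_le (hκ : StrongDoeblin κ) (hμ : κ.Invariant μ)
    (hq : TimeChanges q) (hL : IsMarkovLaw κ L) {W : (Fin (m + 1) → M) → ℝ} (hW : BddMeas W)
    {p : ℝ} {h : (Fin (m + 1) → M) → ℝ} (he : IsEigen (productKernel m κ μ) W p h) :
    ∃ A K : ℝ, 0 ≤ K ∧ ∀ ε : ℝ, 0 < ε → ε ≤ 1 / 2 → ∀ᶠ N : ℕ in atTop,
      |Real.log (∫ w, Real.exp (∑ n ∈ Finset.Icc 1 N, W (samplePoint q w n)) ∂L) - p * N|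
        ≤ A + K * (ε * N) := by
  obtain ⟨n₀, D, hD, hT⟩ := exists_comparable (m := m) hκ hμ
  obtain ⟨w, hw⟩ := hW.bounded
  have hV := bddMeas_reduced (μ := μ) hW
  have hVw : ∀ y, |reduced μ W y| ≤ w := by
    intro y
    have h1 := exp_section_lower (μ := μ) hW.measurable hw y
    have h2 : ∫ z, Real.exp (W (Fin.cons y z)) ∂(Measure.pi fun _ : Fin m => μ) ≤ Real.exp w := by
      have hi : Integrable (fun z => Real.exp (W (Fin.cons y z)))
          (Measure.pi fun _ : Fin m => μ) :=
        (hW.exp.comp (measurable_cons.comp measurable_prodMk_left)).integrable _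
      simpa using integral_mono hi (integrable_const (Real.exp w))
        fun z => Real.exp_le_exp.2 (abs_le.1 (hw _)).2
    rw [← exp_reduced hW] at h1 h2
    exact abs_le.2 ⟨Real.exp_le_exp.1 h1, Real.exp_le_exp.1 h2⟩
  obtain ⟨y0⟩ : Nonempty M := nonempty_of_isProbabilityMeasure μ
  have hw0 : 0 ≤ w := (abs_nonneg _).trans (hVw y0)
  set D' := D * Real.exp (2 * (n₀ * w)) with hD'
  have hD0 : 0 < D' := mul_pos (by linarith) (Real.exp_pos _)
  refine ⟨2 * w + Real.log D', 2 * w + 2 * m, by positivity, fun ε hε hε1 => ?_⟩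
  filter_upwards [lintegral_prod_sample_between hκ hμ hq hL hW hε] with N hN
  set a := ⌈ε * N⌉₊ with ha
  have hN0 : (0 : ℝ) ≤ N := Nat.cast_nonneg N
  have haN : a ≤ N := Nat.ceil_le.2 (by nlinarith)
  have ha1 : (a : ℝ) ≤ ε * N + 1 := (Nat.ceil_lt_add_one (by positivity)).le
  have hYb : ∀ n, BddMeas fun x : ℕ → M => W (samplePoint q x n) := fun n =>
    hW.comp (measurable_samplePoint q n)
  have hVb : ∀ n, BddMeas fun x : ℕ → M => reduced μ W (x n) := fun n =>
    hV.comp (measurable_pi_apply n)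
  have s1 := (lintegral_prod_exp_between (L := L) (fun n => (hYb n).measurable)
    (fun n x => hw _) haN)
  have s3 := (lintegral_prod_exp_between (L := L) (fun n => (hVb n).measurable)
    (fun n x => hVw _) haN)
  have hint : ∀ {Y : ℕ → (ℕ → M) → ℝ} (_ : ∀ n, BddMeas (Y n)) (s : Finset ℕ),
      0 ≤ ∫ x, Real.exp (∑ n ∈ s, Y n x) ∂L := fun _ _ => integral_nonneg fun x =>
    (Real.exp_pos _).le
  rw [← ofReal_integral_exp_sum hYb, ← ofReal_integral_exp_sum hYb,
    ← ENNReal.ofReal_mul (Real.exp_pos _).le, ← ENNReal.ofReal_mul (Real.exp_pos _).le,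
    ENNReal.ofReal_le_ofReal_iff (mul_nonneg (Real.exp_pos _).le (hint hYb _)),
    ENNReal.ofReal_le_ofReal_iff (hint hYb _)] at s1
  have hchain : ∫⁻ x, ∏ n ∈ Finset.Icc 1 N, ENNReal.ofReal (Real.exp (reduced μ W (x n))) ∂L
      = ∫⁻ x, ENNReal.ofReal ((tilt (productKernel m κ μ) W)^[N] (fun _ => 1) fun _ => x 0) ∂L := by
    have := hL.lintegral_prod_exp hV N (BddMeas.const 1) fun _ => zero_le_one
    simp only [ENNReal.ofReal_one, mul_one] at this
    rw [this]
    refine lintegral_congr fun x => ?_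
    rw [← tilt_productKernel hW (BddMeas.const 1) N fun _ => x 0]
  have hZ1 : ENNReal.ofReal (D'⁻¹ * Real.exp (p * N))
      ≤ ∫⁻ x, ∏ n ∈ Finset.Icc 1 N, ENNReal.ofReal (Real.exp (reduced μ W (x n))) ∂L := by
    rw [hchain]
    calc ENNReal.ofReal (D'⁻¹ * Real.exp (p * N))
        = ∫⁻ _, ENNReal.ofReal (D'⁻¹ * Real.exp (p * N)) ∂L := by simp
      _ ≤ _ := lintegral_mono fun x => ENNReal.ofReal_le_ofReal (by
          rw [inv_mul_le_iff₀ hD0]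
          exact (he.growth hD hT hW.measurable hw N _).1)
  have hZ2 : ∫⁻ x, ∏ n ∈ Finset.Icc 1 N, ENNReal.ofReal (Real.exp (reduced μ W (x n))) ∂L
      ≤ ENNReal.ofReal (D' * Real.exp (p * N)) := by
    rw [hchain]
    calc _ ≤ ∫⁻ _, ENNReal.ofReal (D' * Real.exp (p * N)) ∂L :=
          lintegral_mono fun x => ENNReal.ofReal_le_ofReal
            (he.growth hD hT hW.measurable hw N _).2
      _ = _ := by simp
  rw [← ofReal_integral_exp_sum hVb, ← ofReal_integral_exp_sum hVb,
    ← ENNReal.ofReal_mul (Real.exp_pos _).le, ← ENNReal.ofReal_mul (Real.exp_pos _).le,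
    ENNReal.ofReal_le_ofReal_iff (mul_nonneg (Real.exp_pos _).le (hint hVb _)),
    ENNReal.ofReal_le_ofReal_iff (hint hVb _)] at s3
  rw [← ofReal_integral_exp_sum hVb, ENNReal.ofReal_le_ofReal_iff (hint hVb _)] at hZ1
  rw [← ofReal_integral_exp_sum hVb, ENNReal.ofReal_le_ofReal_iff (by positivity)] at hZ2
  have e1 : 0 ≤ 1 + ε := by linarith
  have e2 : 0 ≤ 1 - ε := by linarith
  have hN' := hN
  rw [← ofReal_integral_exp_sum hYb, ← ofReal_integral_exp_sum hVb, ← ENNReal.ofReal_pow e1,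
    ← ENNReal.ofReal_pow e2, ← ENNReal.ofReal_mul (pow_nonneg e1 _),
    ← ENNReal.ofReal_mul (pow_nonneg e2 _),
    ENNReal.ofReal_le_ofReal_iff (mul_nonneg (pow_nonneg e1 _) (hint hVb _)),
    ENNReal.ofReal_le_ofReal_iff (hint hYb _)] at hN'
  set Z := ∫ x, Real.exp (∑ n ∈ Finset.Icc 1 N, W (samplePoint q x n)) ∂L with hZdef
  set ZA := ∫ x, Real.exp (∑ n ∈ Finset.Icc (a + 1) N, W (samplePoint q x n)) ∂L
  set YA := ∫ x, Real.exp (∑ n ∈ Finset.Icc (a + 1) N, reduced μ W (x n)) ∂L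
  set Y := ∫ x, Real.exp (∑ n ∈ Finset.Icc 1 N, reduced μ W (x n)) ∂L
  have hEN : Real.exp (-(a * w)) = (Real.exp (a * w))⁻¹ := Real.exp_neg _
  have hp := Real.exp_pos (a * w)
  have hYA : YA ≤ Real.exp (a * w) * Y := by
    have := s3.2
    rwa [hEN, inv_mul_le_iff₀ hp] at this
  have hYA' : (Real.exp (a * w))⁻¹ * Y ≤ YA := by
    rw [inv_mul_le_iff₀ hp]; exact s3.1
  have hup : Z ≤ Real.exp (a * w) * ((1 + ε) ^ (m * N) * (Real.exp (a * w) *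
      (D' * Real.exp (p * N)))) := by
    refine s1.1.trans ?_
    gcongr
    refine hN'.1.trans ?_
    gcongr
    exact hYA.trans (by gcongr)
  have hlow : Real.exp (-(a * w)) * ((1 - ε) ^ (m * N) * (Real.exp (-(a * w)) *
      (D'⁻¹ * Real.exp (p * N)))) ≤ Z := by
    refine le_trans ?_ s1.2
    gcongr
    refine le_trans ?_ hN'.2
    gcongr
    refine le_trans ?_ hYA'
    rw [hEN]
    gcongr
  have e2' : 0 < 1 - ε := by linarith
  have hZ0 : 0 < Z := lt_of_lt_of_le (by positivity) hlow
  have l1 := Real.log_le_log hZ0 hup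
  have l2 := Real.log_le_log (by positivity) hlow
  have e1' : 0 < 1 + ε := by linarith
  rw [Real.log_mul (by positivity) (by positivity), Real.log_mul (by positivity) (by positivity),
    Real.log_mul (by positivity) (by positivity), Real.log_mul (by positivity) (by positivity),
    Real.log_exp, Real.log_exp, Real.log_pow] at l1 l2
  rw [Real.log_inv] at l2
  have b1 : Real.log (1 + ε) ≤ ε := by
    have := Real.log_le_sub_one_of_pos e1'; linarith
  have b2 : -(2 * ε) ≤ Real.log (1 - ε) := by
    refine le_trans ?_ (Real.one_sub_inv_le_log_of_pos e2')
    have : (1 - ε)⁻¹ ≤ 1 + 2 * ε := by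
      rw [inv_le_iff_one_le_mul₀ e2']
      nlinarith
    linarith
  have hmN : (0 : ℝ) ≤ ((m * N : ℕ) : ℝ) := Nat.cast_nonneg _
  have c1 := mul_le_mul_of_nonneg_left b1 hmN
  have c2 := mul_le_mul_of_nonneg_left b2 hmN
  have c3 : (a : ℝ) * w ≤ (ε * N + 1) * w := mul_le_mul_of_nonneg_right ha1 hw0
  push_cast at c1 c2 l1 l2
  have c4 : 0 ≤ (m : ℝ) * N * ε := by positivity
  rw [abs_le]
  constructor <;> linarith

/-- The logarithmic moments converge to the logarithm of the principal eigenvalue. -/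
lemma tendsto_log_moment (hκ : StrongDoeblin κ) (hμ : κ.Invariant μ)
    (hq : TimeChanges q) (hL : IsMarkovLaw κ L) {W : (Fin (m + 1) → M) → ℝ} (hW : BddMeas W)
    {p : ℝ} {h : (Fin (m + 1) → M) → ℝ} (he : IsEigen (productKernel m κ μ) W p h) :
    Tendsto (fun N : ℕ => (1 / (N : ℝ)) *
      Real.log (∫ w, Real.exp (∑ n ∈ Finset.Icc 1 N, W (samplePoint q w n)) ∂L))
      atTop (𝓝 p) := by
  obtain ⟨A, K, hK, hA⟩ := abs_log_moment_sub_le hκ hμ hq hL hW he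
  rw [Metric.tendsto_atTop']
  intro r hr
  have hlim : Tendsto (fun N : ℕ => A / (N : ℝ)) atTop (𝓝 0) :=
    tendsto_const_div_atTop_nhds_zero_nat A
  have hε : 0 < min (1 / 2) (r / (2 * (K + 1))) := by positivity
  have hε2 : K * min (1 / 2) (r / (2 * (K + 1))) ≤ r / 2 := by
    calc K * min (1 / 2) (r / (2 * (K + 1))) ≤ (K + 1) * (r / (2 * (K + 1))) :=
          mul_le_mul (by linarith) (min_le_right _ _) hε.le (by linarith)
      _ = r / 2 := by field_simp
  have hev := ((hA _ hε (min_le_left _ _)).and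
    (hlim.eventually_lt_const (half_pos hr))).and (eventually_gt_atTop 0)
  obtain ⟨N₀, hN₀⟩ := eventually_atTop.1 hev
  refine ⟨N₀, fun N hN => ?_⟩
  obtain ⟨⟨h1, h2⟩, h3⟩ := hN₀ N hN.le
  have hN0 : (0 : ℝ) < N := by exact_mod_cast h3
  rw [Real.dist_eq]
  set l := Real.log (∫ w, Real.exp (∑ n ∈ Finset.Icc 1 N, W (samplePoint q w n)) ∂L)
  have e : 1 / (N : ℝ) * l - p = (l - p * N) / N := by field_simp
  rw [e, abs_div, abs_of_pos hN0]
  calc |l - p * N| / N ≤ (A + K * (min (1 / 2) (r / (2 * (K + 1))) * N)) / N := by gcongr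
    _ = A / N + K * min (1 / 2) (r / (2 * (K + 1))) := by field_simp
    _ < r := by linarith

end

/-! ### Empirical measures and exponential moments -/

section

variable {E : Type*} [TopologicalSpace E] [CompactSpace E] [MeasurableSpace E] [BorelSpace E]

/-- The integral of a continuous function against a probability measure. -/
noncomputable def pairing (V : C(E, ℝ)) (η : ProbabilityMeasure E) : ℝ := ∫ x, V x ∂(η : Measure E)

lemma integrable_continuousMap (V : C(E, ℝ)) (η : Measure E) [IsFiniteMeasure η] :
    Integrable V η :=
  V.bddMeas.integrable η

lemma continuous_pairing (V : C(E, ℝ)) : Continuous (pairing V) :=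
  ProbabilityMeasure.continuous_integral_continuousMap V

lemma pairing_zero (η : ProbabilityMeasure E) : pairing 0 η = 0 := by simp [pairing]

lemma pairing_add (V W : C(E, ℝ)) (η : ProbabilityMeasure E) :
    pairing (V + W) η = pairing V η + pairing W η :=
  integral_add (integrable_continuousMap V _) (integrable_continuousMap W _)

lemma pairing_smul (a : ℝ) (V : C(E, ℝ)) (η : ProbabilityMeasure E) :
    pairing (a • V) η = a * pairing V η :=
  integral_const_mul a _

lemma pairing_sum {ι : Type*} (F : Finset ι) (V : ι → C(E, ℝ)) (η : ProbabilityMeasure E) :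
    pairing (∑ i ∈ F, V i) η = ∑ i ∈ F, pairing (V i) η := by
  classical
  induction F using Finset.induction_on with
  | empty => simp [pairing_zero]
  | insert i F hi ih => rw [Finset.sum_insert hi, Finset.sum_insert hi, pairing_add, ih]

/-- The empirical measure `N⁻¹ ∑_{n=1}^N δ_{y n}`. -/
noncomputable def empirical (y : ℕ → E) (N : ℕ) : Measure E :=
  (N : ℝ≥0∞)⁻¹ • ∑ n ∈ Finset.Icc 1 N, Measure.dirac (y n)

lemma isProbabilityMeasure_empirical (y : ℕ → E) {N : ℕ} (hN : N ≠ 0) :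
    IsProbabilityMeasure (empirical y N) := by
  refine ⟨?_⟩
  simp only [empirical, Measure.smul_apply, Measure.finsetSum_apply, measure_univ,
    Finset.sum_const, Nat.card_Icc, Nat.add_sub_cancel, smul_eq_mul, nsmul_eq_mul, mul_one]
  exact ENNReal.inv_mul_cancel (by exact_mod_cast hN) (ENNReal.natCast_ne_top N)

lemma mul_pairing_empirical {y : ℕ → E} {N : ℕ} (hN : N ≠ 0) {η : ProbabilityMeasure E}
    (hη : (η : Measure E) = empirical y N) (V : C(E, ℝ)) :
    N * pairing V η = ∑ n ∈ Finset.Icc 1 N, V (y n) := by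
  have hN' : (N : ℝ) ≠ 0 := by exact_mod_cast hN
  rw [pairing, hη, empirical, integral_smul_measure, integral_finsetSum_measure]
  · simp only [ENNReal.toReal_inv, ENNReal.toReal_natCast, smul_eq_mul]
    rw [mul_inv_cancel_left₀ hN']
    exact Finset.sum_congr rfl fun n _ =>
      integral_dirac' _ _ V.continuous.stronglyMeasurable
  · exact fun n _ => integrable_continuousMap V _

variable {Ω : Type*} [MeasurableSpace Ω] {P : Measure Ω} [IsProbabilityMeasure P]
  {Y : ℕ → Ω → E} {Q : C(E, ℝ) → ℝ}

/-- `Q` is the limiting logarithmic moment generating functional of the sums `∑_{n=1}^N V(Y n)`. -/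
def HasLogMoments (P : Measure Ω) (Y : ℕ → Ω → E) (Q : C(E, ℝ) → ℝ) : Prop :=
  ∀ V : C(E, ℝ), Tendsto (fun N : ℕ => (1 / (N : ℝ)) *
    Real.log (∫ ω, Real.exp (∑ n ∈ Finset.Icc 1 N, V (Y n ω)) ∂P)) atTop (𝓝 (Q V))

lemma measurable_exp_sum (hY : ∀ n, Measurable (Y n)) (V : C(E, ℝ)) (N : ℕ) :
    Measurable fun ω => Real.exp (∑ n ∈ Finset.Icc 1 N, V (Y n ω)) :=
  (Finset.measurable_sum _ fun n _ => V.continuous.measurable.comp (hY n)).exp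

lemma integrable_exp_sum (hY : ∀ n, Measurable (Y n)) (V : C(E, ℝ)) (N : ℕ) :
    Integrable (fun ω => Real.exp (∑ n ∈ Finset.Icc 1 N, V (Y n ω))) P := by
  refine Integrable.of_bound (measurable_exp_sum hY V N).aestronglyMeasurable
    (Real.exp (∑ n ∈ Finset.Icc 1 N, ‖V‖)) (ae_of_all _ fun ω => ?_)
  rw [Real.norm_eq_abs, Real.abs_exp]
  gcongr with n _
  exact (le_abs_self _).trans (V.norm_coe_le_norm _)

lemma HasLogMoments.eventually_between (hQ : HasLogMoments P Y Q) (hY : ∀ n, Measurable (Y n))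
    (V : C(E, ℝ)) {ε : ℝ} (hε : 0 < ε) : ∀ᶠ N : ℕ in atTop,
      Real.exp (N * (Q V - ε)) ≤ ∫ ω, Real.exp (∑ n ∈ Finset.Icc 1 N, V (Y n ω)) ∂P ∧
      ∫ ω, Real.exp (∑ n ∈ Finset.Icc 1 N, V (Y n ω)) ∂P ≤ Real.exp (N * (Q V + ε)) := by
  filter_upwards [(hQ V).eventually (Icc_mem_nhds (sub_lt_self _ hε) (lt_add_of_pos_right _ hε)),
    eventually_gt_atTop 0] with N hN hN0
  have hN0' : (0 : ℝ) < N := by exact_mod_cast hN0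
  have hZ : 0 < ∫ ω, Real.exp (∑ n ∈ Finset.Icc 1 N, V (Y n ω)) ∂P :=
    integral_exp_pos (integrable_exp_sum hY V N)
  rw [one_div, inv_mul_eq_div, le_div_iff₀ hN0', div_le_iff₀ hN0'] at hN
  rw [← Real.le_log_iff_exp_le hZ, ← Real.log_le_iff_le_exp hZ]
  constructor <;> linarith [hN.1, hN.2]

/-- The sum of exponentials controlling the event that `V ↦ N (∫ V dζ_N - Q V)` is large for some
`V` in a finite family. -/
noncomputable def dominating (Y : ℕ → Ω → E) (Q : C(E, ℝ) → ℝ) (F : Finset C(E, ℝ)) (b : ℝ) (N : ℕ)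
    (ω : Ω) : ℝ :=
  ∑ V ∈ F, Real.exp (N * (b - Q V)) * Real.exp (∑ n ∈ Finset.Icc 1 N, V (Y n ω))

lemma dominating_nonneg (F : Finset C(E, ℝ)) (b : ℝ) (N : ℕ) (ω : Ω) :
    0 ≤ dominating Y Q F b N ω :=
  Finset.sum_nonneg fun V _ => by positivity

lemma measurable_dominating (hY : ∀ n, Measurable (Y n)) (F : Finset C(E, ℝ)) (b : ℝ) (N : ℕ) :
    Measurable (dominating Y Q F b N) :=
  Finset.measurable_sum _ fun V _ => (measurable_exp_sum hY V N).const_mul _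

lemma integrable_dominating (hY : ∀ n, Measurable (Y n)) (F : Finset C(E, ℝ)) (b : ℝ) (N : ℕ) :
    Integrable (dominating Y Q F b N) P :=
  integrable_finsetSum _ fun V _ => (integrable_exp_sum hY V N).const_mul _

lemma HasLogMoments.eventually_integral_dominating_le (hQ : HasLogMoments P Y Q)
    (hY : ∀ n, Measurable (Y n)) (F : Finset C(E, ℝ)) {b c : ℝ} (hbc : b < c) :
    ∀ᶠ N : ℕ in atTop, ∫ ω, dominating Y Q F b N ω ∂P ≤ Real.exp (N * c) := by
  have hε : 0 < (c - b) / 2 := by linarith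
  have h1 : ∀ᶠ N : ℕ in atTop, ∀ V ∈ F,
      ∫ ω, Real.exp (∑ n ∈ Finset.Icc 1 N, V (Y n ω)) ∂P ≤ Real.exp (N * (Q V + (c - b) / 2)) :=
    (eventually_all_finset F).2 fun V _ => (hQ.eventually_between hY V hε).mono fun N h => h.2
  have h2 : Tendsto (fun N : ℕ => Real.exp (N * ((c - b) / 2))) atTop atTop :=
    Real.tendsto_exp_atTop.comp (tendsto_natCast_atTop_atTop.atTop_mul_const hε)
  filter_upwards [h1, h2.eventually_ge_atTop (F.card : ℝ)] with N hN hcard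
  unfold dominating
  rw [integral_finsetSum _ fun V _ => (integrable_exp_sum hY V N).const_mul _]
  calc ∑ V ∈ F, ∫ ω, Real.exp (N * (b - Q V)) *
          Real.exp (∑ n ∈ Finset.Icc 1 N, V (Y n ω)) ∂P
      ≤ ∑ V ∈ F, Real.exp (N * (b + (c - b) / 2)) := by
        refine Finset.sum_le_sum fun V hV => ?_
        rw [integral_const_mul]
        refine (mul_le_mul_of_nonneg_left (hN V hV) (Real.exp_nonneg _)).trans_eq ?_
        rw [← Real.exp_add]
        congr 1
        ring
    _ = F.card * Real.exp (N * (b + (c - b) / 2)) := by rw [Finset.sum_const, nsmul_eq_mul]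
    _ ≤ Real.exp (N * ((c - b) / 2)) * Real.exp (N * (b + (c - b) / 2)) := by gcongr
    _ = Real.exp (N * c) := by
        rw [← Real.exp_add]
        congr 1
        ring

/-- On the event that the empirical measure lies in a set covered by finitely many conditions
`∫ W dη - (∫ V dη - Q V) < b`, the dominating sum exceeds `exp (∑ W)`. -/
lemma exp_sum_lt_dominating {K : Set (ProbabilityMeasure E)} {F : Finset C(E, ℝ)} {W : C(E, ℝ)}
    {b : ℝ} (hF : ∀ η ∈ K, ∃ V ∈ F, pairing W η - (pairing V η - Q V) < b) {N : ℕ} (hN : N ≠ 0)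
    {ω : Ω} {η : ProbabilityMeasure E} (hη : η ∈ K)
    (hemp : (η : Measure E) = empirical (fun n => Y n ω) N) :
    Real.exp (∑ n ∈ Finset.Icc 1 N, W (Y n ω)) < dominating Y Q F b N ω := by
  obtain ⟨V, hV, hlt⟩ := hF η hη
  have hN' : (0 : ℝ) < N := by exact_mod_cast hN.bot_lt
  refine lt_of_lt_of_le ?_ (Finset.single_le_sum
    (f := fun V => Real.exp (N * (b - Q V)) * Real.exp (∑ n ∈ Finset.Icc 1 N, V (Y n ω)))
    (fun V _ => by positivity) hV)
  rw [← Real.exp_add, Real.exp_lt_exp, ← mul_pairing_empirical hN hemp W,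
    ← mul_pairing_empirical hN hemp V, ← mul_add]
  exact mul_lt_mul_of_pos_left (by linarith) hN'

/-- Compactness: a pointwise strict inequality yields a finite family of functions and a
uniform gap. -/
lemma exists_finset_cover {K : Set (ProbabilityMeasure E)} (hK : IsCompact K) {W : C(E, ℝ)} {b : ℝ}
    (h : ∀ η ∈ K, ∃ V, pairing W η - (pairing V η - Q V) < b) :
    ∃ (F : Finset C(E, ℝ)) (b' : ℝ), b' < b ∧
      ∀ η ∈ K, ∃ V ∈ F, pairing W η - (pairing V η - Q V) < b' := by
  classical
  obtain ⟨F, hF⟩ := hK.elim_finite_subcover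
    (fun i : C(E, ℝ) × Set.Iio b => {η | pairing W η - (pairing i.1 η - Q i.1) < i.2})
    (fun i => isOpen_lt ((continuous_pairing W).sub
      ((continuous_pairing i.1).sub continuous_const)) continuous_const)
    (fun η hη => by
      obtain ⟨V, hV⟩ := h η hη
      obtain ⟨c, hc1, hc2⟩ := exists_between hV
      exact Set.mem_iUnion.2 ⟨(V, ⟨c, hc2⟩), hc1⟩)
  have : Nonempty (Set.Iio b) := ⟨⟨b - 1, Set.mem_Iio.2 (by linarith)⟩⟩
  obtain ⟨c, hc⟩ := (F.image Prod.snd).exists_le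
  refine ⟨F.image Prod.fst, c, c.2, fun η hη => ?_⟩
  obtain ⟨i, hi, hlt⟩ := Set.mem_iUnion₂.1 (hF hη)
  exact ⟨i.1, Finset.mem_image_of_mem _ hi, lt_of_lt_of_le hlt
    (Subtype.coe_le_coe.2 (hc _ (Finset.mem_image_of_mem _ hi)))⟩

end

/-! ### Convex duality -/

section

variable {E : Type*} [TopologicalSpace E] [CompactSpace E] [MeasurableSpace E] [BorelSpace E]

/-- The functional `I` on probability measures is the convex conjugate of `Q`, and a continuous
function has at most one equilibrium state, that is, one measure with
`I η = ∫ W dη - Q W`. -/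
structure IsConjugate (I : ProbabilityMeasure E → EReal) (Q : C(E, ℝ) → ℝ) : Prop where
  eq_iSup : ∀ η, I η = ⨆ V : C(E, ℝ), ((pairing V η - Q V : ℝ) : EReal)
  unique : ∀ (W : C(E, ℝ)) (η η' : ProbabilityMeasure E),
    I η ≤ ((pairing W η - Q W : ℝ) : EReal) → I η' ≤ ((pairing W η' - Q W : ℝ) : EReal) → η = η'

variable {I : ProbabilityMeasure E → EReal} {Q : C(E, ℝ) → ℝ}

lemma IsConjugate.le (h : IsConjugate I Q) (V : C(E, ℝ)) (η : ProbabilityMeasure E) :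
    ((pairing V η - Q V : ℝ) : EReal) ≤ I η := by
  rw [h.eq_iSup]
  exact le_iSup (fun V : C(E, ℝ) => ((pairing V η - Q V : ℝ) : EReal)) V

lemma IsConjugate.exists_lt (h : IsConjugate I Q) {η : ProbabilityMeasure E} {a : ℝ}
    (ha : (a : EReal) < I η) : ∃ V, a < pairing V η - Q V := by
  rw [h.eq_iSup, lt_iSup_iff] at ha
  exact ha.imp fun V hV => EReal.coe_lt_coe_iff.1 hV

lemma IsConjugate.eq_top_or_coe (h : IsConjugate I Q) (η : ProbabilityMeasure E) :
    I η = ⊤ ∨ ∃ i : ℝ, I η = i := by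
  by_cases ht : I η = ⊤
  · exact .inl ht
  · have hb : I η ≠ ⊥ := ((EReal.bot_lt_coe _).trans_le (h.le 0 η)).ne'
    exact .inr ⟨(I η).toReal, (EReal.coe_toReal ht hb).symm⟩

lemma IsConjugate.le_coe_iff (h : IsConjugate I Q) {η : ProbabilityMeasure E} {a : ℝ} :
    I η ≤ a ↔ ∀ V, pairing V η - Q V ≤ a := by
  rw [h.eq_iSup, iSup_le_iff]
  simp only [EReal.coe_le_coe_iff]

variable {Ω : Type*} [MeasurableSpace Ω] {P : Measure Ω} [IsProbabilityMeasure P] {Y : ℕ → Ω → E}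
  [T2Space E] [CompactSpace (ProbabilityMeasure E)]

/-- The Legendre transform of `I` is `Q`: otherwise finitely many functions `V` would bound the
exponential moments of `W` by a rate below `Q W`. -/
lemma IsConjugate.eq_iSup_sub (h : IsConjugate I Q) (hQ : HasLogMoments P Y Q)
    (hY : ∀ n, Measurable (Y n)) (W : C(E, ℝ)) :
    (Q W : EReal) = ⨆ η, ((pairing W η : EReal) - I η) := by
  apply le_antisymm
  · by_contra! hlt
    obtain ⟨b, hb1, hb2⟩ := EReal.lt_iff_exists_real_btwn.1 hlt
    rw [EReal.coe_lt_coe_iff] at hb2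
    have hpt : ∀ η ∈ (Set.univ : Set (ProbabilityMeasure E)),
        ∃ V, pairing W η - (pairing V η - Q V) < b := by
      intro η _
      have h1 : (pairing W η : EReal) - I η < b :=
        (le_iSup (fun η => (pairing W η : EReal) - I η) η).trans_lt hb1
      have h2 : ((pairing W η - b : ℝ) : EReal) < I η := by
        rcases h.eq_top_or_coe η with hI | ⟨r, hI⟩
        · exact hI ▸ EReal.coe_lt_top _
        · rw [hI, ← EReal.coe_sub, EReal.coe_lt_coe_iff] at h1
          rw [hI, EReal.coe_lt_coe_iff]
          linarith
      obtain ⟨V, hV⟩ := h.exists_lt h2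
      exact ⟨V, by linarith⟩
    obtain ⟨F, b', hb', hF⟩ := exists_finset_cover isCompact_univ hpt
    have hε : 0 < (Q W - b) / 2 := by linarith
    obtain ⟨N, ⟨h1, -⟩, h2, hN⟩ := ((hQ.eventually_between hY W hε).and
      ((hQ.eventually_integral_dominating_le hY F hb').and (eventually_gt_atTop 0))).exists
    have hN' : (0 : ℝ) < N := by exact_mod_cast hN
    have h3 : ∫ ω, Real.exp (∑ n ∈ Finset.Icc 1 N, W (Y n ω)) ∂P
        ≤ ∫ ω, dominating Y Q F b' N ω ∂P :=
      integral_mono (integrable_exp_sum hY W N) (integrable_dominating hY F b' N) fun ω =>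
        (exp_sum_lt_dominating hF hN.ne' (Set.mem_univ
          ⟨_, isProbabilityMeasure_empirical (fun n => Y n ω) hN.ne'⟩) rfl).le
    have h4 := le_of_mul_le_mul_left (Real.exp_le_exp.1 (h1.trans (h3.trans h2))) hN'
    linarith
  · refine iSup_le fun η => ?_
    have h1 := h.le W η
    rcases h.eq_top_or_coe η with hI | ⟨r, hI⟩
    · rw [hI, EReal.sub_top]
      exact bot_le
    · rw [hI, EReal.coe_le_coe_iff] at h1
      rw [hI, ← EReal.coe_sub, EReal.coe_le_coe_iff]
      linarith

lemma IsConjugate.le_of_forall (h : IsConjugate I Q) (hQ : HasLogMoments P Y Q)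
    (hY : ∀ n, Measurable (Y n)) {W : C(E, ℝ)} {a : ℝ}
    (ha : ∀ (η : ProbabilityMeasure E) (i : ℝ), I η = i → pairing W η - i ≤ a) : Q W ≤ a := by
  rw [← EReal.coe_le_coe_iff, h.eq_iSup_sub hQ hY W]
  refine iSup_le fun η => ?_
  rcases h.eq_top_or_coe η with hI | ⟨r, hI⟩
  · rw [hI, EReal.sub_top]
    exact bot_le
  · rw [hI, ← EReal.coe_sub, EReal.coe_le_coe_iff]
    exact ha η r hI

lemma IsConjugate.convexOn (h : IsConjugate I Q) (hQ : HasLogMoments P Y Q)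
    (hY : ∀ n, Measurable (Y n)) : ConvexOn ℝ Set.univ Q := by
  refine ⟨convex_univ, fun V _ W _ a b ha hb hab => ?_⟩
  refine h.le_of_forall hQ hY fun η i hi => ?_
  have h1 := h.le V η
  have h2 := h.le W η
  rw [hi, EReal.coe_le_coe_iff] at h1 h2
  rw [pairing_add, pairing_smul, pairing_smul, smul_eq_mul, smul_eq_mul]
  have hi' : i = a * i + b * i := by rw [← add_mul, hab, one_mul]
  nlinarith [mul_le_mul_of_nonneg_left h1 ha, mul_le_mul_of_nonneg_left h2 hb]

lemma IsConjugate.lipschitzWith (h : IsConjugate I Q) (hQ : HasLogMoments P Y Q)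
    (hY : ∀ n, Measurable (Y n)) : LipschitzWith 1 Q := by
  refine LipschitzWith.of_le_add_mul 1 fun V W => ?_
  refine h.le_of_forall hQ hY fun η i hi => ?_
  have h1 := h.le W η
  rw [hi, EReal.coe_le_coe_iff] at h1
  have h2 : pairing V η ≤ pairing W η + dist V W := by
    calc pairing V η ≤ ∫ x, (W x + dist V W) ∂(η : Measure E) := by
          refine integral_mono (integrable_continuousMap V _)
            ((integrable_continuousMap W _).add (integrable_const _)) fun x => ?_
          have := (abs_le.1 ((Real.dist_eq (V x) (W x)).symm.trans_le
            (ContinuousMap.dist_apply_le_dist x))).2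
          change V x ≤ W x + dist V W
          linarith
      _ = pairing W η + dist V W := by
          rw [integral_add (integrable_continuousMap W _) (integrable_const _)]
          simp [pairing]
  rw [NNReal.coe_one, one_mul]
  linarith

end

/-! ### The upper bound for closed sets -/

lemma log_div_le {a : ℝ≥0∞} {N : ℕ} (hN : 0 < N) {c : ℝ}
    (h : a ≤ ENNReal.ofReal (Real.exp (N * c))) :
    ENNReal.log a / (N : EReal) ≤ c := by
  have h1 := ENNReal.log_le_log h
  rw [ENNReal.log_ofReal_of_pos (Real.exp_pos _), Real.log_exp] at h1
  rw [EReal.div_le_iff_le_mul (by exact_mod_cast hN) (EReal.natCast_ne_top N)]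
  exact_mod_cast h1

lemma le_log_div {a : ℝ≥0∞} {N : ℕ} (hN : 0 < N) {c : ℝ}
    (h : ENNReal.ofReal (Real.exp (N * c)) ≤ a) :
    (c : EReal) ≤ ENNReal.log a / (N : EReal) := by
  have h1 := ENNReal.log_le_log h
  rw [ENNReal.log_ofReal_of_pos (Real.exp_pos _), Real.log_exp] at h1
  rw [EReal.le_div_iff_mul_le (by exact_mod_cast hN) (EReal.natCast_ne_top N), mul_comm]
  exact_mod_cast h1

section

variable {E : Type*} [TopologicalSpace E] [CompactSpace E] [MeasurableSpace E] [BorelSpace E]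
  {Ω : Type*} [MeasurableSpace Ω] {P : Measure Ω} [IsProbabilityMeasure P] {Y : ℕ → Ω → E}
  {I : ProbabilityMeasure E → EReal} {Q : C(E, ℝ) → ℝ}

/-- The large deviations upper bound for compact sets. -/
theorem IsConjugate.limsup_le (h : IsConjugate I Q) (hQ : HasLogMoments P Y Q)
    (hY : ∀ n, Measurable (Y n)) {K : Set (ProbabilityMeasure E)} (hK : IsCompact K) :
    limsup (fun N : ℕ => ENNReal.log (P {ω | ∃ η ∈ K, (η : Measure E) =
      empirical (fun n => Y n ω) N}) / (N : EReal)) atTop ≤ -⨅ η ∈ K, I η := by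
  refine EReal.le_of_forall_lt_iff_le.1 fun z hz => ?_
  have hpt : ∀ η ∈ K, ∃ V, pairing 0 η - (pairing V η - Q V) < z := by
    intro η hη
    have h1 : ((-z : ℝ) : EReal) < I η := by
      refine lt_of_lt_of_le ?_ (iInf₂_le (f := fun η (_ : η ∈ K) => I η) η hη)
      rw [EReal.coe_neg]
      exact EReal.neg_lt_comm.1 hz
    obtain ⟨V, hV⟩ := h.exists_lt h1
    exact ⟨V, by rw [pairing_zero]; linarith⟩
  obtain ⟨F, b, hb, hF⟩ := exists_finset_cover hK hpt
  refine limsup_le_of_le (h := ?_)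
  filter_upwards [hQ.eventually_integral_dominating_le hY F hb, eventually_gt_atTop 0]
    with N hN hN0
  refine log_div_le hN0 ?_
  have hsub : {ω | ∃ η ∈ K, (η : Measure E) = empirical (fun n => Y n ω) N}
      ⊆ {ω | 1 ≤ dominating Y Q F b N ω} := by
    rintro ω ⟨η, hη, hemp⟩
    have := exp_sum_lt_dominating hF hN0.ne' hη hemp
    simpa using this.le
  have hmarkov := mul_meas_ge_le_integral_of_nonneg (μ := P) (f := dominating Y Q F b N)
    (ae_of_all _ fun ω => dominating_nonneg F b N ω) (integrable_dominating hY F b N) 1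
  rw [one_mul, measureReal_def] at hmarkov
  refine (measure_mono hsub).trans ?_
  exact (ENNReal.le_ofReal_iff_toReal_le (measure_ne_top _ _) (Real.exp_nonneg _)).2
    (hmarkov.trans hN)

end

/-! ### The lower bound for open sets -/

section

variable {E : Type*} [TopologicalSpace E] [CompactSpace E] [MeasurableSpace E] [BorelSpace E]
  [CompactSpace (ProbabilityMeasure E)]
  {Ω : Type*} [MeasurableSpace Ω] {P : Measure Ω} [IsProbabilityMeasure P] {Y : ℕ → Ω → E}
  {I : ProbabilityMeasure E → EReal} {Q : C(E, ℝ) → ℝ}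

/-- Tilting: the neighbourhoods of the equilibrium state of `W` carry the main part of the
exponential moment of `W`, since away from it the dominating sums grow at a rate below `Q W`. -/
lemma IsConjugate.eventually_le_of_equilibrium (h : IsConjugate I Q) (hQ : HasLogMoments P Y Q)
    (hY : ∀ n, Measurable (Y n)) {U : Set (ProbabilityMeasure E)} (hU : IsOpen U) {W : C(E, ℝ)}
    {η : ProbabilityMeasure E} (hη : η ∈ U) (heq : I η ≤ ((pairing W η - Q W : ℝ) : EReal))
    {ε : ℝ} (hε : 0 < ε) :
    ∀ᶠ N : ℕ in atTop, ENNReal.ofReal (Real.exp (N * (Q W - pairing W η - ε))) ≤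
      P {ω | ∃ η ∈ U, (η : Measure E) = empirical (fun n => Y n ω) N} := by
  -- on `O` the sum of `W` is controlled from above by its value under `η`
  set O : Set (ProbabilityMeasure E) := {η' | pairing W η' < pairing W η + ε / 3}
  have hO : IsOpen O := isOpen_lt (continuous_pairing W) continuous_const
  have hηO : η ∈ O := by
    change pairing W η < pairing W η + ε / 3
    linarith
  have hpt : ∀ η' ∈ (U ∩ O)ᶜ, ∃ V, pairing W η' - (pairing V η' - Q V) < Q W := by
    intro η' hη'
    have hlt : ((pairing W η' - Q W : ℝ) : EReal) < I η' := by
      by_contra! hle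
      exact hη' (h.unique W η' η hle heq ▸ ⟨hη, hηO⟩)
    obtain ⟨V, hV⟩ := h.exists_lt hlt
    exact ⟨V, by linarith⟩
  obtain ⟨F, b, hb, hF⟩ := exists_finset_cover (hU.inter hO).isClosed_compl.isCompact hpt
  -- the dominating sums grow at a rate at most `b + (Q W - b) / 3 ≤ Q W - 2 * ε'`, so they are
  -- negligible against the exponential moment of `W`
  set ε' : ℝ := min (ε / 3) ((Q W - b) / 3)
  have hε' : 0 < ε' := lt_min (by linarith) (by linarith)
  have hε1 : ε' ≤ ε / 3 := min_le_left _ _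
  have hε2 : ε' ≤ (Q W - b) / 3 := min_le_right _ _
  have hbc : b < b + (Q W - b) / 3 := by linarith
  have hhalf : ∀ᶠ N : ℕ in atTop, (2 : ℝ) ≤ Real.exp (N * ε') :=
    (Real.tendsto_exp_atTop.comp
      (tendsto_natCast_atTop_atTop.atTop_mul_const hε')).eventually_ge_atTop 2
  filter_upwards [hQ.eventually_between hY W hε', hQ.eventually_integral_dominating_le hY F hbc,
    hhalf, eventually_gt_atTop 0] with N hZ hG h2 hN0
  have hN0' : (0 : ℝ) < N := by exact_mod_cast hN0
  set S : Ω → ℝ := fun ω => ∑ n ∈ Finset.Icc 1 N, W (Y n ω)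
  set A : Set Ω := {ω | dominating Y Q F b N ω ≤ Real.exp (S ω)}
  have hA : MeasurableSet A :=
    measurableSet_le (measurable_dominating hY F b N) (measurable_exp_sum hY W N)
  have hAsub : ∀ ω ∈ A, ∃ η' ∈ U ∩ O, (η' : Measure E) = empirical (fun n => Y n ω) N := by
    intro ω hω
    refine ⟨⟨_, isProbabilityMeasure_empirical (fun n => Y n ω) hN0.ne'⟩, ?_, rfl⟩
    by_contra hnot
    exact absurd (exp_sum_lt_dominating hF hN0.ne' hnot rfl) (not_lt.2 hω)
  have hpoint : ∀ ω, Real.exp (S ω) ≤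
      A.indicator (fun _ => Real.exp (N * (pairing W η + ε / 3))) ω + dominating Y Q F b N ω := by
    intro ω
    by_cases hω : ω ∈ A
    · obtain ⟨η', ⟨-, hη'⟩, hemp⟩ := hAsub ω hω
      have h1 : S ω ≤ N * (pairing W η + ε / 3) := by
        change ∑ n ∈ Finset.Icc 1 N, W (Y n ω) ≤ _
        rw [← mul_pairing_empirical hN0.ne' hemp W]
        exact mul_le_mul_of_nonneg_left (le_of_lt hη') hN0'.le
      rw [Set.indicator_of_mem hω]
      linarith [Real.exp_le_exp.2 h1, dominating_nonneg (Y := Y) (Q := Q) F b N ω]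
    · rw [Set.indicator_of_notMem hω, zero_add]
      exact (not_le.1 hω).le
  have hint : ∫ ω, Real.exp (S ω) ∂P
      ≤ P.real A * Real.exp (N * (pairing W η + ε / 3)) + ∫ ω, dominating Y Q F b N ω ∂P := by
    rw [← smul_eq_mul, ← integral_indicator_const _ hA, ← integral_add
      ((integrable_const _).indicator hA) (integrable_dominating hY F b N)]
    exact integral_mono (integrable_exp_sum hY W N)
      (((integrable_const _).indicator hA).add (integrable_dominating hY F b N)) hpoint
  have hreal : Real.exp (N * (Q W - pairing W η - ε)) ≤ P.real A := by
    set x := Real.exp (N * (Q W - 2 * ε'))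
    have e1 : Real.exp (N * (Q W - ε')) = x * Real.exp (N * ε') := by
      rw [← Real.exp_add]
      congr 1
      ring
    have e2 : Real.exp (N * (b + (Q W - b) / 3)) ≤ x :=
      Real.exp_le_exp.2 (mul_le_mul_of_nonneg_left (by linarith) hN0'.le)
    have e3 : x * 2 ≤ x * Real.exp (N * ε') := mul_le_mul_of_nonneg_left h2 (Real.exp_nonneg _)
    have e4 : x ≤ P.real A * Real.exp (N * (pairing W η + ε / 3)) := by
      linarith [hZ.1.trans hint]
    have e5 : Real.exp (N * (Q W - pairing W η - ε)) *
        Real.exp (N * (pairing W η + ε / 3)) ≤ x := by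
      rw [← Real.exp_add, ← mul_add]
      exact Real.exp_le_exp.2 (mul_le_mul_of_nonneg_left (by linarith) hN0'.le)
    exact le_of_mul_le_mul_right (e5.trans e4) (Real.exp_pos _)
  refine (ENNReal.ofReal_le_ofReal hreal).trans ?_
  rw [measureReal_def, ENNReal.ofReal_toReal (measure_ne_top _ _)]
  exact measure_mono fun ω hω => (hAsub ω hω).imp fun η' h' => ⟨h'.1.1, h'.2⟩

/-- The convex combination of two probability measures. -/
noncomputable def convexCombo (s : ℝ) (hs : s ∈ Set.Icc (0 : ℝ) 1) (η η' : ProbabilityMeasure E) :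
    ProbabilityMeasure E :=
  ⟨ENNReal.ofReal (1 - s) • (η : Measure E) + ENNReal.ofReal s • (η' : Measure E), ⟨by
    simp only [Measure.add_apply, Measure.smul_apply, measure_univ, smul_eq_mul, mul_one]
    rw [← ENNReal.ofReal_add (by linarith [hs.2]) hs.1, sub_add_cancel, ENNReal.ofReal_one]⟩⟩

lemma pairing_convexCombo {s : ℝ} (hs : s ∈ Set.Icc (0 : ℝ) 1) (η η' : ProbabilityMeasure E)
    (V : C(E, ℝ)) :
    pairing V (convexCombo s hs η η') = (1 - s) * pairing V η + s * pairing V η' := by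
  change ∫ x, V x ∂(ENNReal.ofReal (1 - s) • (η : Measure E) +
    ENNReal.ofReal s • (η' : Measure E)) = _
  rw [integral_add_measure ((integrable_continuousMap V _).smul_measure ENNReal.ofReal_ne_top)
    ((integrable_continuousMap V _).smul_measure ENNReal.ofReal_ne_top),
    integral_smul_measure, integral_smul_measure, ENNReal.toReal_ofReal (by linarith [hs.2]),
    ENNReal.toReal_ofReal hs.1]
  rfl

lemma nonneg_of_forall_add_mul {a b : ℝ} (h : ∀ s : ℝ, 0 < s → s ≤ 1 → 0 ≤ a + s * b) : 0 ≤ a := by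
  have h1 : Tendsto (fun s : ℝ => a + s * b) (𝓝[>] 0) (𝓝 (a + 0 * b)) :=
    ((continuous_const.add (continuous_id.mul continuous_const)).tendsto 0).mono_left
      nhdsWithin_le_nhds
  rw [zero_mul, add_zero] at h1
  refine ge_of_tendsto h1 ?_
  filter_upwards [Ioc_mem_nhdsGT (zero_lt_one' ℝ)] with s hs
  exact h s hs.1 hs.2

/-- The squared distance between the integrals of finitely many functions under two measures. -/
noncomputable def sqDist (F : Finset C(E, ℝ)) (η η' : ProbabilityMeasure E) : ℝ :=
  ∑ V ∈ F, (pairing V η' - pairing V η) ^ 2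

lemma sqDist_nonneg (F : Finset C(E, ℝ)) (η η' : ProbabilityMeasure E) : 0 ≤ sqDist F η η' :=
  Finset.sum_nonneg fun _ _ => sq_nonneg _

lemma continuous_sqDist (F : Finset C(E, ℝ)) (η : ProbabilityMeasure E) :
    Continuous (sqDist F η) :=
  continuous_finsetSum _ fun V _ => ((continuous_pairing V).sub continuous_const).pow 2

/-- Outside a neighbourhood of `η` some finite family of integrals stays away from its values
at `η`. -/
lemma exists_le_sqDist [HasOuterApproxClosed E] {U : Set (ProbabilityMeasure E)} (hU : IsOpen U)
    {η : ProbabilityMeasure E} (hη : η ∈ U) :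
    ∃ (F : Finset C(E, ℝ)) (ρ : ℝ), 0 < ρ ∧ ∀ η' ∉ U, ρ ≤ sqDist F η η' := by
  have hK : IsCompact Uᶜ := hU.isClosed_compl.isCompact
  obtain ⟨F, hF⟩ := hK.elim_finite_subcover (fun V : C(E, ℝ) => {η' | pairing V η' ≠ pairing V η})
    (fun V => isOpen_ne_fun (continuous_pairing V) continuous_const) (fun η' hη' => by
      by_contra hnot
      simp only [Set.mem_iUnion, Set.mem_ofPred_eq, not_exists, not_not] at hnot
      have heq : (η' : Measure E) = η :=
        ext_of_forall_integral_eq_of_IsFiniteMeasure fun f => hnot f.toContinuousMap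
      exact hη' (Subtype.ext (a1 := η') (a2 := η) heq ▸ hη))
  rcases Set.eq_empty_or_nonempty Uᶜ with hempty | hne
  · exact ⟨F, 1, one_pos, fun η' hη' => absurd (show η' ∈ Uᶜ from hη') (hempty ▸ id)⟩
  obtain ⟨η₀, hη₀, hmin⟩ := hK.exists_isMinOn hne (continuous_sqDist F η).continuousOn
  refine ⟨F, sqDist F η η₀, ?_, fun η' hη' => hmin hη'⟩
  obtain ⟨V, hV, hne⟩ := Set.mem_iUnion₂.1 (hF hη₀)
  exact Finset.sum_pos' (fun _ _ => sq_nonneg _)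
    ⟨V, hV, by have := sub_ne_zero.2 hne; positivity⟩

/-- Every neighbourhood of `η` contains an equilibrium state with at most the rate of `η`: it is
found by minimising `I` plus a large multiple of the squared distance to `η`; the first order
condition at the minimiser `η'` shows that it is the equilibrium state of minus the derivative of
the penalty. -/
lemma IsConjugate.exists_equilibrium [HasOuterApproxClosed E] [T2Space E] (h : IsConjugate I Q)
    (hQ : HasLogMoments P Y Q) (hY : ∀ n, Measurable (Y n)) {U : Set (ProbabilityMeasure E)}
    (hU : IsOpen U) {η : ProbabilityMeasure E} (hη : η ∈ U) {r : ℝ} (hr : I η ≤ r) :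
    ∃ (W : C(E, ℝ)), ∃ η' ∈ U, I η' ≤ r ∧ I η' ≤ ((pairing W η' - Q W : ℝ) : EReal) := by
  obtain ⟨F, ρ, hρ, hF⟩ := exists_le_sqDist hU hη
  -- `I ≥ -Q 0`, so with this weight the penalty outside `U` exceeds the value at `η`
  set t : ℝ := (|r + Q 0| + 1) / ρ
  have ht : 0 < t := by positivity
  have htρ : t * ρ = |r + Q 0| + 1 := div_mul_cancel₀ _ hρ.ne'
  set J : ProbabilityMeasure E → EReal := fun η' =>
    ⨆ V : C(E, ℝ), ((pairing V η' - Q V + t * sqDist F η η' : ℝ) : EReal)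
  have hJlsc : LowerSemicontinuous J := lowerSemicontinuous_iSup fun V =>
    (continuous_coe_real_ereal.comp (((continuous_pairing V).sub continuous_const).add
      (continuous_const.mul (continuous_sqDist F η)))).lowerSemicontinuous
  obtain ⟨η', -, hmin⟩ := (hJlsc.lowerSemicontinuousOn Set.univ).exists_isMinOn
    ⟨η, Set.mem_univ η⟩ isCompact_univ
  have hJle : ∀ (ξ : ProbabilityMeasure E) (a : ℝ), I ξ ≤ a →
      J ξ ≤ ((a + t * sqDist F η ξ : ℝ) : EReal) := by
    intro ξ a ha
    refine iSup_le fun V => EReal.coe_le_coe_iff.2 ?_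
    linarith [h.le_coe_iff.1 ha V]
  have hJge : ∀ (ξ : ProbabilityMeasure E) (a : ℝ), J ξ ≤ a →
      I ξ ≤ ((a - t * sqDist F η ξ : ℝ) : EReal) := by
    intro ξ a ha
    refine h.le_coe_iff.2 fun V => ?_
    have := EReal.coe_le_coe_iff.1 ((le_iSup (fun V : C(E, ℝ) =>
      ((pairing V ξ - Q V + t * sqDist F η ξ : ℝ) : EReal)) V).trans ha)
    linarith
  have hηη : sqDist F η η = 0 := by simp [sqDist]
  have hη'1 : I η' ≤ ((r - t * sqDist F η η' : ℝ) : EReal) := by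
    refine hJge η' r ((hmin (Set.mem_univ η)).trans ?_)
    simpa [hηη] using hJle η r hr
  have hnn := sqDist_nonneg F η η'
  have hη'r : I η' ≤ r := hη'1.trans (EReal.coe_le_coe_iff.2 (by nlinarith))
  have hη'U : η' ∈ U := by
    by_contra hnot
    have h1 := hF η' hnot
    have h2 := h.le_coe_iff.1 hη'1 0
    rw [pairing_zero] at h2
    nlinarith [le_abs_self (r + Q 0), mul_le_mul_of_nonneg_left h1 ht.le]
  obtain ⟨i, hi⟩ : ∃ i : ℝ, I η' = i :=
    (h.eq_top_or_coe η').resolve_left (hη'r.trans_lt (EReal.coe_lt_top r)).ne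
  -- the derivative of `t * sqDist F η` at `η'` is `2 t ∑ d V • V`
  set d : C(E, ℝ) → ℝ := fun V => pairing V η' - pairing V η
  refine ⟨∑ V ∈ F, (-2 * t * d V) • V, η', hη'U, hη'r, ?_⟩
  rw [hi, EReal.coe_le_coe_iff, le_sub_comm]
  refine h.le_of_forall hQ hY fun ξ j hj => ?_
  set e : C(E, ℝ) → ℝ := fun V => pairing V ξ - pairing V η'
  have hpair : pairing (∑ V ∈ F, (-2 * t * d V) • V) ξ
      = pairing (∑ V ∈ F, (-2 * t * d V) • V) η' - 2 * t * ∑ V ∈ F, d V * e V := by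
    simp only [pairing_sum, pairing_smul, Finset.mul_sum, ← Finset.sum_sub_distrib]
    refine Finset.sum_congr rfl fun V _ => ?_
    simp only [e]
    ring
  -- compare the minimiser with the convex combinations of `η'` and `ξ`
  have hfirst : 0 ≤ j - i + 2 * t * ∑ V ∈ F, d V * e V := by
    refine nonneg_of_forall_add_mul (b := t * ∑ V ∈ F, e V ^ 2) fun s hs0 hs1 => ?_
    have hs : s ∈ Set.Icc (0 : ℝ) 1 := ⟨hs0.le, hs1⟩
    have h1 : I (convexCombo s hs η' ξ) ≤ (((1 - s) * i + s * j : ℝ) : EReal) := by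
      refine h.le_coe_iff.2 fun V => ?_
      have hi' := h.le_coe_iff.1 hi.le V
      have hj' := h.le_coe_iff.1 hj.le V
      rw [pairing_convexCombo]
      nlinarith [mul_le_mul_of_nonneg_left hi' (sub_nonneg.2 hs1),
        mul_le_mul_of_nonneg_left hj' hs0.le]
    have h3 := hJge η' _ ((hmin (Set.mem_univ _)).trans (hJle _ _ h1))
    rw [hi, EReal.coe_le_coe_iff] at h3
    have h4 : sqDist F η (convexCombo s hs η' ξ)
        = sqDist F η η' + s * (2 * ∑ V ∈ F, d V * e V) + s ^ 2 * ∑ V ∈ F, e V ^ 2 := by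
      simp only [sqDist, Finset.mul_sum, ← Finset.sum_add_distrib, pairing_convexCombo]
      refine Finset.sum_congr rfl fun V _ => ?_
      simp only [d, e]
      ring
    rw [h4] at h3
    refine nonneg_of_mul_nonneg_right (a := s) ?_ hs0
    nlinarith
  rw [hpair]
  linarith

/-- The large deviations lower bound for open sets. -/
theorem IsConjugate.le_liminf [HasOuterApproxClosed E] [T2Space E] (h : IsConjugate I Q)
    (hQ : HasLogMoments P Y Q) (hY : ∀ n, Measurable (Y n)) {U : Set (ProbabilityMeasure E)}
    (hU : IsOpen U) :
    -⨅ η ∈ U, I η ≤ liminf (fun N : ℕ => ENNReal.log (P {ω | ∃ η ∈ U, (η : Measure E) =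
      empirical (fun n => Y n ω) N}) / (N : EReal)) atTop := by
  rw [EReal.neg_le]
  refine le_iInf₂ fun η hη => ?_
  rw [EReal.neg_le]
  rcases h.eq_top_or_coe η with hI | ⟨r, hr⟩
  · rw [hI, EReal.neg_top]
    exact bot_le
  obtain ⟨W, η', hη', hle, heq⟩ := h.exists_equilibrium hQ hY hU hη hr.le
  rw [hr]
  refine EReal.ge_of_forall_gt_iff_ge.1 fun z hz => ?_
  rw [← EReal.coe_neg, EReal.coe_lt_coe_iff] at hz
  have hW := h.le_coe_iff.1 hle W
  refine le_liminf_of_le (h := ?_)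
  filter_upwards [h.eventually_le_of_equilibrium hQ hY hU hη' heq (sub_pos.2 hz),
    eventually_gt_atTop 0] with N hN hN0
  refine le_log_div hN0 (le_trans (ENNReal.ofReal_le_ofReal (Real.exp_le_exp.2
    (mul_le_mul_of_nonneg_left ?_ (Nat.cast_nonneg N)))) hN)
  linarith

end

/-! ### The limit functional of the nonconventional sums -/

section

variable {M : Type*} [TopologicalSpace M] [CompactSpace M] [PolishSpace M] [MeasurableSpace M]
  [BorelSpace M] {κ : Kernel M M} [IsMarkovKernel κ] {μ : Measure M} [IsProbabilityMeasure μ]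
  {m : ℕ}

/-- The logarithms of the principal eigenvalues of the tilted product chain are conjugate to the
rate functional. -/
lemma exists_isConjugate_rate (hκ : StrongDoeblin κ) (hμ : κ.Invariant μ) :
    ∃ Q : C(Fin (m + 1) → M, ℝ) → ℝ,
      IsConjugate (fun η => rate κ μ (η : Measure (Fin (m + 1) → M))) Q ∧
      ∀ W : C(Fin (m + 1) → M, ℝ), ∃ h, IsEigen (productKernel m κ μ) W (Q W) h := by
  obtain ⟨x⟩ : Nonempty M := nonempty_of_isProbabilityMeasure μ
  have : Nonempty (Fin (m + 1) → M) := ⟨fun _ => x⟩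
  obtain ⟨n₀, D, hD, hT⟩ := exists_comparable (m := m) hκ hμ
  choose Q hQ using fun W : C(Fin (m + 1) → M, ℝ) => exists_isEigen hD hT W.bddMeas
  refine ⟨Q, ⟨fun η => ?_, fun W η η' hη hη' => ?_⟩, hQ⟩
  · rw [← dvRate_productKernel]
    refine le_antisymm (dvRate_le_iSup hD hT (productKernel_invariant hμ) hQ _)
      (iSup_le fun W => ?_)
    obtain ⟨h, he⟩ := hQ W
    exact he.integral_sub_le_dvRate W.bddMeas η
  · rw [← dvRate_productKernel] at hη hη'
    obtain ⟨h, he⟩ := hQ W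
    exact Subtype.ext (equilibrium_unique hD hT W.bddMeas he η η' hη hη')

/-- The sums along the sampling times of a Markov chain have `Q` as limiting logarithmic moment
generating functional, whatever the initial distribution. -/
lemma hasLogMoments_samplePoint (hκ : StrongDoeblin κ) (hμ : κ.Invariant μ)
    {q : Fin (m + 1) → ℝ → ℝ} (hq : TimeChanges q) {Q : C(Fin (m + 1) → M, ℝ) → ℝ}
    (heig : ∀ W : C(Fin (m + 1) → M, ℝ), ∃ h, IsEigen (productKernel m κ μ) W (Q W) h)
    {Ω : Type*} [MeasurableSpace Ω] {P : Measure Ω} [IsProbabilityMeasure P] {X : ℕ → Ω → M}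
    (hX : IsMarkovChain κ P X) :
    HasLogMoments P (fun n ω => samplePoint q (fun i => X i ω) n) Q := by
  have hXm : Measurable fun ω n => X n ω := measurable_pi_lambda _ hX.measurable
  have : IsProbabilityMeasure (P.map fun ω n => X n ω) :=
    Measure.isProbabilityMeasure_map hXm.aemeasurable
  intro W
  obtain ⟨h, he⟩ := heig W
  refine (tendsto_log_moment hκ hμ hq hX.isMarkovLaw W.bddMeas he).congr fun N => ?_
  rw [integral_map hXm.aemeasurable
    (measurable_exp_sum (measurable_samplePoint q) W N).aestronglyMeasurable]

end

end Nonconventional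

theorem theorem2p2 {M : Type*} [TopologicalSpace M] [CompactSpace M] [PolishSpace M]
    [MeasurableSpace M] [BorelSpace M]
    (κ : Kernel M M) [IsMarkovKernel κ] (hκ : Nonconventional.StrongDoeblin κ)
    (μ : Measure M) [IsProbabilityMeasure μ] (hμ : κ.Invariant μ)
    {m : ℕ} (q : Fin (m + 1) → ℝ → ℝ) (hq : Nonconventional.TimeChanges q)
    {Ω : Type*} [MeasurableSpace Ω] (P : Measure Ω) [IsProbabilityMeasure P]
    (X : ℕ → Ω → M) (hX : Nonconventional.IsMarkovChain κ P X) :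
    (∃ Q : C(Fin (m + 1) → M, ℝ) → ℝ,
      (∀ (W : C(Fin (m + 1) → M, ℝ)) (x : M),
        Tendsto (fun N : ℕ => (1 / (N : ℝ)) *
          Real.log (∫ w, Real.exp (∑ n ∈ Finset.Icc 1 N, W (Nonconventional.samplePoint q w n))
            ∂(Nonconventional.pathMeasure κ x))) atTop (𝓝 (Q W))) ∧
      ConvexOn ℝ Set.univ Q ∧
      LowerSemicontinuous Q ∧
      ∀ W : C(Fin (m + 1) → M, ℝ),
        (Q W : EReal) = ⨆ η : ProbabilityMeasure (Fin (m + 1) → M),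
          (((∫ x, W x ∂(η : Measure (Fin (m + 1) → M)) : ℝ) : EReal)
            - Nonconventional.rate κ μ (η : Measure (Fin (m + 1) → M)))) ∧
    (∀ K : Set (ProbabilityMeasure (Fin (m + 1) → M)), IsClosed K →
      limsup (fun N : ℕ => ENNReal.log (P {ω | ∃ η ∈ K, (η : Measure (Fin (m + 1) → M)) =
          Nonconventional.occupationalMeasure q (fun n => X n ω) N}) / (N : EReal)) atTop
        ≤ -⨅ η ∈ K, Nonconventional.rate κ μ (η : Measure (Fin (m + 1) → M))) ∧
    (∀ U : Set (ProbabilityMeasure (Fin (m + 1) → M)), IsOpen U →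
      -⨅ η ∈ U, Nonconventional.rate κ μ (η : Measure (Fin (m + 1) → M))
        ≤ liminf (fun N : ℕ => ENNReal.log (P {ω | ∃ η ∈ U, (η : Measure (Fin (m + 1) → M)) =
          Nonconventional.occupationalMeasure q (fun n => X n ω) N}) / (N : EReal)) atTop) := by
  obtain ⟨Q, hIQ, heig⟩ := Nonconventional.exists_isConjugate_rate (m := m) hκ hμ
  have hQ := Nonconventional.hasLogMoments_samplePoint hκ hμ hq heig hX
  have hY : ∀ n, Measurable fun ω => Nonconventional.samplePoint q (fun i => X i ω) n := fun n =>
    (Nonconventional.measurable_samplePoint q n).comp (measurable_pi_lambda _ hX.measurable)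
  refine ⟨⟨Q, fun W x => ?_, hIQ.convexOn hQ hY,
    (hIQ.lipschitzWith hQ hY).continuous.lowerSemicontinuous, fun W => hIQ.eq_iSup_sub hQ hY W⟩,
    fun K hK => hIQ.limsup_le hQ hY hK.isCompact, fun U hU => hIQ.le_liminf hQ hY hU⟩
  obtain ⟨h, he⟩ := heig W
  exact Nonconventional.tendsto_log_moment hκ hμ hq
    (Nonconventional.isMarkovLaw_pathMeasure κ x) W.bddMeas he
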